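/- **Circuit model.** A circuit acts on data qubits and on finitely many ancilla qubits, which are supplied in the states $|0\rangle$, $|+\rangle$, $T|+\rangle$ and $CCZ|{+}{+}{+}\rangle$. It is a finite sequence of instructions of the following kinds: measurement of a two-qubit Pauli operator (any element of $\{I,X,Y,Z\}^{\otimes 2}$ on two distinct qubits); measurement of one qubit in the $X$ or $Z$ basis; a single-qubit Pauli gate; a two-input Boolean gate on classical bits (all of which start as $0$). Measurement bases and Pauli gates may depend on classical bits, and hence on earlier outcomes. A two-qubit Pauli measurement takes one logical cycle; the other instructions take none. $\mathrm{LogicalDepth}(V)$ is the number of logical cycles when each instruction of $V$ is executed as soon as its qubits are free from the earlier instructions and the classical bits it reads are known. The size of a circuit is its number of supplied ancilla states plus its number of instructions. For a circuit $V$ with measurement outcomes $o$, let $K_o$ be the (linear) map from data states to unnormalized final states of data and ancilla qubits. $V$ *implements* a unitary $U$ with accuracy $\delta$ if there are ancilla vectors $\chi_o$, independent of the input, with $\sum_o\|\chi_o\|^2=1$ and $\sum_o\|K_o\varphi-U\varphi\otimes\chi_o\|^2\le\delta^2\|\varphi\|^2$ for all $\varphi$. $V$ is *$Z$-equivalent*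 to $U$ with accuracy $\delta$ if the same holds after $K_o$ is replaced by $Z^{a(o)}K_o$, where $Z^{a(o)}$ is a product of Pauli-$Z$ gates on data qubits, each controlled by a sum modulo 2 of classical bits held by $V$ at its end. For $\delta=0$ the implementation or $Z$-equivalence is exact. **Phaser.** Let $C_1,\dots,C_m$ be disjunctions of $k$ literals in $n$ Boolean variables, let $Q_j$ be the set of qubits of the variables in $C_j$, and for $\gamma\in\mathbb R$ let $$U_j=\sum_{x\in\{0,1\}^n}e^{-i\gamma C_j(x)}|x\rangle\langle x|,\qquad U_C=\prod_{j=1}^m U_j .$$ **Statement.** There is a universal constant $A$ such that the following holds for all $n,m,k\ge 0$, all $\gamma\in\mathbb R$, $\delta\ge0$ and all clauses as above. Suppose that $\{C_1,\dots,C_m\}$ (indexed by $j$) is partitioned into $c$ parts such that $Q_i\cap Q_j=\emptyset$ whenever $i\ne j$ and $C_i,C_j$ lie in the same part. Let $P$ be a circuit of logical depth $n_P$ that implements the single-qubit phase gate $P_1(\gamma)=e^{i\gamma|1\rangle\langle1|}$ with accuracy $\delta$. Then there are circuits $V_1,\dots,V_m$, each $V_j$ being $Z$-equivalent to $U_j$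 with accuracy $\delta$ and of size at most $A\,(k+\mathrm{size}(P)+1)^A$, such that their product $V_C=\prod_jV_j$ (composition in a suitable order, on shared data qubits and separate ancilla qubits and classical bits) is $Z$-equivalent to the phaser $U_C$ with accuracy $m\delta$ and satisfies $$\mathrm{LogicalDepth}(V_C)\le c+n_P+4\lceil\log_2k\rceil,$$ where $\lceil\log_2 0\rceil$ is read as $0$. In particular, if $\delta=0$ then $V_j$ and $V_C$ are exactly $Z$-equivalent to $U_j$ and $U_C$. -/

import Mathlib

/-! ## Adaptive lattice-surgery circuits

A circuit acts on a set `D` of data qubits and on ancilla qubits that start out in `|0⟩`, `|+⟩`,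
`T` or `CCZ` states.  It is a list of (adaptive) Pauli measurements, conditional Pauli gates and
classical Boolean gates.  A two-qubit Pauli measurement takes one logical cycle. -/

namespace LatticeSurgery

/-- The states in which ancilla qubits can be supplied. -/
inductive AncillaState : Type
  | zero
  | plus
  | tState
  | cczState

/-- The number of qubits of an ancilla state. -/
def AncillaState.arity : AncillaState → ℕ
  | .zero => 1
  | .plus => 1
  | .tState => 1
  | .cczState => 3

/-- Amplitudes in the computational basis of `|0⟩`, `|+⟩`, `T|+⟩` and `CCZ|+++⟩`. -/
noncomputable def AncillaState.amplitude : (s : AncillaState) → (Fin s.arity → Bool) → ℂ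
  | .zero, y => if y = fun _ => false then 1 else 0
  | .plus, _ => 1 / (Real.sqrt 2 : ℂ)
  | .tState, y =>
      (if y = fun _ => true then Complex.exp (Complex.I * (Real.pi / 4 : ℝ)) else 1)
        / (Real.sqrt 2 : ℂ)
  | .cczState, y => (if y = fun _ => true then -1 else 1) / (Real.sqrt 8 : ℂ)

/-- Instructions on qubits `Q` and classical bits `B`.  All measurement bases and all Pauli gates
may depend on classical bits, and hence on earlier measurement outcomes. -/
inductive Instr (Q B : Type) : Type
  /-- Measure the Pauli operator `σ(x,z)` on `q` times `σ(x',z')` on `q'`, where the four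
  bits are read from classical memory and `σ(0,0) = I`, `σ(1,0) = X`, `σ(0,1) = Z`, `σ(1,1) = Y`;
  store the outcome in `out`. -/
  | measure2 (q q' : Q) (hq : q ≠ q') (x z x' z' out : B)
  /-- Measure `q` in the `X` basis if the bit `basis` is set, and in the `Z` basis otherwise;
  store the outcome in `out`. -/
  | measure1 (q : Q) (basis out : B)
  /-- Apply `σ(x,z)` to `q`, with `x` and `z` read from classical memory. -/
  | pauli (q : Q) (x z : B)
  /-- Set the bit `out` to `f a b`. -/
  | classical (f : Bool → Bool → Bool) (a b out : B)

namespace Instr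

variable {Q B Q' B' : Type}

/-- Rename qubits and classical bits. -/
def relabel (f : Q ↪ Q') (g : B → B') : Instr Q B → Instr Q' B'
  | .measure2 q q' hq x z x' z' out =>
      .measure2 (f q) (f q') (fun h => hq (f.injective h)) (g x) (g z) (g x') (g z') (g out)
  | .measure1 q basis out => .measure1 (f q) (g basis) (g out)
  | .pauli q x z => .pauli (f q) (g x) (g z)
  | .classical h a b out => .classical h (g a) (g b) (g out)

def isMeasurement : Instr Q B → Bool
  | .measure2 .. => true
  | .measure1 .. => true
  | .pauli .. => false
  | .classical .. => false

end Instr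

section Semantics

variable {Q B : Type} [DecidableEq Q] [DecidableEq B]

/-- The Pauli operator `σ(x,z)` on qubit `q`, acting on amplitude functions. -/
noncomputable def pauliOp (x z : Bool) (q : Q) (ψ : (Q → Bool) → ℂ) : (Q → Bool) → ℂ :=
  fun s => (if z && s q then -1 else 1) * (if x && z then -Complex.I else 1) *
    ψ (if x then Function.update s q (!(s q)) else s)

/-- Contents of the classical memory, and the unnormalized quantum state of one branch. -/
structure Config (Q B : Type) : Type where
  mem : B → Bool
  amp : (Q → Bool) → ℂ

/-- Execute one instruction.  If it is a measurement of `P`, then `o` is the outcome of the branch,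
and the state is multiplied by the projector `(1 + (-1)^o P) / 2`. -/
noncomputable def Instr.step : Instr Q B → Bool → Config Q B → Config Q B
  | .measure2 q q' _ x z x' z' out, o, c =>
      { mem := Function.update c.mem out o
        amp := fun s => (c.amp s + (if o then -1 else 1) *
          pauliOp (c.mem x) (c.mem z) q (pauliOp (c.mem x') (c.mem z') q' c.amp) s) / 2 }
  | .measure1 q basis out, o, c =>
      { mem := Function.update c.mem out o
        amp := fun s => (c.amp s + (if o then -1 else 1) *
          pauliOp (c.mem basis) (!(c.mem basis)) q c.amp s) / 2 }
  | .pauli q x z, _, c => { mem := c.mem, amp := pauliOp (c.mem x) (c.mem z) q c.amp }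
  | .classical f a b out, _, c =>
      { mem := Function.update c.mem out (f (c.mem a) (c.mem b)), amp := c.amp }

/-- Execute a list of instructions along the branch with the given list of outcomes. -/
noncomputable def run : List (Instr Q B) → List Bool → Config Q B → Config Q B
  | [], _, c => c
  | I :: l, os, c =>
      if I.isMeasurement then run l os.tail (I.step (os.headD false) c)
      else run l os (I.step false c)

/-- The logical cycle after which each qubit is free, and each classical bit is known. -/
structure Clock (Q B : Type) : Type where
  qubit : Q → ℕ
  bit : B → ℕ

/-- Schedule one instruction as early as its qubits and the classical bits it reads allow.
A two-qubit measurement takes one logical cycle; single-qubit `X` and `Z` measurements, Pauli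
gates (which are only tracked) and classical gates take none. -/
def Instr.tick (t : Clock Q B) : Instr Q B → Clock Q B
  | .measure2 q q' _ x z x' z' out =>
      let e := max (max (t.qubit q) (t.qubit q'))
        (max (max (t.bit x) (t.bit z)) (max (t.bit x') (t.bit z'))) + 1
      { qubit := Function.update (Function.update t.qubit q e) q' e
        bit := Function.update t.bit out e }
  | .measure1 q basis out =>
      let e := max (t.qubit q) (t.bit basis)
      { qubit := Function.update t.qubit q e, bit := Function.update t.bit out e }
  | .pauli q x z =>
      let e := max (t.qubit q) (max (t.bit x) (t.bit z))
      { qubit := Function.update t.qubit q e, bit := t.bit }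
  | .classical _ a b out =>
      { qubit := t.qubit, bit := Function.update t.bit out (max (t.bit a) (t.bit b)) }

end Semantics

/-- A circuit on the data qubits `D`, with finitely many ancilla states indexed by `R`,
classical bits `B`, and a list of instructions. -/
structure Circuit (D : Type) : Type 1 where
  R : Type
  B : Type
  fintypeR : Fintype R
  decEqR : DecidableEq R
  decEqB : DecidableEq B
  res : R → AncillaState
  instrs : List (Instr (D ⊕ (Σ r : R, Fin (res r).arity)) B)

attribute [instance] Circuit.fintypeR Circuit.decEqR Circuit.decEqB

namespace Circuit

variable {D : Type}

/-- The ancilla qubits of a circuit. -/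
abbrev Anc (V : Circuit D) : Type := Σ r : V.R, Fin (V.res r).arity

/-- The number of ancilla states and instructions (classical gates included). -/
def size (V : Circuit D) : ℕ := Fintype.card V.R + V.instrs.length

/-- The sequences of measurement outcomes. -/
abbrev Outcome (V : Circuit D) : Type := Fin (V.instrs.countP Instr.isMeasurement) → Bool

/-- The total number of logical cycles, when every instruction is executed as early as possible. -/
def logicalDepth [Fintype D] [DecidableEq D] (V : Circuit D) : ℕ :=
  Finset.univ.sup
    (V.instrs.foldl Instr.tick { qubit := fun _ => 0, bit := fun _ => 0 }).qubit

/-- Run the circuit on data state `φ` along the branch `o`: all classical bits start as `0`. -/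
noncomputable def exec [DecidableEq D] (V : Circuit D) (o : V.Outcome) (φ : (D → Bool) → ℂ) :
    Config (D ⊕ V.Anc) V.B :=
  run V.instrs (List.ofFn o)
    { mem := fun _ => false
      amp := fun s => φ (fun d => s (.inl d)) *
        ∏ r, (V.res r).amplitude (fun i => s (.inr ⟨r, i⟩)) }

/-- The state of branch `o` after the Pauli corrections `∏_d ∏_{b ∈ corr d} Z_d ^ b`. -/
noncomputable def corrected [Fintype D] [DecidableEq D] (V : Circuit D)
    (corr : D → Finset V.B) (o : V.Outcome) (φ : (D → Bool) → ℂ) (s : D ⊕ V.Anc → Bool) : ℂ :=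
  (∏ d, ∏ b ∈ corr d, if (V.exec o φ).mem b && s (.inl d) then -1 else 1) * (V.exec o φ).amp s

/-- The circuit `V`, followed by the `Z` corrections `corr`, acts on the data qubits as `U` with
accuracy `δ`: as an isometry into data qubits, ancilla qubits and outcome record it is within
`δ`, in operator norm, of `U ⊗ |χ⟩` for a unit vector `χ` that does not depend on the input. -/
def Realizes [Fintype D] [DecidableEq D] (V : Circuit D) (corr : D → Finset V.B)
    (U : Matrix (D → Bool) (D → Bool) ℂ) (δ : ℝ) : Prop :=
  ∃ χ : V.Outcome → (V.Anc → Bool) → ℂ, (∑ o, ∑ y, ‖χ o y‖ ^ 2 = 1) ∧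
    ∀ φ : (D → Bool) → ℂ,
      ∑ o, ∑ s : D ⊕ V.Anc → Bool,
        ‖V.corrected corr o φ s -
          U.mulVec φ (fun d => s (.inl d)) * χ o (fun a => s (.inr a))‖ ^ 2
        ≤ δ ^ 2 * ∑ x, ‖φ x‖ ^ 2

/-- `V` implements `U` with accuracy `δ`, without any pending correction. -/
def Implements [Fintype D] [DecidableEq D] (V : Circuit D)
    (U : Matrix (D → Bool) (D → Bool) ℂ) (δ : ℝ) : Prop :=
  V.Realizes (fun _ => ∅) U δ

/-- `V` is `Z`-equivalent to `U` with accuracy `δ` (exactly so if `δ = 0`): `U` is `V` followed by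
single-qubit `Z` gates, controlled by sums modulo 2 of classical bits that `V` has computed. -/
def ZEquivalent [Fintype D] [DecidableEq D] (V : Circuit D)
    (U : Matrix (D → Bool) (D → Bool) ℂ) (δ : ℝ) : Prop :=
  ∃ corr : D → Finset V.B, V.Realizes corr U δ

/-- The composition of the circuits `V j` in the order `V (σ 0), V (σ 1), …`.  They share the
data qubits, and each has ancilla qubits and classical bits of its own. -/
def product {m : ℕ} (V : Fin m → Circuit D) (σ : Equiv.Perm (Fin m)) : Circuit D where
  R := Σ j, (V j).R
  B := Σ j, (V j).B
  fintypeR := inferInstance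
  decEqR := inferInstance
  decEqB := inferInstance
  res := fun r => (V r.1).res r.2
  instrs := (List.ofFn σ).flatMap fun j =>
    (V j).instrs.map (Instr.relabel
      ((Function.Embedding.refl D).sumMap
        ⟨fun a => ⟨⟨j, a.1⟩, a.2⟩, by rintro ⟨r, i⟩ ⟨r', i'⟩ h; cases h; rfl⟩)
      (Sigma.mk j))

end Circuit

/-! ## k-SAT phasers -/

/-- A disjunction of `k` literals in `n` variables: `(i, true)` is the literal `xᵢ`,
and `(i, false)` is the literal `¬xᵢ`. -/
abbrev Clause (n k : ℕ) : Type := Fin k → Fin n × Bool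

namespace Clause

variable {n k : ℕ}

/-- The qubits that the clause addresses. -/
def qubits (C : Clause n k) : Finset (Fin n) := Finset.univ.image fun i => (C i).1

/-- `1` if the assignment satisfies the clause, and `0` otherwise. -/
def value (C : Clause n k) (x : Fin n → Bool) : ℕ := if ∃ i, x (C i).1 = (C i).2 then 1 else 0

end Clause

/-- The exponentiated clause `∑_x exp(-iγ C(x)) |x⟩⟨x|`. -/
noncomputable def clauseUnitary {n k : ℕ} (γ : ℝ) (C : Clause n k) :
    Matrix (Fin n → Bool) (Fin n → Bool) ℂ :=
  Matrix.diagonal fun x => Complex.exp (-Complex.I * γ * (C.value x : ℂ))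

/-- The phaser `∏_j U_j`, that is, `∑_x exp(-iγ ∑_j C_j(x)) |x⟩⟨x|`. -/
noncomputable def phaser {n m k : ℕ} (γ : ℝ) (C : Fin m → Clause n k) :
    Matrix (Fin n → Bool) (Fin n → Bool) ℂ :=
  Matrix.diagonal fun x => Complex.exp (-Complex.I * γ * ∑ j, ((C j).value x : ℂ))

/-- The single-qubit phase gate `exp(iγ |1⟩⟨1|)`. -/
noncomputable def phaseGate (γ : ℝ) : Matrix (Unit → Bool) (Unit → Bool) ℂ :=
  Matrix.diagonal fun x => if x () then Complex.exp (Complex.I * γ) else 1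

end LatticeSurgery

/-!
Up to the global phase `exp(-iγ)`, the unitary of a clause applies the phase `exp(iγ)` to the
assignments that falsify all of its literals. A balanced binary tree of `CCZ`-assisted AND gates
computes this conjunction in a fresh qubit, one level in two cycles. The data qubits take part only
in a `ZZ` measurement each at the leaves, so they are occupied for one cycle. After the circuit for
`exp(iγ |1⟩⟨1|)` has acted on the root, the tree is uncomputed by measurements: an `X` measurement
of a qubit that holds a Boolean value leaves the sign `(-1)^value` behind, which is pushed to the
children level by level, until only `Z` corrections on the data qubits remain.

In the product, the circuits are ordered by the part that their clause belongs to. Each part then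
occupies the data qubits for one cycle, and everything else happens on ancilla qubits in parallel.
`Z` corrections can be deferred to the end, because all circuits are diagonal on the data qubits,
and the errors of the factors add up.
-/

open Function

namespace LatticeSurgery

/-! ### Measurement records -/

/-- The sum of `F` over all records of `n` measurement outcomes.  Records are lists, as in `run`. -/
def recordSum {M : Type*} [AddCommMonoid M] (n : ℕ) (F : List Bool → M) : M :=
  ∑ o : Fin n → Bool, F (List.ofFn o)

section RecordSum

variable {M : Type*} [AddCommMonoid M]

theorem recordSum_zero (F : List Bool → M) : recordSum 0 F = F [] := by
  simp [recordSum]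

theorem recordSum_one (F : List Bool → M) : recordSum 1 F = F [true] + F [false] := by
  unfold recordSum
  rw [← (Equiv.funUnique (Fin 1) Bool).symm.sum_comp]
  simp

theorem recordSum_add (a b : ℕ) (F : List Bool → M) :
    recordSum (a + b) F = recordSum a fun o => recordSum b fun o' => F (o ++ o') := by
  unfold recordSum
  rw [← Fintype.sum_prod_type', ← (Fin.appendEquiv a b).sum_comp]
  exact Finset.sum_congr rfl fun p _ => by simp [Fin.appendEquiv, List.ofFn_fin_append]

theorem recordSum_congr {n : ℕ} {F G : List Bool → M} (h : ∀ o, o.length = n → F o = G o) :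
    recordSum n F = recordSum n G :=
  Finset.sum_congr rfl fun _ _ => h _ List.length_ofFn

theorem recordSum_mono [PartialOrder M] [IsOrderedAddMonoid M] {n : ℕ} {F G : List Bool → M}
    (h : ∀ o, o.length = n → F o ≤ G o) : recordSum n F ≤ recordSum n G :=
  Finset.sum_le_sum fun _ _ => h _ List.length_ofFn

theorem recordSum_mul_left {R : Type*} [NonUnitalNonAssocSemiring R] (n : ℕ)
    (F : List Bool → R) (a : R) : recordSum n (fun o => a * F o) = a * recordSum n F :=
  Finset.mul_sum _ _ _ |>.symm

theorem recordSum_mul_right {R : Type*} [NonUnitalNonAssocSemiring R] (n : ℕ)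
    (F : List Bool → R) (a : R) : recordSum n (fun o => F o * a) = recordSum n F * a :=
  Finset.sum_mul _ _ _ |>.symm

end RecordSum

/-! ### Kraus operators -/

/-- The sign `(-1)^b`. -/
noncomputable def sgn (b : Bool) : ℂ := if b then -1 else 1

section Kraus

variable {Q B : Type} [DecidableEq Q] [DecidableEq B]

/-- The number of measurements in a list of instructions. -/
abbrev measCount {Q B : Type} (l : List (Instr Q B)) : ℕ := l.countP Instr.isMeasurement

theorem run_append (l₁ l₂ : List (Instr Q B)) (o : List Bool) (c : Config Q B) :
    run (l₁ ++ l₂) o c = run l₂ (o.drop (measCount l₁)) (run l₁ o c) := by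
  induction l₁ generalizing o c with
  | nil => simp [run]
  | cons I l ih =>
    by_cases h : I.isMeasurement = true
    · simp [run, h, ih, Nat.add_comm]
    · simp [run, h, ih]

theorem run_take (l : List (Instr Q B)) (o : List Bool) (c : Config Q B) :
    run l (o.take (measCount l)) c = run l o c := by
  induction l generalizing o c with
  | nil => simp [run]
  | cons I l ih =>
    by_cases hI : I.isMeasurement = true
    · cases o with
      | nil => simp
      | cons b o => simp [run, hI, ih]
    · simp [run, hI, ih]

theorem Instr.step_mem_congr (I : Instr Q B) (o : Bool) (m : B → Bool)
    (ψ φ : (Q → Bool) → ℂ) : (I.step o ⟨m, ψ⟩).mem = (I.step o ⟨m, φ⟩).mem := by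
  cases I <;> rfl

theorem run_mem_congr (l : List (Instr Q B)) (o : List Bool) (m : B → Bool)
    (ψ φ : (Q → Bool) → ℂ) : (run l o ⟨m, ψ⟩).mem = (run l o ⟨m, φ⟩).mem := by
  induction l generalizing o m ψ φ with
  | nil => rfl
  | cons I l ih =>
    have hI : ∀ b o', (run l o' (I.step b ⟨m, ψ⟩)).mem = (run l o' (I.step b ⟨m, φ⟩)).mem :=
      fun b o' => (ih o' _ _ _).trans
        (congrArg (fun m' => (run l o' ⟨m', _⟩).mem) (I.step_mem_congr b m ψ φ))
    simp only [run]
    split_ifs <;> exact hI _ _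

theorem pauliOp_add (x z : Bool) (q : Q) (ψ φ : (Q → Bool) → ℂ) :
    pauliOp x z q (ψ + φ) = pauliOp x z q ψ + pauliOp x z q φ :=
  funext fun _ => mul_add _ _ _

theorem pauliOp_smul (x z : Bool) (q : Q) (a : ℂ) (ψ : (Q → Bool) → ℂ) :
    pauliOp x z q (a • ψ) = a • pauliOp x z q ψ :=
  funext fun _ => mul_left_comm _ _ _

theorem Instr.isLinearMap_step (I : Instr Q B) (o : Bool) (m : B → Bool) :
    IsLinearMap ℂ fun ψ => (I.step o ⟨m, ψ⟩).amp := by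
  constructor <;> intros <;> funext s <;> cases I <;>
    simp only [Instr.step, pauliOp_add, pauliOp_smul, Pi.add_apply, Pi.smul_apply,
      smul_eq_mul] <;> ring

theorem isLinearMap_run (l : List (Instr Q B)) (o : List Bool) (m : B → Bool) :
    IsLinearMap ℂ fun ψ => (run l o ⟨m, ψ⟩).amp := by
  induction l generalizing o m with
  | nil => exact LinearMap.id.isLinear
  | cons I l ih =>
    have hI : ∀ b o', IsLinearMap ℂ fun ψ => (run l o' (I.step b ⟨m, ψ⟩)).amp := by
      intro b o'
      convert ((ih o' (I.step b ⟨m, 0⟩).mem).mk' _ ∘ₗ (I.isLinearMap_step b m).mk' _).isLinear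
        using 2 with ψ
      exact congrArg (fun m' => (run l o' ⟨m', _⟩).amp) (I.step_mem_congr b m ψ 0)
    simp only [run]
    split_ifs <;> exact hI _ _

/-- The contents of the classical memory after the instructions `l` on the branch `o`.  It does not
depend on the quantum state. -/
noncomputable def finalMem (l : List (Instr Q B)) (o : List Bool) (m : B → Bool) : B → Bool :=
  (run l o ⟨m, 0⟩).mem

/-- The Kraus operator of the instructions `l` on the branch `o`, for the initial memory `m`. -/
noncomputable def kraus (l : List (Instr Q B)) (o : List Bool) (m : B → Bool) :
    ((Q → Bool) → ℂ) →ₗ[ℂ] ((Q → Bool) → ℂ) :=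
  (isLinearMap_run l o m).mk' _

theorem run_eq (l : List (Instr Q B)) (o : List Bool) (m : B → Bool) (ψ : (Q → Bool) → ℂ) :
    run l o ⟨m, ψ⟩ = ⟨finalMem l o m, kraus l o m ψ⟩ :=
  congrArg (Config.mk · (run l o ⟨m, ψ⟩).amp) (run_mem_congr l o m ψ 0)

theorem finalMem_append (l₁ l₂ : List (Instr Q B)) (o : List Bool) (m : B → Bool) :
    finalMem (l₁ ++ l₂) o m = finalMem l₂ (o.drop (measCount l₁)) (finalMem l₁ o m) := by
  simpa only [run_eq] using congrArg Config.mem (run_append l₁ l₂ o ⟨m, 0⟩)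

theorem kraus_append (l₁ l₂ : List (Instr Q B)) (o : List Bool) (m : B → Bool)
    (ψ : (Q → Bool) → ℂ) :
    kraus (l₁ ++ l₂) o m ψ =
      kraus l₂ (o.drop (measCount l₁)) (finalMem l₁ o m) (kraus l₁ o m ψ) := by
  simpa only [run_eq] using congrArg Config.amp (run_append l₁ l₂ o ⟨m, ψ⟩)

theorem finalMem_take (l : List (Instr Q B)) (o : List Bool) (m : B → Bool) :
    finalMem l (o.take (measCount l)) m = finalMem l o m :=
  congrArg Config.mem (run_take l o ⟨m, 0⟩)

theorem kraus_take (l : List (Instr Q B)) (o : List Bool) (m : B → Bool) :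
    kraus l (o.take (measCount l)) m = kraus l o m :=
  LinearMap.ext fun ψ => congrArg Config.amp (run_take l o ⟨m, ψ⟩)

end Kraus

/-! ### Conservation of probability -/

/-- The squared norm of an amplitude function. -/
noncomputable def normSq {Y : Type*} [Fintype Y] (ψ : Y → ℂ) : ℝ := ∑ s, ‖ψ s‖ ^ 2

theorem normSq_nonneg {Y : Type*} [Fintype Y] (ψ : Y → ℂ) : 0 ≤ normSq ψ :=
  Finset.sum_nonneg fun _ _ => sq_nonneg _

section Norm

variable {Q B : Type} [Fintype Q] [DecidableEq Q]

theorem normSq_pauliOp (x z : Bool) (q : Q) (ψ : (Q → Bool) → ℂ) :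
    normSq (pauliOp x z q ψ) = normSq ψ := by
  have hnorm : ∀ s, ‖pauliOp x z q ψ s‖ = ‖ψ (if x then update s q (!(s q)) else s)‖ := by
    intro s
    simp only [pauliOp, norm_mul, apply_ite norm, norm_neg, norm_one, Complex.norm_I, ite_self,
      one_mul]
  simp only [normSq, hnorm]
  cases x with
  | false => simp
  | true =>
    have hflip : Involutive fun s : Q → Bool => update s q (!(s q)) := fun s => by simp
    simpa using Equiv.sum_comp (hflip.toPerm _) fun s => ‖ψ s‖ ^ 2

theorem normSq_half_sub_add_normSq_half_add {Y : Type*} [Fintype Y] {ψ φ : Y → ℂ}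
    (h : normSq φ = normSq ψ) :
    normSq (fun s => (ψ s - φ s) / 2) + normSq (fun s => (ψ s + φ s) / 2) = normSq ψ := by
  have hpoint : ∀ s, ‖(ψ s - φ s) / 2‖ ^ 2 + ‖(ψ s + φ s) / 2‖ ^ 2
      = (‖ψ s‖ ^ 2 + ‖φ s‖ ^ 2) / 2 := by
    intro s
    have := parallelogram_law_with_norm ℝ (ψ s) (φ s)
    rw [norm_div, norm_div, Complex.norm_ofNat]
    nlinarith
  unfold normSq at *
  rw [← Finset.sum_add_distrib, Finset.sum_congr rfl fun s _ => hpoint s, ← Finset.sum_div,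
    Finset.sum_add_distrib, h]
  ring

variable [DecidableEq B]

theorem Instr.normSq_step_of_isMeasurement {I : Instr Q B} (hI : I.isMeasurement = true)
    (c : Config Q B) :
    normSq (I.step true c).amp + normSq (I.step false c).amp = normSq c.amp := by
  cases I with
  | measure2 q q' hq x z x' z' out =>
    simpa [Instr.step, sub_eq_add_neg] using normSq_half_sub_add_normSq_half_add
      ((normSq_pauliOp _ _ q _).trans (normSq_pauliOp (c.mem x') (c.mem z') q' c.amp))
  | measure1 q basis out =>
    simpa [Instr.step, sub_eq_add_neg] using normSq_half_sub_add_normSq_half_add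
      (normSq_pauliOp (c.mem basis) (!(c.mem basis)) q c.amp)
  | pauli => simp [Instr.isMeasurement] at hI
  | classical => simp [Instr.isMeasurement] at hI

theorem Instr.normSq_step_of_not_isMeasurement {I : Instr Q B} (hI : ¬ I.isMeasurement = true)
    (o : Bool) (c : Config Q B) : normSq (I.step o c).amp = normSq c.amp := by
  cases I with
  | measure2 => simp [Instr.isMeasurement] at hI
  | measure1 => simp [Instr.isMeasurement] at hI
  | pauli => exact normSq_pauliOp _ _ _ _
  | classical => rfl

theorem recordSum_normSq_run (l : List (Instr Q B)) (c : Config Q B) :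
    recordSum (measCount l) (fun o => normSq (run l o c).amp) = normSq c.amp := by
  induction l generalizing c with
  | nil => simp [recordSum_zero, run]
  | cons I l ih =>
    by_cases hI : I.isMeasurement = true
    · rw [measCount, List.countP_cons_of_pos hI, Nat.add_comm, recordSum_add, recordSum_one]
      simp only [run, hI, if_true, List.cons_append, List.nil_append, List.tail_cons,
        List.headD_cons]
      rw [ih, ih, Instr.normSq_step_of_isMeasurement hI]
    · rw [measCount, List.countP_cons_of_neg hI]
      simp only [run, hI, if_false, Bool.false_eq_true]
      rw [ih, Instr.normSq_step_of_not_isMeasurement hI]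

theorem recordSum_normSq_kraus (l : List (Instr Q B)) (m : B → Bool) (ψ : (Q → Bool) → ℂ) :
    recordSum (measCount l) (fun o => normSq (kraus l o m ψ)) = normSq ψ :=
  recordSum_normSq_run l ⟨m, ψ⟩

end Norm

/-! ### The frame rule -/

section Relabel

variable {Q B Q' B' : Type}

theorem Instr.isMeasurement_relabel (f : Q ↪ Q') (g : B → B') (I : Instr Q B) :
    (I.relabel f g).isMeasurement = I.isMeasurement := by
  cases I <;> rfl

theorem Instr.relabel_relabel {Q'' B'' : Type} (f : Q ↪ Q') (g : B → B') (f' : Q' ↪ Q'')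
    (g' : B' → B'') (I : Instr Q B) :
    (I.relabel f g).relabel f' g' = I.relabel (f.trans f') (g' ∘ g) := by
  cases I <;> rfl

theorem map_relabel_map_relabel {Q'' B'' : Type} (f : Q ↪ Q') (g : B → B') (f' : Q' ↪ Q'')
    (g' : B' → B'') (l : List (Instr Q B)) :
    (l.map (Instr.relabel f g)).map (Instr.relabel f' g') =
      l.map (Instr.relabel (f.trans f') (g' ∘ g)) := by
  rw [List.map_map]
  exact List.map_congr_left fun I _ => I.relabel_relabel f g f' g'

theorem measCount_map_relabel (f : Q ↪ Q') (g : B → B') (l : List (Instr Q B)) :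
    measCount (l.map (Instr.relabel f g)) = measCount l := by
  rw [measCount, List.countP_map]
  exact List.countP_congr fun I _ => by simp [Instr.isMeasurement_relabel]

theorem update_extend {α β γ : Type*} [DecidableEq α] [DecidableEq β] {g : α → β}
    (hg : Injective g) (u : α → γ) (v : β → γ) (a : α) (c : γ) :
    update (extend g u v) (g a) c = extend g (update u a c) v := by
  funext b
  by_cases hb : ∃ a', g a' = b
  · obtain ⟨a', rfl⟩ := hb
    simp only [update_apply, hg.eq_iff, hg.extend_apply]
  · rw [extend_apply' _ _ _ hb, update_of_ne (fun h => hb ⟨a, h.symm⟩), extend_apply' _ _ _ hb]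

theorem extend_comp_self {α β γ : Type*} {g : α → β} (hg : Injective g) (v : β → γ) :
    extend g (v ∘ g) v = v := by
  funext b
  by_cases hb : ∃ a, g a = b
  · obtain ⟨a, rfl⟩ := hb
    exact hg.extend_apply _ _ _
  · exact extend_apply' _ _ _ hb

variable [DecidableEq Q] [DecidableEq Q']

theorem pauliOp_relabel (f : Q ↪ Q') {R : (Q' → Bool) → ℂ}
    (hR : ∀ s q v, R (update s (f q) v) = R s) (x z : Bool) (q : Q) (ψ : (Q → Bool) → ℂ) :
    pauliOp x z (f q) (fun s => ψ (s ∘ f) * R s) =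
      fun s => pauliOp x z q ψ (s ∘ f) * R s := by
  have hupdate : ∀ (s : Q' → Bool) v, update s (f q) v ∘ f = update (s ∘ f) q v := fun s v =>
    update_comp_eq_of_injective s f.injective q v
  funext s
  cases x <;> simp [pauliOp, hR, hupdate, mul_assoc]

variable [DecidableEq B] [DecidableEq B']

theorem Instr.step_relabel (f : Q ↪ Q') {g : B → B'} (hg : Injective g) {R : (Q' → Bool) → ℂ}
    (hR : ∀ s q v, R (update s (f q) v) = R s) (I : Instr Q B) (o : Bool) (m : B → Bool)
    (m' : B' → Bool) (ψ : (Q → Bool) → ℂ) :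
    (I.relabel f g).step o ⟨extend g m m', fun s => ψ (s ∘ f) * R s⟩ =
      ⟨extend g (I.step o ⟨m, ψ⟩).mem m', fun s => (I.step o ⟨m, ψ⟩).amp (s ∘ f) * R s⟩ := by
  cases I <;>
    simp only [Instr.step, Instr.relabel, hg.extend_apply, update_extend hg,
      pauliOp_relabel f hR] <;>
    congr 1 <;> funext s <;> ring

theorem run_relabel (f : Q ↪ Q') {g : B → B'} (hg : Injective g) {R : (Q' → Bool) → ℂ}
    (hR : ∀ s q v, R (update s (f q) v) = R s) (l : List (Instr Q B)) (o : List Bool)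
    (m : B → Bool) (m' : B' → Bool) (ψ : (Q → Bool) → ℂ) :
    run (l.map (Instr.relabel f g)) o ⟨extend g m m', fun s => ψ (s ∘ f) * R s⟩ =
      ⟨extend g (finalMem l o m) m', fun s => kraus l o m ψ (s ∘ f) * R s⟩ := by
  suffices ∀ c : Config Q B, run (l.map (Instr.relabel f g)) o
      ⟨extend g c.mem m', fun s => c.amp (s ∘ f) * R s⟩ =
        ⟨extend g (run l o c).mem m', fun s => (run l o c).amp (s ∘ f) * R s⟩ by
    simpa only [run_eq] using this ⟨m, ψ⟩
  induction l generalizing o with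
  | nil => exact fun _ => rfl
  | cons I l ih =>
    intro c
    simp only [List.map_cons, run, Instr.isMeasurement_relabel, I.step_relabel f hg hR]
    split_ifs <;> exact ih _ _

theorem kraus_relabel (f : Q ↪ Q') {g : B → B'} (hg : Injective g) {R : (Q' → Bool) → ℂ}
    (hR : ∀ s q v, R (update s (f q) v) = R s) (l : List (Instr Q B)) (o : List Bool)
    (m : B' → Bool) (ψ : (Q → Bool) → ℂ) :
    kraus (l.map (Instr.relabel f g)) o m (fun s => ψ (s ∘ f) * R s) =
      fun s => kraus l o (m ∘ g) ψ (s ∘ f) * R s := by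
  simpa only [run_eq, extend_comp_self hg] using
    congrArg Config.amp (run_relabel f hg hR l o (m ∘ g) m ψ)

theorem finalMem_relabel (f : Q ↪ Q') {g : B → B'} (hg : Injective g) (l : List (Instr Q B))
    (o : List Bool) (m : B' → Bool) :
    finalMem (l.map (Instr.relabel f g)) o m = extend g (finalMem l o (m ∘ g)) m := by
  simpa only [run_eq, extend_comp_self hg] using
    congrArg Config.mem (run_relabel f hg (R := 0) (fun _ _ _ => rfl) l o (m ∘ g) m 0)

theorem finalMem_relabel_comp (f : Q ↪ Q') {g : B → B'} (hg : Injective g)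
    (l : List (Instr Q B)) (o : List Bool) (m : B' → Bool) :
    finalMem (l.map (Instr.relabel f g)) o m ∘ g = finalMem l o (m ∘ g) := by
  rw [finalMem_relabel f hg]
  exact extend_comp hg _ _

omit [DecidableEq Q] [DecidableEq B] in
theorem finalMem_relabel_comp_of_ne {γ : Type*} (f : Q ↪ Q') {g : B → B'} (hg : Injective g)
    {g' : γ → B'} (hgg' : ∀ b c, g b ≠ g' c) (l : List (Instr Q B)) (o : List Bool)
    (m : B' → Bool) : finalMem (l.map (Instr.relabel f g)) o m ∘ g' = m ∘ g' := by
  classical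
  rw [finalMem_relabel f hg]
  exact funext fun c => extend_apply' _ _ _ fun ⟨b, hb⟩ => hgg' b c hb

theorem kraus_relabel_append {Q₁ B₁ Q₂ B₂ : Type} [DecidableEq Q₁] [DecidableEq B₁]
    [DecidableEq Q₂] [DecidableEq B₂] (f₁ : Q₁ ↪ Q') {g₁ : B₁ → B'} (hg₁ : Injective g₁)
    (f₂ : Q₂ ↪ Q') {g₂ : B₂ → B'} (hg₂ : Injective g₂) (hf : ∀ q q', f₁ q ≠ f₂ q')
    (hg : ∀ b b', g₁ b ≠ g₂ b') {R : (Q' → Bool) → ℂ} (hR₁ : ∀ s q v, R (update s (f₁ q) v) = R s)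
    (hR₂ : ∀ s q v, R (update s (f₂ q) v) = R s) (l₁ : List (Instr Q₁ B₁))
    (l₂ : List (Instr Q₂ B₂)) (o : List Bool) (m : B' → Bool) (ψ₁ : (Q₁ → Bool) → ℂ)
    (ψ₂ : (Q₂ → Bool) → ℂ) :
    kraus (l₁.map (Instr.relabel f₁ g₁) ++ l₂.map (Instr.relabel f₂ g₂)) o m
      (fun s => ψ₁ (s ∘ f₁) * (ψ₂ (s ∘ f₂) * R s)) =
      fun s => kraus l₁ o (m ∘ g₁) ψ₁ (s ∘ f₁) *
        (kraus l₂ (o.drop (measCount l₁)) (m ∘ g₂) ψ₂ (s ∘ f₂) * R s) := by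
  have h₁ : ∀ s q v, ψ₂ (update s (f₁ q) v ∘ f₂) * R (update s (f₁ q) v) = ψ₂ (s ∘ f₂) * R s :=
    fun s q v => by rw [update_comp_eq_of_forall_ne _ _ fun q' => (hf q q').symm, hR₁]
  have h₂ : ∀ s q v, kraus l₁ o (m ∘ g₁) ψ₁ (update s (f₂ q) v ∘ f₁) * R (update s (f₂ q) v) =
      kraus l₁ o (m ∘ g₁) ψ₁ (s ∘ f₁) * R s :=
    fun s q v => by rw [update_comp_eq_of_forall_ne _ _ fun q' => hf q' q, hR₂]
  rw [kraus_append, measCount_map_relabel, kraus_relabel f₁ hg₁ h₁]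
  simp only [mul_left_comm (kraus l₁ o (m ∘ g₁) ψ₁ _)]
  rw [kraus_relabel f₂ hg₂ h₂, finalMem_relabel_comp_of_ne f₁ hg₁ hg]

end Relabel

/-! ### Scheduling -/

namespace Clock

variable {Q B Q' B' : Type}

instance : Preorder (Clock Q B) := Preorder.lift fun t => (t.qubit, t.bit)

/-- All qubits and classical bits are available after `k` cycles. -/
def const (Q B : Type) (k : ℕ) : Clock Q B := ⟨fun _ => k, fun _ => k⟩

/-- The clock `t`, with all times delayed by `k` cycles. -/
def delay (k : ℕ) (t : Clock Q B) : Clock Q B := ⟨fun q => t.qubit q + k, fun b => t.bit b + k⟩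

/-- The clock `t`, restricted to the qubits and bits that are renamed by `f` and `g`. -/
def comap (f : Q → Q') (g : B → B') (t : Clock Q' B') : Clock Q B := ⟨t.qubit ∘ f, t.bit ∘ g⟩

/-- The clock that agrees with `t` on the qubits and bits renamed by `f` and `g`, and with `u` on
the others. -/
noncomputable def extend (f : Q → Q') (g : B → B') (t : Clock Q B) (u : Clock Q' B') :
    Clock Q' B' :=
  ⟨Function.extend f t.qubit u.qubit, Function.extend g t.bit u.bit⟩

theorem extend_comap_self {f : Q → Q'} {g : B → B'} (hf : Injective f) (hg : Injective g)
    (t : Clock Q' B') : (t.comap f g).extend f g t = t := by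
  simp only [extend, comap, extend_comp_self hf, extend_comp_self hg]

theorem delay_le_delay {k k' : ℕ} {t u : Clock Q B} (hk : k ≤ k') (h : t ≤ u) :
    t.delay k ≤ u.delay k' :=
  ⟨fun q => Nat.add_le_add (h.1 q) hk, fun b => Nat.add_le_add (h.2 b) hk⟩

end Clock

theorem update_le_update {α γ : Type*} [DecidableEq α] [Preorder γ] {t u : α → γ} (h : t ≤ u)
    (a : α) {v w : γ} (hv : v ≤ w) : update t a v ≤ update u a w :=
  update_le_update_iff.2 ⟨hv, fun b _ => h b⟩

theorem extend_le {α β γ : Type*} [LE γ] {g : α → β} (hg : Injective g) {u : α → γ}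
    {v w : β → γ} (hu : u ≤ w ∘ g) (hv : v ≤ w) : extend g u v ≤ w := by
  intro b
  by_cases hb : ∃ a, g a = b
  · obtain ⟨a, rfl⟩ := hb
    exact (hg.extend_apply u v a).trans_le (hu a)
  · exact (extend_apply' u v b hb).trans_le (hv b)

section Tick

variable {Q B Q' B' : Type} [DecidableEq Q] [DecidableEq B] [DecidableEq Q'] [DecidableEq B']

theorem Instr.tick_mono (I : Instr Q B) {t u : Clock Q B} (h : t ≤ u) : I.tick t ≤ I.tick u := by
  obtain ⟨hq, hb⟩ := h
  cases I with
  | measure2 q q' _ x z x' z' out =>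
    have he := Nat.add_le_add_right (max_le_max (max_le_max (hq q) (hq q')) (max_le_max
      (max_le_max (hb x) (hb z)) (max_le_max (hb x') (hb z')))) 1
    exact ⟨update_le_update (update_le_update hq q he) q' he, update_le_update hb out he⟩
  | measure1 q basis out =>
    have he := max_le_max (hq q) (hb basis)
    exact ⟨update_le_update hq q he, update_le_update hb out he⟩
  | pauli q x z =>
    exact ⟨update_le_update hq q (max_le_max (hq q) (max_le_max (hb x) (hb z))), hb⟩
  | classical _ a b out => exact ⟨hq, update_le_update hb out (max_le_max (hb a) (hb b))⟩

theorem Instr.tick_delay (I : Instr Q B) (k : ℕ) (t : Clock Q B) :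
    I.tick (t.delay k) = (I.tick t).delay k := by
  have hupdate : ∀ {α : Type} [DecidableEq α] (u : α → ℕ) a v,
      (fun c => update u a v c + k) = update (fun c => u c + k) a (v + k) :=
    fun u a v => comp_update (· + k) u a v
  cases I <;> simp only [Instr.tick, Clock.delay, hupdate] <;> grind

theorem Instr.tick_relabel (f : Q ↪ Q') {g : B → B'} (hg : Injective g) (I : Instr Q B)
    (t : Clock Q B) (u : Clock Q' B') :
    (I.relabel f g).tick (t.extend f g u) = (I.tick t).extend f g u := by
  cases I <;>
    simp only [Instr.tick, Instr.relabel, Clock.extend, hg.extend_apply, f.injective.extend_apply,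
      update_extend hg, update_extend f.injective]

theorem foldl_tick_mono (l : List (Instr Q B)) {t u : Clock Q B} (h : t ≤ u) :
    l.foldl Instr.tick t ≤ l.foldl Instr.tick u := by
  induction l generalizing t u with
  | nil => exact h
  | cons I _ ih => exact ih (I.tick_mono h)

theorem foldl_tick_delay (l : List (Instr Q B)) (k : ℕ) (t : Clock Q B) :
    l.foldl Instr.tick (t.delay k) = (l.foldl Instr.tick t).delay k := by
  induction l generalizing t with
  | nil => rfl
  | cons I l ih => rw [List.foldl_cons, I.tick_delay, ih, List.foldl_cons]

theorem foldl_tick_relabel (f : Q ↪ Q') {g : B → B'} (hg : Injective g) (l : List (Instr Q B))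
    (t : Clock Q' B') :
    (l.map (Instr.relabel f g)).foldl Instr.tick t =
      (l.foldl Instr.tick (t.comap f g)).extend f g t := by
  suffices ∀ u : Clock Q B, (l.map (Instr.relabel f g)).foldl Instr.tick (u.extend f g t) =
      (l.foldl Instr.tick u).extend f g t by
    simpa only [Clock.extend_comap_self f.injective hg] using this (t.comap f g)
  induction l with
  | nil => exact fun _ => rfl
  | cons I l ih =>
    intro u
    rw [List.map_cons, List.foldl_cons, I.tick_relabel f hg, ih, List.foldl_cons]

theorem foldl_tick_relabel_le (f : Q ↪ Q') {g : B → B'} (hg : Injective g) {l : List (Instr Q B)}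
    {k : ℕ} {t u : Clock Q B} {t' u' : Clock Q' B'} (hl : l.foldl Instr.tick t ≤ u)
    (ht : t'.comap f g ≤ t.delay k) (hu : u.delay k ≤ u'.comap f g) (htu : t' ≤ u') :
    (l.map (Instr.relabel f g)).foldl Instr.tick t' ≤ u' := by
  have hrun : l.foldl Instr.tick (t'.comap f g) ≤ u'.comap f g :=
    calc l.foldl Instr.tick (t'.comap f g)
      _ ≤ (l.foldl Instr.tick t).delay k := (foldl_tick_mono l ht).trans_eq (foldl_tick_delay l k t)
      _ ≤ u.delay k := Clock.delay_le_delay le_rfl hl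
      _ ≤ u'.comap f g := hu
  rw [foldl_tick_relabel f hg]
  exact ⟨extend_le f.injective hrun.1 htu.1, extend_le hg hrun.2 htu.2⟩

end Tick

/-! ### Measurement gadgets -/

section Projections

/-- `1` if the two bits agree, and `0` otherwise. -/
def ind (b c : Bool) : ℂ := if b = c then 1 else 0

@[simp] theorem ind_self (b : Bool) : ind b b = 1 := by simp [ind]
@[simp] theorem ind_true_false : ind true false = 0 := rfl
@[simp] theorem ind_false_true : ind false true = 0 := rfl
@[simp] theorem sgn_true : sgn true = -1 := rfl
@[simp] theorem sgn_false : sgn false = 1 := rfl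

theorem ind_mul_congr {b c : Bool} {u v : ℂ} (h : b = c → u = v) : ind b c * u = ind b c * v := by
  by_cases hbc : b = c
  · rw [h hbc]
  · simp [ind, hbc]

variable {Q B : Type} [DecidableEq Q] [DecidableEq B]

/-- The projection onto the outcome `o` of the measurement of `σ(x,z)` on `q`. -/
noncomputable def proj1 (x z : Bool) (q : Q) (o : Bool) (ψ : (Q → Bool) → ℂ) : (Q → Bool) → ℂ :=
  fun s => (ψ s + sgn o * pauliOp x z q ψ s) / 2

/-- The projection onto the outcome `o` of the measurement of `σ(x,z)` on `q` times `σ(x',z')`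
on `q'`. -/
noncomputable def proj2 (x z : Bool) (q : Q) (x' z' : Bool) (q' : Q) (o : Bool)
    (ψ : (Q → Bool) → ℂ) : (Q → Bool) → ℂ :=
  fun s => (ψ s + sgn o * pauliOp x z q (pauliOp x' z' q' ψ) s) / 2

theorem run_measure2 (q q' : Q) (hq : q ≠ q') (x z x' z' out : B) (l : List (Instr Q B))
    (o : List Bool) (m : B → Bool) (ψ : (Q → Bool) → ℂ) :
    run (.measure2 q q' hq x z x' z' out :: l) o ⟨m, ψ⟩ =
      run l o.tail ⟨update m out (o.headD false),
        proj2 (m x) (m z) q (m x') (m z') q' (o.headD false) ψ⟩ := rfl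

theorem run_measure1 (q : Q) (basis out : B) (l : List (Instr Q B))
    (o : List Bool) (m : B → Bool) (ψ : (Q → Bool) → ℂ) :
    run (.measure1 q basis out :: l) o ⟨m, ψ⟩ =
      run l o.tail ⟨update m out (o.headD false),
        proj1 (m basis) (!(m basis)) q (o.headD false) ψ⟩ := rfl

theorem run_pauli (q : Q) (x z : B) (l : List (Instr Q B))
    (o : List Bool) (m : B → Bool) (ψ : (Q → Bool) → ℂ) :
    run (.pauli q x z :: l) o ⟨m, ψ⟩ = run l o ⟨m, pauliOp (m x) (m z) q ψ⟩ := rfl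

theorem run_classical (f : Bool → Bool → Bool) (a b out : B) (l : List (Instr Q B))
    (o : List Bool) (m : B → Bool) (ψ : (Q → Bool) → ℂ) :
    run (.classical f a b out :: l) o ⟨m, ψ⟩ = run l o ⟨update m out (f (m a) (m b)), ψ⟩ := rfl

theorem run_nil (o : List Bool) (c : Config Q B) : run [] o c = c := rfl

theorem amp_run (l : List (Instr Q B)) (o : List Bool) (m : B → Bool) (ψ : (Q → Bool) → ℂ) :
    (run l o ⟨m, ψ⟩).amp = kraus l o m ψ := rfl

theorem mem_run (l : List (Instr Q B)) (o : List Bool) (m : B → Bool) (ψ : (Q → Bool) → ℂ) :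
    (run l o ⟨m, ψ⟩).mem = finalMem l o m :=
  run_mem_congr l o m ψ 0

theorem pauliOp_Z (z : Bool) (q : Q) (ψ : (Q → Bool) → ℂ) :
    pauliOp false z q ψ = fun s => sgn (z && s q) * ψ s := by
  funext s
  simp [pauliOp, sgn]

theorem pauliOp_X (x : Bool) (q : Q) (ψ : (Q → Bool) → ℂ) :
    pauliOp x false q ψ = fun s => ψ (update s q (s q ^^ x)) := by
  funext s
  cases x <;> simp [pauliOp]

theorem proj1_Z (q : Q) (o : Bool) (ψ : (Q → Bool) → ℂ) :
    proj1 false true q o ψ = fun s => ind (s q) o * ψ s := by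
  funext s
  simp only [proj1, pauliOp_Z]
  cases s q <;> cases o <;> simp

theorem proj2_ZZ (q q' : Q) (o : Bool) (ψ : (Q → Bool) → ℂ) :
    proj2 false true q false true q' o ψ = fun s => ind (s q ^^ s q') o * ψ s := by
  funext s
  simp only [proj2, pauliOp_Z]
  cases s q <;> cases s q' <;> cases o <;> simp

theorem proj1_X_ind (q : Q) (o a : Bool) :
    proj1 true false q o (fun s => ind (s q) a) = fun s => sgn (o && a) * (sgn (o && s q) / 2) := by
  funext s
  simp only [proj1, pauliOp_X, update_self]
  cases o <;> cases a <;> cases s q <;> norm_num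

/-- One-bit teleportation: a phase `(-1)^v` on `|1⟩` of `z` becomes the value `v` of `t`. -/
theorem pauliOp_proj_teleport {z t : Q} (hzt : z ≠ t) (v o o' : Bool) {G : (Q → Bool) → ℂ}
    (hz : ∀ s b, G (update s z b) = G s) (ht : ∀ s b, G (update s t b) = G s) :
    pauliOp false o' t (pauliOp o false t (proj1 false true z o' (proj2 true false z false true t o
      fun s => sgn (v && s z) * G s))) = fun s => ind (s z) o' * ind (s t) v * G s := by
  funext s
  simp only [proj1_Z, proj2, pauliOp_X, pauliOp_Z, update_of_ne hzt, update_of_ne hzt.symm,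
    update_self, hz, ht]
  generalize s z = b; generalize s t = c
  cases v <;> cases o <;> cases o' <;> cases b <;> cases c <;> simp

theorem proj2_XX_ind {t u : Q} (htu : t ≠ u) (v o : Bool) {ψ G : (Q → Bool) → ℂ}
    (hψ : ∀ s, ψ s = ind (s t) v * ind (s u) false * G s)
    (ht : ∀ s b, G (update s t b) = G s) (hu : ∀ s b, G (update s u b) = G s) :
    proj2 true false t true false u o ψ =
      fun s => ind (s t) (v ^^ s u) * sgn (o && s u) * (G s / 2) := by
  funext s
  simp only [proj2, pauliOp_X, hψ, update_of_ne htu, update_of_ne htu.symm, update_self, ht, hu]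
  generalize s t = b; generalize s u = c
  cases v <;> cases o <;> cases b <;> cases c <;> simp <;> ring

/-- If the state of `x` is `|a⟩`, then measuring `X ⊗ X^c` and thereafter `Z` on `x` amounts to
a gate `X^(c (a + o'))` on `t`. -/
theorem proj1_Z_proj2_X {x t : Q} (hxt : x ≠ t) (a c o o' : Bool) {ψ G : (Q → Bool) → ℂ}
    (hψ : ∀ s, ψ s = ind (s x) a * G s) (hx : ∀ s b, G (update s x b) = G s) :
    proj1 false true x o' (proj2 true false x c false t o ψ) =
      fun s => ind (s x) o' * sgn (o && (a ^^ o')) *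
        (G (update s t (s t ^^ (c && (a ^^ o')))) / 2) := by
  funext s
  simp only [proj1_Z, proj2, pauliOp_X, hψ, update_of_ne hxt, update_of_ne hxt.symm, update_self,
    update_comm hxt, hx, mul_assoc]
  refine ind_mul_congr fun hs => ?_
  rw [hs]
  cases a <;> cases o' <;> cases o <;> simp [div_eq_mul_inv]

end Projections

section And

/-- The ancilla qubits of the conjunction gadget, apart from its output qubit: the conjuncts `p` and
`q`, the CCZ state on `x`, `y`, `z`, and a qubit `u` in the state `|0⟩`. -/
inductive AndAnc
  | p | q | x | y | z | u
  deriving DecidableEq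

/-- The classical bits of the conjunction gadget: constants, measurement outcomes named after the
measured qubits, and products of bits that control corrections. -/
inductive AndBit
  | zero | one | px | qy | zt | z | tu | xt | x | yu | y | u | a₁ | a₂ | a₃ | a₄
  deriving DecidableEq

/-- Computes into the qubit `none`, initially in the state `|+⟩`, the conjunction of the bits of `p`
and `q`.  The parities with `x` and `y` are not corrected, but remembered by the later measurement
bases, so that the gadget ends two cycles after `p` and `q` become available. -/
def andPre : List (Instr (Option AndAnc) AndBit) :=
  [ .classical (fun _ _ => true) .zero .zero .one,
    .measure2 (some .p) (some .x) (by decide) .zero .one .zero .one .px,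
    .measure2 (some .q) (some .y) (by decide) .zero .one .zero .one .qy,
    .measure2 (some .z) none (by decide) .one .zero .zero .one .zt,
    .measure1 (some .z) .zero .z,
    .pauli none .zt .zero,
    .pauli none .zero .z,
    .measure2 none (some .u) (by decide) .one .zero .one .zero .tu,
    .measure2 (some .x) none (by decide) .one .zero .qy .zero .xt,
    .measure1 (some .x) .zero .x,
    .measure2 (some .y) (some .u) (by decide) .one .zero .px .zero .yu,
    .measure1 (some .y) .zero .y,
    .measure1 (some .u) .zero .u,
    .classical and .px .qy .a₁,
    .classical and .px .y .a₂,
    .classical and .qy .x .a₃,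
    .classical and .px .tu .a₄,
    .pauli none .u .zero,
    .pauli none .a₁ .zero,
    .pauli none .a₂ .zero,
    .pauli none .a₃ .zero,
    .pauli (some .p) .zero .xt,
    .pauli (some .q) .zero .yu,
    .pauli (some .q) .zero .a₄ ]

theorem ind_xor_left (b c d : Bool) : ind (b ^^ c) d = ind b (d ^^ c) := by
  cases b <;> cases c <;> cases d <;> simp

theorem sgn_xor (b c : Bool) : sgn (b ^^ c) = sgn b * sgn c := by
  cases b <;> cases c <;> simp

theorem ind_and_correction (p q o₁ o₂ o₆ o₈ t u : Bool) :
    ind (t ^^ (o₂ && o₆) ^^ (o₁ && o₈) ^^ (o₁ && o₂) ^^ u)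
      (((p ^^ o₁) && (q ^^ o₂)) ^^ (u ^^ (o₁ && (q ^^ o₂ ^^ o₈))) ^^ (o₂ && (p ^^ o₁ ^^ o₆)))
      = ind t (p && q) := by
  rw [ind_xor_left, ind_xor_left, ind_xor_left, ind_xor_left]
  congr 1
  decide +revert

theorem sgn_and_correction (p q o₁ o₂ o₄ o₅ o₆ o₇ o₈ u : Bool) :
    sgn (o₁ && o₄ && q) * sgn (o₇ && q) * sgn (o₅ && p) *
      (sgn (o₄ && (u ^^ (o₁ && (q ^^ o₂ ^^ o₈)))) * sgn (o₅ && (p ^^ o₁ ^^ o₆)) *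
        sgn (o₇ && (q ^^ o₂ ^^ o₈))) =
      sgn (o₅ && (o₁ ^^ o₆)) * sgn (o₇ && (o₂ ^^ o₈)) *
        sgn (o₄ && (u ^^ (o₁ && (o₂ ^^ o₈)))) := by
  simp only [← sgn_xor]
  congr 1
  cases o₁ <;> cases o₄ <;> cases o₅ <;> cases o₇ <;> decide +revert

theorem andPre_parities (a b o₁ o₂ : Bool) (κ : (Option AndAnc → Bool) → ℂ) :
    proj2 false true (some .q) false true (some .y) o₂
      (proj2 false true (some .p) false true (some .x) o₁ fun s : Option AndAnc → Bool =>
        ind (s (some .p)) a * ind (s (some .q)) b *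
          (sgn (s (some .x) && s (some .y) && s (some .z)) * κ s)) =
      fun s => sgn ((a ^^ o₁) && (b ^^ o₂) && s (some .z)) *
        (ind (s (some .p)) a * ind (s (some .q)) b * ind (s (some .x)) (a ^^ o₁) *
          ind (s (some .y)) (b ^^ o₂) * κ s) := by
  simp only [proj2_ZZ]
  funext s
  generalize s (some .p) = p; generalize s (some .q) = q
  generalize s (some .x) = x; generalize s (some .y) = y
  by_cases hp : p = a
  · by_cases hq : q = b
    · subst hp hq
      cases p <;> cases x <;> cases o₁ <;> simp <;> cases q <;> cases y <;> cases o₂ <;> simp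
    · simp [ind, hq]
  · simp [ind, hp]

theorem andPre_projections (a b X Y v o₀ o₁ o₂ o₃ o₄ o₅ o₆ o₇ o₈ : Bool) :
    proj1 false true (some .y) o₈ (proj2 true false (some .y) o₁ false (some .u) o₇
      (proj1 false true (some .x) o₆ (proj2 true false (some .x) o₂ false none o₅
        (proj2 true false none true false (some .u) o₄
          (pauliOp false o₀ none (pauliOp o₃ false none (proj1 false true (some .z) o₀
            (proj2 true false (some .z) false true none o₃ fun s => sgn (v && s (some .z)) *
              (ind (s (some .p)) a * ind (s (some .q)) b * ind (s (some .x)) X *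
                ind (s (some .y)) Y * ind (s (some .u)) false))))))))) =
      fun s : Option AndAnc → Bool => ind (s (some .p)) a * ind (s (some .q)) b *
        ind (s none) (v ^^ (s (some .u) ^^ (o₁ && (Y ^^ o₈))) ^^ (o₂ && (X ^^ o₆))) *
        (ind (s (some .x)) o₆ * ind (s (some .y)) o₈ * ind (s (some .z)) o₀ *
          sgn (o₄ && (s (some .u) ^^ (o₁ && (Y ^^ o₈)))) * sgn (o₅ && (X ^^ o₆)) *
          sgn (o₇ && (Y ^^ o₈)) / 8) := by
  rw [pauliOp_proj_teleport (by decide) _ _ _ (fun s c => by simp) (fun s c => by simp),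
    proj2_XX_ind (by decide) v o₄ (G := fun s => ind (s (some .p)) a * ind (s (some .q)) b *
      ind (s (some .x)) X * ind (s (some .y)) Y * ind (s (some .z)) o₀)
      (fun s => by ring) (fun s c => by simp) (fun s c => by simp),
    proj1_Z_proj2_X (by decide) X o₂ o₅ o₆ (G := fun s => ind (s none) (v ^^ s (some .u)) *
      sgn (o₄ && s (some .u)) * (ind (s (some .p)) a * ind (s (some .q)) b *
        ind (s (some .y)) Y * ind (s (some .z)) o₀ / 2)) (fun s => by ring) (fun s c => by simp),
    proj1_Z_proj2_X (by decide) Y o₁ o₇ o₈ (G := fun s =>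
      ind (s none) (v ^^ s (some .u) ^^ (o₂ && (X ^^ o₆))) * sgn (o₄ && s (some .u)) *
      sgn (o₅ && (X ^^ o₆)) * (ind (s (some .p)) a * ind (s (some .q)) b *
        ind (s (some .x)) o₆ * ind (s (some .z)) o₀ / 4))
      (fun s => by simp [ind_xor_left]; ring) (fun s c => by simp)]
  funext s
  simp only [ne_eq, reduceCtorEq, not_false_eq_true, Option.some.injEq, update_of_ne, update_self]
  ring

theorem exists_kraus_andPre (o : List Bool) : ∃ J : Bool → Bool → Bool → Bool → ℂ, ∀ a b : Bool,
    kraus andPre o ⊥ (fun s => ind (s (some .p)) a * ind (s (some .q)) b *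
      (sgn (s (some .x) && s (some .y) && s (some .z)) * ind (s (some .u)) false)) =
      fun s => ind (s none) (a && b) * (ind (s (some .p)) a * ind (s (some .q)) b *
        J (s (some .x)) (s (some .y)) (s (some .z)) (s (some .u))) := by
  simp only [← amp_run, andPre, run_measure2, run_measure1, run_pauli, run_classical, run_nil]
  generalize o.headD false = o₁
  generalize o.tail.headD false = o₂
  generalize o.tail.tail.headD false = o₃
  generalize o.tail.tail.tail.headD false = o₀
  generalize o.tail.tail.tail.tail.headD false = o₄
  generalize o.tail.tail.tail.tail.tail.headD false = o₅
  generalize o.tail.tail.tail.tail.tail.tail.headD false = o₆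
  generalize o.tail.tail.tail.tail.tail.tail.tail.headD false = o₇
  generalize o.tail.tail.tail.tail.tail.tail.tail.tail.headD false = o₈
  generalize o.tail.tail.tail.tail.tail.tail.tail.tail.tail.headD false = o₉
  simp only [ne_eq, reduceCtorEq, not_false_eq_true, update_of_ne, update_self, Pi.bot_apply,
    bot_eq_false, Bool.not_false]
  refine ⟨fun x y z u => ind x o₆ * ind y o₈ * ind z o₀ * ind u o₉ * (1 / 8) *
    sgn (o₅ && (o₁ ^^ o₆)) * sgn (o₇ && (o₂ ^^ o₈)) * sgn (o₄ && (u ^^ (o₁ && (o₂ ^^ o₈)))),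
    fun a b => ?_⟩
  rw [andPre_parities, andPre_projections]
  simp only [proj1_Z, pauliOp_X, pauliOp_Z, ne_eq, reduceCtorEq, not_false_eq_true, update_of_ne,
    update_self]
  funext s
  rcases eq_or_ne (s (some .u)) o₉ with rfl | hu
  · rcases eq_or_ne (s (some .p)) a with rfl | hp
    · rcases eq_or_ne (s (some .q)) b with rfl | hq
      · rw [ind_and_correction]
        simp only [ind_self]
        linear_combination ind (s none) (s (some .p) && s (some .q)) * ind (s (some .x)) o₆ *
          ind (s (some .y)) o₈ * ind (s (some .z)) o₀ / 8 * sgn_and_correction (s (some .p))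
            (s (some .q)) o₁ o₂ o₄ o₅ o₆ o₇ o₈ (s (some .u))
      · simp [ind, hq]
    · simp [ind, hp]
  · simp [ind, hu]

/-- The outcomes of the gadget that undoes `andPre`: `pend` is the sign that is pending on the
conjunction, `left` and `right` are those that it leaves behind on the conjuncts. -/
inductive UnandBit
  | zero | one | pend | left | right
  deriving DecidableEq

/-- Measures the qubits of the conjuncts (`true` and `false`) in a basis of graph states if `pend`
is set, and in the `X` basis otherwise. -/
def andPost : List (Instr Bool UnandBit) :=
  [ .classical (fun _ _ => true) .zero .zero .one,
    .measure2 true false (by decide) .one .zero .zero .pend .left,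
    .measure2 true false (by decide) .zero .pend .one .zero .right ]

/-- Up to a factor, the amplitudes of the states on which `andPost` projects. -/
noncomputable def graphSign (r r₁ r₂ a b : Bool) : ℂ :=
  sgn (r && (a && b)) * sgn (r₁ && a) * sgn (r₂ && b)

theorem kraus_andPost (o : List Bool) {m : UnandBit → Bool} (h0 : m .zero = false) (a b : Bool) :
    kraus andPost o m (fun s => ind (s true) a * ind (s false) b) = fun s =>
      graphSign (m .pend) (finalMem andPost o m .left) (finalMem andPost o m .right) a b *
        (graphSign (m .pend) (finalMem andPost o m .left) (finalMem andPost o m .right)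
          (s true) (s false) / 4) := by
  simp only [← amp_run, ← mem_run _ _ _ 0, andPost, run_measure2, run_classical, run_nil]
  simp only [ne_eq, reduceCtorEq, not_false_eq_true, update_of_ne, update_self, h0]
  generalize o.headD false = r₁; generalize o.tail.headD false = r₂; generalize m .pend = r
  funext s
  simp only [proj2, pauliOp_X, pauliOp_Z, ne_eq, not_false_eq_true, update_of_ne, update_self,
    Bool.true_eq_false, Bool.false_eq_true, Bool.xor_true, graphSign]
  generalize s true = p; generalize s false = q
  cases r <;> cases a <;> cases p <;> cases b <;> cases q <;> cases r₁ <;> cases r₂ <;> norm_num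

theorem andPre_tick_le : andPre.foldl Instr.tick
    ⟨fun q => if q = some .p ∨ q = some .q then 1 else 0, fun _ => 0⟩ ≤ Clock.const _ _ 3 := by
  refine ⟨?_, fun b => by cases b <;> decide⟩
  rintro (_ | i)
  · decide
  · cases i <;> decide

theorem andPost_tick_le : andPost.foldl Instr.tick (Clock.const _ _ 0) ≤ Clock.const _ _ 2 :=
  ⟨fun q => by cases q <;> decide, fun b => by cases b <;> decide⟩

end And

section Leaf

/-- The classical bits of the gadgets that evaluate literals and constants. -/
inductive LeafBit
  | zero | one | out | pend
  deriving DecidableEq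

/-- Copies the data qubit, negated if `b` is set, to the ancilla qubit. -/
def literalPre (b : Bool) : List (Instr (Unit ⊕ Option Empty) LeafBit) :=
  [ .classical (fun _ _ => true) .zero .zero .one,
    .measure2 (.inl ()) (.inr none) (by decide) .zero .one .zero .one .out,
    .pauli (.inr none) .out .zero,
    .pauli (.inr none) (if b then .one else .zero) .zero ]

theorem kraus_literalPre (b : Bool) (o : List Bool) (a : Bool) (κ : ℂ) :
    kraus (literalPre b) o ⊥ (fun s => ind (s (.inl ())) a * κ) =
      fun s => ind (s (.inl ())) a * (ind (s (.inr none)) (a ^^ b) * κ) := by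
  simp only [← amp_run, literalPre, run_measure2, run_classical, run_pauli, run_nil]
  generalize o.headD false = o₁
  simp only [ne_eq, reduceCtorEq, not_false_eq_true, update_of_ne, update_self, proj2_ZZ,
    Pi.bot_apply, bot_eq_false]
  funext s
  cases b <;>
    simp only [pauliOp_X, ne_eq, reduceCtorEq, not_false_eq_true, update_of_ne, update_self,
      if_true, Bool.false_eq_true, if_false] <;>
    generalize s (.inl ()) = p <;> generalize s (.inr none) = q <;>
    cases a <;> cases p <;> cases q <;> cases o₁ <;> simp

/-- Prepares the ancilla qubit in the basis state `b`. -/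
def constPre (b : Bool) : List (Instr (Empty ⊕ Option Empty) LeafBit) :=
  [ .classical (fun _ _ => true) .zero .zero .one,
    .measure1 (.inr none) .zero .out,
    .pauli (.inr none) .out .zero,
    .pauli (.inr none) (if b then .one else .zero) .zero ]

theorem kraus_constPre (b : Bool) (o : List Bool) (κ : ℂ) :
    kraus (constPre b) o ⊥ (fun _ => κ) = fun s => ind (s (.inr none)) b * κ := by
  simp only [← amp_run, constPre, run_measure1, run_classical, run_pauli, run_nil]
  generalize o.headD false = o₁
  simp only [ne_eq, reduceCtorEq, not_false_eq_true, update_of_ne, update_self, proj1_Z,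
    Pi.bot_apply, bot_eq_false, Bool.not_false]
  funext s
  cases b <;>
    simp only [pauliOp_X, ne_eq, reduceCtorEq, not_false_eq_true, update_of_ne, update_self,
      if_true, Bool.false_eq_true, if_false] <;>
    generalize s (.inr none) = q <;> cases q <;> cases o₁ <;> simp

theorem literalPre_tick_le (b : Bool) :
    (literalPre b).foldl Instr.tick (Clock.const _ _ 0) ≤ Clock.const _ _ 1 := by
  refine ⟨?_, fun c => by cases b <;> cases c <;> decide⟩
  rintro (_ | _ | q)
  · cases b <;> decide +revert
  · cases b <;> decide
  · exact q.elim

theorem constPre_tick_le (b : Bool) :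
    (constPre b).foldl Instr.tick (Clock.const _ _ 0) ≤ Clock.const _ _ 1 := by
  refine ⟨?_, fun c => by cases b <;> cases c <;> decide⟩
  rintro (q | _ | q)
  · exact q.elim
  · cases b <;> decide
  · exact q.elim

end Leaf

section MeasureX

/-- Measures a qubit in the `X` basis and stores the outcome in the bit `false`. -/
def measureX : List (Instr Unit Bool) :=
  [ .classical (fun _ _ => true) true true true, .measure1 () true false ]

theorem kraus_measureX (o : List Bool) (m : Bool → Bool) (a : Bool) :
    kraus measureX o m (fun s => ind (s ()) a) =
      fun s => sgn (o.headD false && a) * (sgn (o.headD false && s ()) / 2) := by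
  simp only [← amp_run, measureX, run_measure1, run_classical, run_nil, update_self, Bool.not_true]
  exact proj1_X_ind () _ a

theorem finalMem_measureX (o : List Bool) (m : Bool → Bool) :
    finalMem measureX o m = update (update m true true) false (o.headD false) := rfl

end MeasureX

/-! ### Supplies of ancilla states -/

theorem normSq_eq_card_mul {Y : Type*} [Fintype Y] {ψ : Y → ℂ} {c : ℝ}
    (h : ∀ s, ‖ψ s‖ ^ 2 = c) : normSq ψ = Fintype.card Y * c := by
  simp [normSq, h]

theorem norm_ofReal_sqrt_sq {a : ℝ} (ha : 0 ≤ a) : ‖(Real.sqrt a : ℂ)‖ ^ 2 = a := by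
  rw [Complex.norm_real, Real.norm_eq_abs, sq_abs, Real.sq_sqrt ha]

theorem AncillaState.normSq_amplitude (r : AncillaState) : normSq r.amplitude = 1 := by
  have h2 := norm_ofReal_sqrt_sq (a := 2) (by norm_num)
  have h8 := norm_ofReal_sqrt_sq (a := 8) (by norm_num)
  have hcard : ∀ n, Fintype.card (Fin n → Bool) = 2 ^ n := fun n => by simp
  cases r with
  | zero =>
    simp only [normSq, AncillaState.amplitude, apply_ite norm, norm_one, norm_zero, ite_pow]
    simp
  | plus =>
    rw [normSq_eq_card_mul (c := 1 / 2) fun s => by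
      simp only [AncillaState.amplitude, norm_div, norm_one, div_pow, h2, one_pow], hcard]
    norm_num [AncillaState.arity]
  | tState =>
    rw [normSq_eq_card_mul (c := 1 / 2) fun s => by
      simp only [AncillaState.amplitude, norm_div, div_pow, h2, apply_ite norm, norm_one,
        mul_comm Complex.I, Complex.norm_exp_ofReal_mul_I, ite_self, one_pow], hcard]
    norm_num [AncillaState.arity]
  | cczState =>
    rw [normSq_eq_card_mul (c := 1 / 8) fun s => by
      simp only [AncillaState.amplitude, norm_div, div_pow, h8, apply_ite norm, norm_neg,
        norm_one, ite_self, one_pow], hcard]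
    norm_num [AncillaState.arity]

/-- The amplitude function `init` on the qubits `A` is a product of at most `N` of the states in
which ancilla qubits can be supplied. -/
def IsSupply {A : Type} (init : (A → Bool) → ℂ) (N : ℕ) : Prop :=
  ∃ (R : Type) (_ : Fintype R) (_ : DecidableEq R) (res : R → AncillaState)
    (e : (Σ r, Fin (res r).arity) ≃ A),
    (∀ s, init s = ∏ r, (res r).amplitude fun i => s (e ⟨r, i⟩)) ∧ Fintype.card R ≤ N

/-- The initial state of the ancilla qubits of the circuit. -/
noncomputable def Circuit.init {D : Type} (V : Circuit D) (s : V.Anc → Bool) : ℂ :=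
  ∏ r, (V.res r).amplitude fun i => s ⟨r, i⟩

/-- The amplitude of the state `|+⟩`. -/
noncomputable def plusAmp : ℂ := 1 / (Real.sqrt 2 : ℂ)

namespace IsSupply

theorem empty : IsSupply (fun _ : Empty → Bool => 1) 0 :=
  ⟨Empty, inferInstance, inferInstance, Empty.elim, Equiv.equivOfIsEmpty _ _, by simp, by simp⟩

theorem single (r : AncillaState) : IsSupply r.amplitude 1 :=
  ⟨Unit, inferInstance, inferInstance, fun _ => r, Equiv.uniqueSigma _, fun s => by simp; rfl,
    by simp⟩

theorem of_circuit {D : Type} (P : Circuit D) : IsSupply P.init (Fintype.card P.R) :=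
  ⟨P.R, inferInstance, inferInstance, P.res, Equiv.refl _, fun _ => rfl, le_rfl⟩

variable {A A' : Type} {init : (A → Bool) → ℂ} {init' : (A' → Bool) → ℂ} {N N' : ℕ}

theorem mono (h : IsSupply init N) (hN : N ≤ N') : IsSupply init N' := by
  obtain ⟨R, _, _, res, e, hinit, hcard⟩ := h
  exact ⟨R, _, ‹_›, res, e, hinit, hcard.trans hN⟩

theorem sum (h : IsSupply init N) (h' : IsSupply init' N') :
    IsSupply (fun s : A ⊕ A' → Bool => init (s ∘ .inl) * init' (s ∘ .inr)) (N + N') := by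
  obtain ⟨R, _, _, res, e, hinit, hcard⟩ := h
  obtain ⟨R', _, _, res', e', hinit', hcard'⟩ := h'
  refine ⟨R ⊕ R', inferInstance, inferInstance, Sum.elim res res',
    (Equiv.sumSigmaDistrib fun r => Fin (Sum.elim res res' r).arity).trans
      (Equiv.sumCongr (α₁ := Σ r, Fin (res r).arity) (β₁ := Σ r, Fin (res' r).arity) e e'),
    fun s => ?_, ?_⟩
  · rw [Fintype.prod_sum_type]
    exact congrArg₂ (· * ·) (hinit _) (hinit' _)
  · rw [Fintype.card_sum]
    exact Nat.add_le_add hcard hcard'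

theorem congr (h : IsSupply init N) (e : A ≃ A') :
    IsSupply (fun s : A' → Bool => init (s ∘ e)) N := by
  obtain ⟨R, _, _, res, e', hinit, hcard⟩ := h
  exact ⟨R, _, ‹_›, res, e'.trans e, fun s => hinit _, hcard⟩

theorem plus : IsSupply (fun _ : Unit → Bool => plusAmp) 1 :=
  (single .plus).congr (A' := Unit) (Equiv.ofUnique (Fin 1) Unit)

theorem zero : IsSupply (fun s : Unit → Bool => ind (s ()) false) 1 := by
  convert (single .zero).congr (A' := Unit) (Equiv.ofUnique (Fin 1) Unit) using 2 with s
  simp [ind, AncillaState.amplitude, funext_iff, AncillaState.arity]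

theorem ccz : IsSupply (fun s : Fin 3 → Bool =>
    sgn (s 0 && s 1 && s 2) * (1 / (Real.sqrt 8 : ℂ))) 1 := by
  have hamp (s : Fin 3 → Bool) : AncillaState.cczState.amplitude s =
      sgn (s 0 && s 1 && s 2) * (1 / (Real.sqrt 8 : ℂ)) := by
    have hs : (s = fun _ => true) ↔ (s 0 && s 1 && s 2) = true := by
      simp [funext_iff, Fin.forall_fin_succ, and_assoc]
    rw [mul_one_div]
    refine congrArg (· / _) ?_
    by_cases h : (s 0 && s 1 && s 2) = true
    · exact (if_pos (hs.2 h)).trans (if_pos h).symm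
    · exact (if_neg (mt hs.1 h)).trans (if_neg h).symm
  exact (funext hamp : AncillaState.cczState.amplitude = _) ▸ single .cczState

theorem normSq_eq_one [Fintype A] [DecidableEq A] (h : IsSupply init N) : normSq init = 1 := by
  obtain ⟨R, _, _, res, e, hinit, -⟩ := h
  have hprod : ∑ p : ∀ r, Fin (res r).arity → Bool, ∏ r, ‖(res r).amplitude (p r)‖ ^ 2 = 1 := by
    rw [← Fintype.piFinset_univ, ← Finset.prod_univ_sum
      (fun r => (Finset.univ : Finset (Fin (res r).arity → Bool)))
      (fun r a => ‖(res r).amplitude a‖ ^ 2)]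
    exact Finset.prod_eq_one fun r _ => (res r).normSq_amplitude
  rw [normSq, ← hprod,
    ← ((e.arrowCongr (Equiv.refl Bool)).symm.trans (Equiv.piCurry fun _ _ => Bool)).sum_comp]
  refine Finset.sum_congr rfl fun s _ => ?_
  rw [hinit, norm_prod, Finset.prod_pow]
  rfl

end IsSupply

/-- The initial state of the ancilla qubits of the conjunction gadget. -/
noncomputable def andInit (s : AndAnc → Bool) : ℂ :=
  plusAmp * plusAmp *
    (sgn (s .x && s .y && s .z) * (1 / (Real.sqrt 8 : ℂ)) * ind (s .u) false)

/-- Labels the ancilla qubits of the conjunction gadget by the states that supply them. -/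
def andAncEquiv : (Unit ⊕ Unit) ⊕ (Fin 3 ⊕ Unit) ≃ AndAnc where
  toFun := Sum.elim (Sum.elim (fun _ => .p) fun _ => .q) (Sum.elim ![.x, .y, .z] fun _ => .u)
  invFun
    | .p => .inl (.inl ())
    | .q => .inl (.inr ())
    | .x => .inr (.inl 0)
    | .y => .inr (.inl 1)
    | .z => .inr (.inl 2)
    | .u => .inr (.inr ())
  left_inv := by decide
  right_inv := by rintro (_ | _) <;> rfl

instance : Fintype AndAnc := .ofEquiv _ andAncEquiv

theorem isSupply_andInit : IsSupply andInit 4 :=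
  ((IsSupply.plus.sum .plus).sum (IsSupply.ccz.sum .zero)).congr andAncEquiv

/-! ### Computing and uncomputing a Boolean function -/

/-- The basis state `x`. -/
noncomputable def ket {E : Type*} (x s : E → Bool) : ℂ :=
  open Classical in if s = x then 1 else 0

theorem ket_sum {E E' : Type*} (x s : E ⊕ E' → Bool) :
    ket x s = ket (x ∘ .inl) (s ∘ .inl) * ket (x ∘ .inr) (s ∘ .inr) := by
  have hs : s = x ↔ s ∘ .inl = x ∘ .inl ∧ s ∘ .inr = x ∘ .inr := by
    simp [funext_iff]
  by_cases hl : s ∘ .inl = x ∘ .inl <;> by_cases hr : s ∘ .inr = x ∘ .inr <;>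
    simp [ket, hs, hl, hr]

theorem ket_unit (x s : Unit → Bool) : ket x s = ind (s ()) (x ()) := by
  have hs : s = x ↔ s () = x () := ⟨fun h => h ▸ rfl, fun h => funext fun _ => h⟩
  by_cases hx : s () = x () <;> simp [ket, ind, hs, hx]

theorem ket_empty (x s : Empty → Bool) : ket x s = 1 :=
  if_pos (Subsingleton.elim s x)

/-- A circuit `pre` that writes `f x` into an ancilla qubit `none`, for data in the basis state `x`,
and a circuit `post` that removes the by-products, after that qubit has been measured in the `X`
basis with an outcome that is stored in `pend`.  Single-qubit `Z` corrections of the data qubits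
remain, controlled by the bits `corr`.  The data qubits are occupied for one cycle, and `pre` and
`post` take `1 + 2 * L` and `2 * L` cycles.  There are at most `N` ancilla states other than the one
of the qubit `none`, and at most `N` instructions. -/
structure Evaluator (E : Type) [Fintype E] [DecidableEq E] (f : (E → Bool) → Bool)
    (L N : ℕ) where
  A : Type
  B : Type
  [decEqA : DecidableEq A]
  [decEqB : DecidableEq B]
  [fintypeA : Fintype A]
  init : (A → Bool) → ℂ
  supply : IsSupply init N
  pre : List (Instr (E ⊕ Option A) B)
  post : List (Instr A B)
  length_le : pre.length + post.length ≤ N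
  pend : B
  corr : E → B
  /-- The state of the ancilla qubits `A` after `pre`, and its amplitudes, up to signs, after
  `post`, for given outcomes. -/
  state : List Bool → (E → Bool) → (A → Bool) → ℂ
  final : List Bool → List Bool → Bool → (A → Bool) → ℂ
  kraus_pre : ∀ o x, kraus pre o ⊥
    (fun s => ket x (s ∘ .inl) * (plusAmp * init (s ∘ .inr ∘ some))) =
      fun s => ket x (s ∘ .inl) * (ind (s (.inr none)) (f x) * state o x (s ∘ .inr ∘ some))
  kraus_post : ∀ o o' r x, kraus post o' (update (finalMem pre o ⊥) pend r) (state o x) =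
    fun s => sgn (r && f x) *
      (∏ e, sgn (finalMem post o' (update (finalMem pre o ⊥) pend r) (corr e) && x e)) *
        final o o' r s
  pre_tick_le : pre.foldl Instr.tick (Clock.const _ _ 0) ≤
    ⟨Sum.elim (fun _ => 1) fun _ => 1 + 2 * L, fun _ => 1 + 2 * L⟩
  post_tick_le : post.foldl Instr.tick (Clock.const _ _ 0) ≤ Clock.const _ _ (2 * L)

attribute [instance] Evaluator.decEqA Evaluator.decEqB Evaluator.fintypeA

theorem sgn_mul_self (b : Bool) : sgn b * sgn b = 1 := by
  cases b <;> simp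

/-- Copies a data qubit, negated if `b` is set, as the value of a literal. -/
noncomputable def Evaluator.literal (b : Bool) : Evaluator Unit (fun x => x () ^^ b) 0 4 where
  A := Empty
  B := LeafBit
  init := fun _ => 1
  supply := IsSupply.empty.mono (by norm_num)
  pre := literalPre b
  post := []
  length_le := by simp [literalPre]
  pend := .pend
  corr := fun _ => .pend
  state := fun _ _ _ => plusAmp
  final := fun _ _ r _ => sgn (r && b) * plusAmp
  kraus_pre := fun o x => by
    simpa only [ket_unit, mul_one] using! kraus_literalPre b o (x ()) plusAmp
  kraus_post := fun o o' r x => by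
    funext s
    change plusAmp = _
    simp only [finalMem, run, Finset.univ_unique, Finset.prod_singleton, update_self]
    cases r <;> cases x () <;> cases b <;> simp
  pre_tick_le := (literalPre_tick_le b).trans ⟨by rintro (_ | _) <;> rfl, fun _ => le_rfl⟩
  post_tick_le := le_rfl

/-- Prepares a constant. -/
noncomputable def Evaluator.const (b : Bool) : Evaluator Empty (fun _ => b) 0 4 where
  A := Empty
  B := LeafBit
  init := fun _ => 1
  supply := IsSupply.empty.mono (by norm_num)
  pre := constPre b
  post := []
  length_le := by simp [constPre]
  pend := .pend
  corr := fun _ => .pend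
  state := fun _ _ _ => plusAmp
  final := fun _ _ r _ => sgn (r && b) * plusAmp
  kraus_pre := fun o x => by
    simpa only [ket_empty, one_mul, mul_one] using kraus_constPre b o plusAmp
  kraus_post := fun o o' r x => by
    funext s
    change plusAmp = _
    simp [← mul_assoc, sgn_mul_self]
  pre_tick_le := (constPre_tick_le b).trans ⟨by rintro (_ | _) <;> rfl, fun _ => le_rfl⟩
  post_tick_le := le_rfl

/-! ### Conjunctions -/

section ConjLayout

variable {E₁ E₂ A₁ A₂ B₁ B₂ : Type}

/-- The ancilla qubits of the evaluator of a conjunction, for given ancilla qubits of the evaluators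
of the conjuncts. -/
abbrev ConjAnc (A₁ A₂ : Type) : Type := A₁ ⊕ (A₂ ⊕ AndAnc)

/-- The classical bits of the evaluator of a conjunction, for given bits of the evaluators of the
conjuncts. -/
abbrev ConjBit (B₁ B₂ : Type) : Type := B₁ ⊕ (B₂ ⊕ (AndBit ⊕ UnandBit))

/-- Places the evaluator of the left conjunct, whose output becomes the qubit `p`. -/
@[simps]
def conjLeft : E₁ ⊕ Option A₁ ↪ (E₁ ⊕ E₂) ⊕ Option (ConjAnc A₁ A₂) where
  toFun := Sum.map .inl fun a => some (a.elim (.inr (.inr .p)) .inl)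
  inj' := by rintro (e | _ | a) (e' | _ | a') h <;> simp_all

/-- Places the evaluator of the right conjunct, whose output becomes the qubit `q`. -/
@[simps]
def conjRight : E₂ ⊕ Option A₂ ↪ (E₁ ⊕ E₂) ⊕ Option (ConjAnc A₁ A₂) where
  toFun := Sum.map .inr fun a => some (.inr (a.elim (.inr .q) .inl))
  inj' := by rintro (e | _ | a) (e' | _ | a') h <;> simp_all

/-- Places the gadget `andPre`. -/
@[simps]
def conjAnd : Option AndAnc ↪ (E₁ ⊕ E₂) ⊕ Option (ConjAnc A₁ A₂) where
  toFun := .inr ∘ Option.map (.inr ∘ .inr)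
  inj' := Sum.inr_injective.comp (Option.map_injective (Sum.inr_injective.comp Sum.inr_injective))

/-- Places the gadget `andPost`. -/
@[simps]
def conjUnand : Bool ↪ ConjAnc A₁ A₂ where
  toFun b := .inr (.inr (cond b .p .q))
  inj' := by rintro (_ | _) (_ | _) h <;> simp_all

/-- Routes the outcomes of `andPost` to the bits `b₁` and `b₂` that are pending in the evaluators of
the conjuncts. -/
def conjUnandBit (b₁ : B₁) (b₂ : B₂) : UnandBit → ConjBit B₁ B₂
  | .left => .inl b₁
  | .right => .inr (.inl b₂)
  | b => .inr (.inr (.inr b))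

theorem conjUnandBit_injective (b₁ : B₁) (b₂ : B₂) : Injective (conjUnandBit b₁ b₂) := by
  intro a b h
  cases a <;> cases b <;> simp_all [conjUnandBit]

theorem conjLeft_ne_conjRight (q : E₁ ⊕ Option A₁) (q' : E₂ ⊕ Option A₂) :
    conjLeft q ≠ conjRight q' := by
  rcases q with e | _ | a <;> rcases q' with e' | _ | a' <;> simp

theorem inr_inl_injective {α β γ : Type} : Injective (.inr ∘ .inl : β → α ⊕ (β ⊕ γ)) :=
  Sum.inr_injective.comp Sum.inl_injective

theorem inr_inr_inl_injective {α β γ δ : Type} :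
    Injective (.inr ∘ .inr ∘ .inl : γ → α ⊕ (β ⊕ (γ ⊕ δ))) :=
  Sum.inr_injective.comp inr_inl_injective

/-- The initial state of the ancilla qubits of the evaluator of a conjunction. -/
noncomputable def conjInit (init₁ : (A₁ → Bool) → ℂ) (init₂ : (A₂ → Bool) → ℂ)
    (s : ConjAnc A₁ A₂ → Bool) : ℂ :=
  init₁ (s ∘ .inl) * (init₂ (s ∘ .inr ∘ .inl) * andInit (s ∘ .inr ∘ .inr))

end ConjLayout

namespace Evaluator

variable {E₁ E₂ : Type} [Fintype E₁] [DecidableEq E₁] [Fintype E₂] [DecidableEq E₂]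
  {f₁ : (E₁ → Bool) → Bool} {f₂ : (E₂ → Bool) → Bool} {L N₁ N₂ : ℕ}
  (C₁ : Evaluator E₁ f₁ L N₁) (C₂ : Evaluator E₂ f₂ L N₂)

theorem isSupply_conjInit : IsSupply (conjInit C₁.init C₂.init) (N₁ + N₂ + 27) :=
  (C₁.supply.sum (C₂.supply.sum isSupply_andInit)).mono (by omega)

/-- Evaluates both conjuncts. -/
def conjPrePair : List (Instr ((E₁ ⊕ E₂) ⊕ Option (ConjAnc C₁.A C₂.A)) (ConjBit C₁.B C₂.B)) :=
  C₁.pre.map (Instr.relabel conjLeft .inl) ++ C₂.pre.map (Instr.relabel conjRight (.inr ∘ .inl))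

/-- Evaluates the conjunction. -/
def conjPre : List (Instr ((E₁ ⊕ E₂) ⊕ Option (ConjAnc C₁.A C₂.A)) (ConjBit C₁.B C₂.B)) :=
  conjPrePair C₁ C₂ ++ andPre.map (Instr.relabel conjAnd (.inr ∘ .inr ∘ .inl))

/-- Uncomputes both conjuncts. -/
def conjPostPair : List (Instr (ConjAnc C₁.A C₂.A) (ConjBit C₁.B C₂.B)) :=
  C₁.post.map (Instr.relabel .inl .inl) ++
    C₂.post.map (Instr.relabel (Embedding.inl.trans .inr) (.inr ∘ .inl))

/-- Uncomputes the conjunction. -/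
def conjPost : List (Instr (ConjAnc C₁.A C₂.A) (ConjBit C₁.B C₂.B)) :=
  andPost.map (Instr.relabel conjUnand (conjUnandBit C₁.pend C₂.pend)) ++ conjPostPair C₁ C₂

theorem length_conjPre_add_length_conjPost_le :
    (conjPre C₁ C₂).length + (conjPost C₁ C₂).length ≤ N₁ + N₂ + 27 := by
  have h₁ := C₁.length_le
  have h₂ := C₂.length_le
  have hpre : andPre.length = 24 := rfl
  have hpost : andPost.length = 3 := rfl
  simp only [conjPre, conjPrePair, conjPost, conjPostPair, List.length_append, List.length_map]
  omega

variable (o : List Bool)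

theorem finalMem_conjPrePair_comp {γ : Type} (g : γ → AndBit ⊕ UnandBit) :
    finalMem (conjPrePair C₁ C₂) o ⊥ ∘ (.inr ∘ .inr ∘ g) = ⊥ := by
  rw [conjPrePair, finalMem_append,
    finalMem_relabel_comp_of_ne _ inr_inl_injective (by simp),
    finalMem_relabel_comp_of_ne _ Sum.inl_injective (by simp)]
  rfl

theorem finalMem_conjPre_inl : finalMem (conjPre C₁ C₂) o ⊥ ∘ .inl = finalMem C₁.pre o ⊥ := by
  rw [conjPre, conjPrePair, finalMem_append, finalMem_append,
    finalMem_relabel_comp_of_ne _ inr_inr_inl_injective (by simp),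
    finalMem_relabel_comp_of_ne _ inr_inl_injective (by simp),
    finalMem_relabel_comp _ Sum.inl_injective]
  rfl

theorem finalMem_conjPre_inr_inl : finalMem (conjPre C₁ C₂) o ⊥ ∘ (.inr ∘ .inl) =
    finalMem C₂.pre (o.drop (measCount C₁.pre)) ⊥ := by
  rw [conjPre, conjPrePair, finalMem_append, finalMem_append,
    finalMem_relabel_comp_of_ne _ inr_inr_inl_injective (by simp),
    finalMem_relabel_comp _ inr_inl_injective, measCount_map_relabel,
    finalMem_relabel_comp_of_ne _ Sum.inl_injective (by simp)]
  rfl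

theorem finalMem_conjPre_inr_inr_inr : finalMem (conjPre C₁ C₂) o ⊥ ∘ (.inr ∘ .inr ∘ .inr) = ⊥ := by
  rw [conjPre, finalMem_append, finalMem_relabel_comp_of_ne _ inr_inr_inl_injective (by simp),
    finalMem_conjPrePair_comp]

/-- The state of the ancilla qubits after both conjuncts have been evaluated, except those of the
gadget `andPre`. -/
noncomputable def conjPairState (x : E₁ ⊕ E₂ → Bool) (s : ConjAnc C₁.A C₂.A → Bool) : ℂ :=
  C₁.state o (x ∘ .inl) (s ∘ .inl) *
    C₂.state (o.drop (measCount C₁.pre)) (x ∘ .inr) (s ∘ .inr ∘ .inl)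

theorem kraus_conjPrePair (x : E₁ ⊕ E₂ → Bool) : kraus (conjPrePair C₁ C₂) o ⊥
    (fun s => ket x (s ∘ .inl) * (plusAmp * conjInit C₁.init C₂.init (s ∘ .inr ∘ some))) =
    fun s => ind (s (conjAnd (some .p))) (f₁ (x ∘ .inl)) *
      ind (s (conjAnd (some .q))) (f₂ (x ∘ .inr)) *
      (sgn (s (conjAnd (some .x)) && s (conjAnd (some .y)) && s (conjAnd (some .z))) *
        ind (s (conjAnd (some .u))) false) *
      (ket x (s ∘ .inl) * conjPairState C₁ C₂ o x (s ∘ .inr ∘ some) *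
        (plusAmp * (1 / (Real.sqrt 8 : ℂ)))) := by
  set κ : (Option AndAnc → Bool) → ℂ := fun s =>
    sgn (s (some .x) && s (some .y) && s (some .z)) * ind (s (some .u)) false *
      (plusAmp * (1 / (Real.sqrt 8 : ℂ))) with hκ
  have hrun := kraus_relabel_append (conjLeft (E₂ := E₂) (A₂ := C₂.A)) Sum.inl_injective conjRight
    (inr_inl_injective (α := C₁.B) (γ := AndBit ⊕ UnandBit)) conjLeft_ne_conjRight (by simp)
    (R := fun s => κ (s ∘ conjAnd)) (by rintro s (e | _ | a) v <;> simp [hκ])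
    (by rintro s (e | _ | a) v <;> simp [hκ]) C₁.pre C₂.pre o ⊥
    (fun s => ket (x ∘ .inl) (s ∘ .inl) * (plusAmp * C₁.init (s ∘ .inr ∘ some)))
    (fun s => ket (x ∘ .inr) (s ∘ .inl) * (plusAmp * C₂.init (s ∘ .inr ∘ some)))
  rw [show (⊥ : ConjBit C₁.B C₂.B → Bool) ∘ .inl = ⊥ from rfl,
    show (⊥ : ConjBit C₁.B C₂.B → Bool) ∘ (.inr ∘ .inl) = ⊥ from rfl,
    C₁.kraus_pre, C₂.kraus_pre] at hrun
  calc kraus (conjPrePair C₁ C₂) o ⊥ _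
    _ = _ := congrArg _ (funext fun s => by
      simp only [ket_sum x, conjInit, andInit, hκ, comp_def, conjLeft_apply, conjRight_apply,
        conjAnd_apply, Sum.map_inl, Sum.map_inr, Option.elim_some, Option.map_some]
      ring)
    _ = _ := hrun
    _ = _ := funext fun s => by
      simp only [ket_sum x, conjPairState, hκ, comp_def, conjLeft_apply, conjRight_apply,
        conjAnd_apply, Sum.map_inl, Sum.map_inr, Option.elim_some, Option.elim_none,
        Option.map_some]
      ring

/-- The state in which `andPre` leaves the qubits `x`, `y`, `z` and `u`. -/
noncomputable def conjJunk (s : AndAnc → Bool) : ℂ :=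
  (exists_kraus_andPre (o.drop (measCount (conjPrePair C₁ C₂)))).choose
    (s .x) (s .y) (s .z) (s .u) * (plusAmp * (1 / (Real.sqrt 8 : ℂ)))

/-- The state of the ancilla qubits after the conjunction has been evaluated. -/
noncomputable def conjState (x : E₁ ⊕ E₂ → Bool) (s : ConjAnc C₁.A C₂.A → Bool) : ℂ :=
  ind (s (conjUnand true)) (f₁ (x ∘ .inl)) * ind (s (conjUnand false)) (f₂ (x ∘ .inr)) *
    (conjPairState C₁ C₂ o x s * conjJunk C₁ C₂ o (s ∘ .inr ∘ .inr))

theorem kraus_conjPre (x : E₁ ⊕ E₂ → Bool) : kraus (conjPre C₁ C₂) o ⊥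
    (fun s => ket x (s ∘ .inl) * (plusAmp * conjInit C₁.init C₂.init (s ∘ .inr ∘ some))) =
    fun s => ket x (s ∘ .inl) * (ind (s (.inr none)) (f₁ (x ∘ .inl) && f₂ (x ∘ .inr)) *
      conjState C₁ C₂ o x (s ∘ .inr ∘ some)) := by
  set o' := o.drop (measCount (conjPrePair C₁ C₂)) with ho'
  have hrun := kraus_relabel (conjAnd (E₁ := E₁) (E₂ := E₂) (A₁ := C₁.A) (A₂ := C₂.A))
    (inr_inr_inl_injective (α := C₁.B) (β := C₂.B) (δ := UnandBit))
    (R := fun s => ket x (s ∘ .inl) * conjPairState C₁ C₂ o x (s ∘ .inr ∘ some) *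
      (plusAmp * (1 / (Real.sqrt 8 : ℂ))))
    (by rintro s (_ | i) v <;> simp [conjPairState, comp_def]) andPre o'
    (finalMem (conjPrePair C₁ C₂) o ⊥)
    (fun s => ind (s (some .p)) (f₁ (x ∘ .inl)) * ind (s (some .q)) (f₂ (x ∘ .inr)) *
      (sgn (s (some .x) && s (some .y) && s (some .z)) * ind (s (some .u)) false))
  rw [finalMem_conjPrePair_comp, (exists_kraus_andPre o').choose_spec] at hrun
  rw [conjPre, kraus_append, kraus_conjPrePair, ← ho']
  refine hrun.trans (funext fun s => ?_)
  simp only [conjState, conjJunk, comp_apply, conjAnd_apply, conjUnand_apply,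
    Option.map_some, Option.map_none, cond_true, cond_false]
  ring

/-- The classical bits of `andPost` after its execution, for the outcomes `o` and `o'` of `conjPre`
and `conjPost`, and the pending sign `r` of the conjunction. -/
noncomputable def unandMem (o' : List Bool) (r : Bool) : UnandBit → Bool :=
  finalMem andPost o' (update (finalMem (conjPre C₁ C₂) o ⊥) (.inr (.inr (.inr .pend))) r ∘
    conjUnandBit C₁.pend C₂.pend)

variable (o' : List Bool) (r : Bool)

theorem update_finalMem_conjPre_comp_conjUnandBit :
    (update (finalMem (conjPre C₁ C₂) o ⊥) (.inr (.inr (.inr .pend))) r ∘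
      conjUnandBit C₁.pend C₂.pend) .zero = false ∧
    (update (finalMem (conjPre C₁ C₂) o ⊥) (.inr (.inr (.inr .pend))) r ∘
      conjUnandBit C₁.pend C₂.pend) .pend = r := by
  refine ⟨?_, update_self ..⟩
  exact (update_of_ne (by simp [conjUnandBit]) _ _).trans
    (congrFun (finalMem_conjPre_inr_inr_inr C₁ C₂ o) .zero)

theorem kraus_andPost_conjState (x : E₁ ⊕ E₂ → Bool) :
    kraus (andPost.map (Instr.relabel conjUnand (conjUnandBit C₁.pend C₂.pend))) o'
      (update (finalMem (conjPre C₁ C₂) o ⊥) (.inr (.inr (.inr .pend))) r)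
      (conjState C₁ C₂ o x) = fun s =>
        graphSign r (unandMem C₁ C₂ o o' r .left) (unandMem C₁ C₂ o o' r .right)
          (f₁ (x ∘ .inl)) (f₂ (x ∘ .inr)) *
        (graphSign r (unandMem C₁ C₂ o o' r .left) (unandMem C₁ C₂ o o' r .right)
          (s (conjUnand true)) (s (conjUnand false)) / 4) *
        (conjPairState C₁ C₂ o x s * conjJunk C₁ C₂ o (s ∘ .inr ∘ .inr)) := by
  obtain ⟨hzero, hpend⟩ := update_finalMem_conjPre_comp_conjUnandBit C₁ C₂ o r
  have hrun := kraus_relabel (conjUnand (A₁ := C₁.A) (A₂ := C₂.A))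
    (conjUnandBit_injective C₁.pend C₂.pend)
    (R := fun s => conjPairState C₁ C₂ o x s * conjJunk C₁ C₂ o (s ∘ .inr ∘ .inr))
    (by rintro s (_ | _) v <;> simp [conjPairState, conjJunk, comp_def]) andPost o'
    (update (finalMem (conjPre C₁ C₂) o ⊥) (.inr (.inr (.inr .pend))) r)
    (fun s => ind (s true) (f₁ (x ∘ .inl)) * ind (s false) (f₂ (x ∘ .inr)))
  rw [kraus_andPost o' hzero, hpend] at hrun
  exact hrun

theorem extend_conjUnandBit_comp_inl {B₁ B₂ : Type} [DecidableEq B₁] (b₁ : B₁) (b₂ : B₂)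
    (u : UnandBit → Bool) (v : ConjBit B₁ B₂ → Bool) :
    extend (conjUnandBit b₁ b₂) u v ∘ .inl = update (v ∘ .inl) b₁ (u .left) := by
  funext b
  by_cases hb : b = b₁
  · subst hb
    rw [update_self]
    exact (conjUnandBit_injective b b₂).extend_apply _ _ .left
  · rw [update_of_ne hb]
    refine extend_apply' _ _ _ ?_
    rintro ⟨_ | _ | _ | _ | _, h⟩ <;> simp_all [conjUnandBit]

theorem extend_conjUnandBit_comp_inr_inl {B₁ B₂ : Type} [DecidableEq B₂] (b₁ : B₁) (b₂ : B₂)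
    (u : UnandBit → Bool) (v : ConjBit B₁ B₂ → Bool) :
    extend (conjUnandBit b₁ b₂) u v ∘ (.inr ∘ .inl) =
      update (v ∘ (.inr ∘ .inl)) b₂ (u .right) := by
  funext b
  by_cases hb : b = b₂
  · subst hb
    rw [update_self]
    exact (conjUnandBit_injective b₁ b).extend_apply _ _ .right
  · rw [update_of_ne hb]
    refine extend_apply' _ _ _ ?_
    rintro ⟨_ | _ | _ | _ | _, h⟩ <;> simp_all [conjUnandBit]

/-- The classical bits after the conjunction has been uncomputed, but not the conjuncts. -/
noncomputable def conjMidMem : ConjBit C₁.B C₂.B → Bool :=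
  finalMem (andPost.map (Instr.relabel (conjUnand (A₁ := C₁.A) (A₂ := C₂.A))
      (conjUnandBit C₁.pend C₂.pend))) o'
    (update (finalMem (conjPre C₁ C₂) o ⊥) (.inr (.inr (.inr .pend))) r)

theorem conjMidMem_comp_inl : conjMidMem C₁ C₂ o o' r ∘ .inl =
    update (finalMem C₁.pre o ⊥) C₁.pend (unandMem C₁ C₂ o o' r .left) := by
  rw [conjMidMem, finalMem_relabel _ (conjUnandBit_injective _ _), extend_conjUnandBit_comp_inl,
    update_comp_eq_of_forall_ne _ _ (by simp), finalMem_conjPre_inl]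
  rfl

theorem conjMidMem_comp_inr_inl : conjMidMem C₁ C₂ o o' r ∘ (.inr ∘ .inl) =
    update (finalMem C₂.pre (o.drop (measCount C₁.pre)) ⊥) C₂.pend
      (unandMem C₁ C₂ o o' r .right) := by
  rw [conjMidMem, finalMem_relabel _ (conjUnandBit_injective _ _),
    extend_conjUnandBit_comp_inr_inl, update_comp_eq_of_forall_ne _ _ (by simp),
    finalMem_conjPre_inr_inl]
  rfl

theorem finalMem_conjPost_inl : finalMem (conjPost C₁ C₂) o'
    (update (finalMem (conjPre C₁ C₂) o ⊥) (.inr (.inr (.inr .pend))) r) ∘ .inl =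
    finalMem C₁.post (o'.drop (measCount andPost))
      (update (finalMem C₁.pre o ⊥) C₁.pend (unandMem C₁ C₂ o o' r .left)) := by
  rw [conjPost, conjPostPair, finalMem_append, finalMem_append,
    finalMem_relabel_comp_of_ne _ inr_inl_injective (by simp),
    finalMem_relabel_comp _ Sum.inl_injective, measCount_map_relabel, ← conjMidMem,
    conjMidMem_comp_inl]

theorem finalMem_conjPost_inr_inl : finalMem (conjPost C₁ C₂) o'
    (update (finalMem (conjPre C₁ C₂) o ⊥) (.inr (.inr (.inr .pend))) r) ∘ (.inr ∘ .inl) =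
    finalMem C₂.post ((o'.drop (measCount andPost)).drop (measCount C₁.post))
      (update (finalMem C₂.pre (o.drop (measCount C₁.pre)) ⊥) C₂.pend
        (unandMem C₁ C₂ o o' r .right)) := by
  rw [conjPost, conjPostPair, finalMem_append, finalMem_append,
    finalMem_relabel_comp _ inr_inl_injective, measCount_map_relabel, measCount_map_relabel,
    finalMem_relabel_comp_of_ne _ Sum.inl_injective (by simp), ← conjMidMem,
    conjMidMem_comp_inr_inl]

/-- The bits that control the corrections of the data qubits. -/
def conjCorr : E₁ ⊕ E₂ → ConjBit C₁.B C₂.B :=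
  Sum.elim (.inl ∘ C₁.corr) (.inr ∘ .inl ∘ C₂.corr)

/-- The state of the ancilla qubits after the conjunction has been uncomputed. -/
noncomputable def conjFinal (s : ConjAnc C₁.A C₂.A → Bool) : ℂ :=
  C₁.final o (o'.drop (measCount andPost)) (unandMem C₁ C₂ o o' r .left) (s ∘ .inl) *
  (C₂.final (o.drop (measCount C₁.pre)) ((o'.drop (measCount andPost)).drop (measCount C₁.post))
    (unandMem C₁ C₂ o o' r .right) (s ∘ .inr ∘ .inl) *
  (graphSign r (unandMem C₁ C₂ o o' r .left) (unandMem C₁ C₂ o o' r .right)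
    (s (conjUnand true)) (s (conjUnand false)) / 4 * conjJunk C₁ C₂ o (s ∘ .inr ∘ .inr)))

theorem sgn_mul_sgn_mul_graphSign (r r₁ r₂ a b : Bool) :
    sgn (r₁ && a) * (sgn (r₂ && b) * graphSign r r₁ r₂ a b) = sgn (r && (a && b)) := by
  rw [graphSign]
  linear_combination sgn (r && (a && b)) *
    (sgn (r₂ && b) * sgn (r₂ && b) * sgn_mul_self (r₁ && a) + sgn_mul_self (r₂ && b))

theorem kraus_conjPost (x : E₁ ⊕ E₂ → Bool) : kraus (conjPost C₁ C₂) o'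
    (update (finalMem (conjPre C₁ C₂) o ⊥) (.inr (.inr (.inr .pend))) r) (conjState C₁ C₂ o x) =
    fun s => sgn (r && (f₁ (x ∘ .inl) && f₂ (x ∘ .inr))) *
      (∏ e, sgn (finalMem (conjPost C₁ C₂) o'
        (update (finalMem (conjPre C₁ C₂) o ⊥) (.inr (.inr (.inr .pend))) r)
          (conjCorr C₁ C₂ e) && x e)) * conjFinal C₁ C₂ o o' r s := by
  set r₁ := unandMem C₁ C₂ o o' r .left with hr₁
  set r₂ := unandMem C₁ C₂ o o' r .right with hr₂
  have hrun := kraus_relabel_append (Embedding.inl (β := C₂.A ⊕ AndAnc)) Sum.inl_injective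
    (Embedding.inl.trans (Embedding.inr (α := C₁.A)))
    (inr_inl_injective (α := C₁.B) (γ := AndBit ⊕ UnandBit)) (by simp) (by simp)
    (R := fun s => graphSign r r₁ r₂ (f₁ (x ∘ .inl)) (f₂ (x ∘ .inr)) *
      (graphSign r r₁ r₂ (s (conjUnand true)) (s (conjUnand false)) / 4 *
        conjJunk C₁ C₂ o (s ∘ .inr ∘ .inr)))
    (by intro s a v; simp [conjJunk, comp_def]) (by intro s a v; simp [conjJunk, comp_def])
    C₁.post C₂.post (o'.drop (measCount andPost)) (conjMidMem C₁ C₂ o o' r)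
    (C₁.state o (x ∘ .inl)) (C₂.state (o.drop (measCount C₁.pre)) (x ∘ .inr))
  rw [conjMidMem_comp_inl, conjMidMem_comp_inr_inl, C₁.kraus_post, C₂.kraus_post,
    ← finalMem_conjPost_inl, ← finalMem_conjPost_inr_inl] at hrun
  calc kraus (conjPost C₁ C₂) o' _ _
    _ = kraus (conjPostPair C₁ C₂) (o'.drop (measCount andPost)) (conjMidMem C₁ C₂ o o' r) _ := by
      rw [conjPost, kraus_append, kraus_andPost_conjState, measCount_map_relabel, conjMidMem]
    _ = _ := congrArg _ (funext fun s => by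
      simp only [conjPairState, comp_def, Embedding.trans_apply, Embedding.inl_apply,
        Embedding.inr_apply, ← hr₁, ← hr₂]
      ring)
    _ = _ := hrun
    _ = _ := funext fun s => by
      rw [← sgn_mul_sgn_mul_graphSign r r₁ r₂]
      simp only [conjFinal, conjCorr, Fintype.prod_sum_type, comp_def, Sum.elim_inl,
        Sum.elim_inr, Embedding.trans_apply, Embedding.inl_apply, Embedding.inr_apply, ← hr₁, ← hr₂]
      ring

/-- The clock of the evaluator of a conjunction at which the evaluator of the left conjunct has
reached the cycle `d₁` on its data qubits and `t₁` elsewhere, and likewise the one of the right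
conjunct. -/
def conjClock (d₁ t₁ d₂ t₂ : ℕ) :
    Clock ((E₁ ⊕ E₂) ⊕ Option (ConjAnc C₁.A C₂.A)) (ConjBit C₁.B C₂.B) where
  qubit
    | .inl e => Sum.elim (fun _ => d₁) (fun _ => d₂) e
    | .inr (some (.inl _)) | .inr (some (.inr (.inr .p))) => t₁
    | .inr (some (.inr (.inl _))) | .inr (some (.inr (.inr .q))) => t₂
    | .inr _ => 0
  bit := Sum.elim (fun _ => t₁) (Sum.elim (fun _ => t₂) fun _ => 0)

theorem conjPre_tick_le : (conjPre C₁ C₂).foldl Instr.tick (Clock.const _ _ 0) ≤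
    ⟨Sum.elim (fun _ => 1) fun _ => 1 + 2 * (L + 1), fun _ => 1 + 2 * (L + 1)⟩ := by
  have hleft : (C₁.pre.map (Instr.relabel conjLeft .inl)).foldl Instr.tick
      (Clock.const _ _ 0) ≤ conjClock C₁ C₂ 1 (1 + 2 * L) 0 0 :=
    foldl_tick_relabel_le (k := 0) _ Sum.inl_injective C₁.pre_tick_le le_rfl
      ⟨by rintro (e | _ | a) <;> exact le_rfl, fun _ => le_rfl⟩
      ⟨fun _ => Nat.zero_le _, fun _ => Nat.zero_le _⟩
  have hright : (C₂.pre.map (Instr.relabel conjRight (.inr ∘ .inl))).foldl Instr.tick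
      (conjClock C₁ C₂ 1 (1 + 2 * L) 0 0) ≤ conjClock C₁ C₂ 1 (1 + 2 * L) 1 (1 + 2 * L) :=
    foldl_tick_relabel_le (k := 0) _ inr_inl_injective C₂.pre_tick_le
      ⟨by rintro (e | _ | a) <;> exact le_rfl, fun _ => le_rfl⟩
      ⟨by rintro (e | _ | a) <;> exact le_rfl, fun _ => le_rfl⟩
      ⟨by rintro ((e | e) | _ | a | a | _ | _) <;> simp [conjClock],
        by rintro (b | b | b) <;> simp [conjClock]⟩
  rw [conjPre, conjPrePair, List.foldl_append, List.foldl_append]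
  refine (foldl_tick_mono _ ((foldl_tick_mono _ hleft).trans hright)).trans ?_
  refine foldl_tick_relabel_le (k := 2 * L) _ inr_inr_inl_injective andPre_tick_le
    ⟨by rintro (_ | _ | _) <;> simp [conjClock, Clock.comap, Clock.delay],
      fun _ => Nat.zero_le _⟩
    ⟨fun i => ?_, fun b => ?_⟩ ⟨?_, ?_⟩
  · simp [Clock.comap, Clock.delay, Clock.const]; omega
  · simp [Clock.comap, Clock.delay, Clock.const]; omega
  · rintro ((e | e) | _ | a | a | _ | _) <;> simp [conjClock]
  · rintro (b | b | b) <;> simp [conjClock]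

theorem conjPost_tick_le : (conjPost C₁ C₂).foldl Instr.tick (Clock.const _ _ 0) ≤
    Clock.const _ _ (2 * (L + 1)) := by
  have hand : (andPost.map (Instr.relabel conjUnand (conjUnandBit C₁.pend C₂.pend))).foldl
      Instr.tick (Clock.const (ConjAnc C₁.A C₂.A) (ConjBit C₁.B C₂.B) 0) ≤ Clock.const _ _ 2 :=
    foldl_tick_relabel_le (k := 0) _ (conjUnandBit_injective _ _) andPost_tick_le le_rfl le_rfl
      ⟨fun _ => Nat.zero_le _, fun _ => Nat.zero_le _⟩
  have hleft : (C₁.post.map (Instr.relabel .inl .inl)).foldl Instr.tick (Clock.const _ _ 2) ≤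
      (⟨Sum.elim (fun _ => 2 * (L + 1)) fun _ => 2, Sum.elim (fun _ => 2 * (L + 1)) fun _ => 2⟩ :
        Clock (ConjAnc C₁.A C₂.A) (ConjBit C₁.B C₂.B)) :=
    foldl_tick_relabel_le (k := 2) _ Sum.inl_injective C₁.post_tick_le
      ⟨fun _ => le_rfl, fun _ => le_rfl⟩ ⟨fun _ => le_rfl, fun _ => le_rfl⟩
      ⟨by rintro (_ | _) <;> simp [Clock.const], by rintro (_ | _) <;> simp [Clock.const]⟩
  rw [conjPost, conjPostPair, List.foldl_append, List.foldl_append]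
  refine (foldl_tick_mono _ ((foldl_tick_mono _ hand).trans hleft)).trans ?_
  exact foldl_tick_relabel_le (k := 2) _ inr_inl_injective C₂.post_tick_le
    ⟨fun _ => le_rfl, fun _ => le_rfl⟩ ⟨fun _ => le_rfl, fun _ => le_rfl⟩
    ⟨by rintro (_ | _) <;> simp [Clock.const], by rintro (_ | _) <;> simp [Clock.const]⟩

/-- Evaluates a conjunction.  Both outcomes of uncomputing it become pending signs of the
conjuncts. -/
noncomputable def conj :
    Evaluator (E₁ ⊕ E₂) (fun x => f₁ (x ∘ .inl) && f₂ (x ∘ .inr)) (L + 1) (N₁ + N₂ + 27) where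
  A := ConjAnc C₁.A C₂.A
  B := ConjBit C₁.B C₂.B
  init := conjInit C₁.init C₂.init
  supply := isSupply_conjInit C₁ C₂
  pre := conjPre C₁ C₂
  post := conjPost C₁ C₂
  length_le := length_conjPre_add_length_conjPost_le C₁ C₂
  pend := .inr (.inr (.inr .pend))
  corr := conjCorr C₁ C₂
  state := conjState C₁ C₂
  final := conjFinal C₁ C₂
  kraus_pre := kraus_conjPre C₁ C₂
  kraus_post := kraus_conjPost C₁ C₂
  pre_tick_le := conjPre_tick_le C₁ C₂
  post_tick_le := conjPost_tick_le C₁ C₂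

end Evaluator

/-! ### Conjunctions of literals -/

/-- The conjunction of the literals `x e` with `b e = false` and `¬x e` with `b e = true`. -/
def literalConj {E : Type} [Fintype E] (b x : E → Bool) : Bool :=
  decide (∀ e, (x e ^^ b e) = true)

theorem literalConj_empty (b : Empty → Bool) : literalConj b = fun _ => true := by
  simp [literalConj, funext_iff]

theorem literalConj_unit (b : Unit → Bool) : literalConj b = fun x => x () ^^ b () :=
  funext fun _ => Bool.eq_iff_iff.2 (decide_eq_true_iff.trans Unique.forall_iff)

theorem literalConj_sum {E₁ E₂ : Type} [Fintype E₁] [Fintype E₂] (b : E₁ ⊕ E₂ → Bool) :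
    literalConj b = fun x => literalConj (b ∘ .inl) (x ∘ .inl) &&
      literalConj (b ∘ .inr) (x ∘ .inr) := by
  funext x
  simp only [literalConj, Sum.forall, Bool.decide_and, comp_apply]

section Tree

variable {Q : Type} {b : Q → Bool} {L : ℕ}

/-- There is an evaluator of depth `L` for the conjunction of the literals given by `b` in the
variables `S`. -/
def HasEvaluator (b : Q → Bool) (L : ℕ) (S : Finset Q) : Prop :=
  ∃ (E : Type) (_ : Fintype E) (_ : DecidableEq E) (ι : E ↪ Q) (N : ℕ),
    Set.range ι = S ∧ N + 27 ≤ 31 * 2 ^ L ∧ Nonempty (Evaluator E (literalConj (b ∘ ι)) L N)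

theorem hasEvaluator_of_card_le_one {S : Finset Q} (hS : S.card ≤ 1) : HasEvaluator b 0 S := by
  obtain hS | hS := Nat.le_one_iff_eq_zero_or_eq_one.1 hS
  · obtain rfl := Finset.card_eq_zero.1 hS
    refine ⟨Empty, inferInstance, inferInstance, .ofIsEmpty, 4, ?_, by norm_num, ?_⟩
    · simp [Set.range_eq_empty]
    · exact ⟨literalConj_empty _ ▸ .const true⟩
  · obtain ⟨d, rfl⟩ := Finset.card_eq_one.1 hS
    refine ⟨Unit, inferInstance, inferInstance, ⟨fun _ => d, fun _ _ _ => rfl⟩, 4, ?_,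
      by norm_num, ?_⟩
    · rw [Finset.coe_singleton]
      exact Set.range_const
    · exact ⟨literalConj_unit (b ∘ fun _ => d) ▸ .literal (b d)⟩

theorem HasEvaluator.disjUnion {S₁ S₂ : Finset Q} (h₁ : HasEvaluator b L S₁)
    (h₂ : HasEvaluator b L S₂) (h : Disjoint S₁ S₂) :
    HasEvaluator b (L + 1) (S₁.disjUnion S₂ h) := by
  obtain ⟨E₁, _, _, ι₁, N₁, hι₁, hN₁, ⟨C₁⟩⟩ := h₁
  obtain ⟨E₂, _, _, ι₂, N₂, hι₂, hN₂, ⟨C₂⟩⟩ := h₂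
  have hι (e₁ : E₁) (e₂ : E₂) : ι₁ e₁ ≠ ι₂ e₂ := by
    refine Set.disjoint_iff_forall_ne.1 ?_ (Set.mem_range_self e₁) (Set.mem_range_self e₂)
    rwa [hι₁, hι₂, Finset.disjoint_coe]
  refine ⟨E₁ ⊕ E₂, inferInstance, inferInstance,
    ⟨Sum.elim ι₁ ι₂, ι₁.injective.sumElim ι₂.injective hι⟩, N₁ + N₂ + 27, ?_, ?_, ?_⟩
  · rw [Embedding.coeFn_mk, Set.Sum.elim_range, hι₁, hι₂, Finset.coe_disjUnion]
  · rw [pow_succ]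
    omega
  · exact ⟨literalConj_sum (b ∘ Sum.elim ι₁ ι₂) ▸ C₁.conj C₂⟩

theorem hasEvaluator_of_card_le {S : Finset Q} (hS : S.card ≤ 2 ^ L) : HasEvaluator b L S := by
  classical
  induction L generalizing S with
  | zero => exact hasEvaluator_of_card_le_one hS
  | succ L ih =>
    obtain ⟨S₁, hS₁, hcard⟩ := Finset.exists_subset_card_eq (Nat.div_le_self S.card 2)
    have hcard' := Finset.card_sdiff_add_card_eq_card hS₁
    rw [pow_succ] at hS
    have h := (ih (S := S₁) (by omega)).disjUnion (ih (S := S \ S₁) (by omega))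
      Finset.disjoint_sdiff
    rwa [Finset.disjUnion_eq_union, Finset.union_sdiff_of_subset hS₁] at h

end Tree

/-! ### Circuits that are diagonal on the data qubits -/

section Norm

variable {D A : Type}

/-- The product of a state of the qubits `D` and a state of the qubits `A`. -/
def tensor (φ : (D → Bool) → ℂ) (ψ : (A → Bool) → ℂ) (s : D ⊕ A → Bool) : ℂ :=
  φ (s ∘ .inl) * ψ (s ∘ .inr)

theorem normSq_smul {Y : Type*} [Fintype Y] (c : ℂ) (ψ : Y → ℂ) :
    normSq (c • ψ) = ‖c‖ ^ 2 * normSq ψ := by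
  simp only [normSq, Pi.smul_apply, norm_smul, mul_pow, Finset.mul_sum]

theorem ket_self (x : D → Bool) : ket x x = 1 := if_pos rfl

variable [Fintype D] [DecidableEq D]

theorem eq_sum_ket (φ : (D → Bool) → ℂ) (s : D → Bool) : φ s = ∑ x, φ x * ket x s := by
  simp [ket]

theorem normSq_ket (x : D → Bool) : normSq (ket x) = 1 := by
  simp [normSq, ket, apply_ite norm, ite_pow]

variable [Fintype A] [DecidableEq A]

theorem normSq_comp_equiv {A' : Type} [Fintype A'] [DecidableEq A'] (e : A ≃ A')
    (ψ : (A → Bool) → ℂ) : normSq (fun s : A' → Bool => ψ (s ∘ e)) = normSq ψ :=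
  (e.symm.arrowCongr (Equiv.refl Bool)).sum_comp fun s => ‖ψ s‖ ^ 2

theorem normSq_mul_fiber (c : (D → Bool) → ℂ) (F : (D → Bool) → (A → Bool) → ℂ) :
    normSq (fun s : D ⊕ A → Bool => c (s ∘ .inl) * F (s ∘ .inl) (s ∘ .inr)) =
      ∑ x, ‖c x‖ ^ 2 * normSq (F x) := by
  simp only [normSq, norm_mul, mul_pow, Finset.mul_sum]
  rw [← (Equiv.sumArrowEquivProdArrow D A Bool).symm.sum_comp, Fintype.sum_prod_type]
  rfl

theorem normSq_tensor (φ : (D → Bool) → ℂ) (ψ : (A → Bool) → ℂ) :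
    normSq (tensor φ ψ) = normSq φ * normSq ψ :=
  (normSq_mul_fiber φ fun _ => ψ).trans (Finset.sum_mul ..).symm

theorem normSq_option (φ : (Unit → Bool) → ℂ)
    (ψ : (A → Bool) → ℂ) :
    normSq (fun s : Option A → Bool => φ (fun _ => s none) * ψ (s ∘ some)) =
      normSq φ * normSq ψ := by
  rw [mul_comm, ← normSq_tensor, ← normSq_comp_equiv (Equiv.optionEquivSumPUnit A).symm]
  exact congrArg normSq (funext fun _ => mul_comm ..)

theorem norm_sgn (b : Bool) : ‖sgn b‖ = 1 := by
  cases b <;> simp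

end Norm

section CorrSign

variable {D B : Type} [Fintype D]

/-- The sign by which the corrections `corr` multiply the basis state `x`, for the contents `m` of
the classical memory. -/
noncomputable def corrSign (corr : D → Finset B) (m : B → Bool) (x : D → Bool) : ℂ :=
  ∏ d, ∏ b ∈ corr d, sgn (m b && x d)

theorem norm_corrSign (corr : D → Finset B) (m : B → Bool) (x : D → Bool) :
    ‖corrSign corr m x‖ = 1 := by
  simp [corrSign, norm_prod, norm_sgn]

theorem corrSign_relabel {D' B' : Type} [Fintype D'] (ι : D ↪ D') (g : B ↪ B')
    (corr : D → Finset B) (m : B' → Bool)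
    (x : D' → Bool) : corrSign (extend ι (fun d => (corr d).map g) fun _ => ∅) m x =
      corrSign corr (m ∘ g) (x ∘ ι) := by
  refine (Fintype.prod_of_injective ι ι.injective _ _ (fun d hd => ?_) fun d => ?_).symm
  · rw [extend_apply' _ _ _ hd, Finset.prod_empty]
  · rw [ι.injective.extend_apply, Finset.prod_map]
    rfl

end CorrSign

section Diagonal

variable {D A B : Type} [DecidableEq D] [DecidableEq A] [DecidableEq B]

/-- The state of the ancilla qubits after the instructions `l` on the branch `o`, for the data
qubits in the basis state `x` and the ancilla qubits in the state `init`. -/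
noncomputable def branch (l : List (Instr (D ⊕ A) B)) (init : (A → Bool) → ℂ) (o : List Bool)
    (x : D → Bool) (y : A → Bool) : ℂ :=
  kraus l o ⊥ (tensor (ket x) init) (Sum.elim x y)

theorem branch_eq {l : List (Instr (D ⊕ A) B)} {init : (A → Bool) → ℂ} {o : List Bool}
    {x : D → Bool} {ψ : (A → Bool) → ℂ}
    (h : kraus l o ⊥ (tensor (ket x) init) = tensor (ket x) ψ) : branch l init o x = ψ := by
  funext y
  rw [branch, h, tensor, Sum.elim_comp_inl, Sum.elim_comp_inr, ket_self, one_mul]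

theorem branch_take (l : List (Instr (D ⊕ A) B)) (init : (A → Bool) → ℂ) (o : List Bool)
    (x : D → Bool) : branch l init (o.take (measCount l)) x = branch l init o x := by
  funext y
  rw [branch, kraus_take, branch]

variable [Fintype D] [Fintype A]

/-- The list `l` of instructions preserves each basis state of the data qubits, and, up to the
corrections `corr`, it multiplies the basis state `x` by `u x`, with accuracy `δ`. -/
structure DiagRealizes (l : List (Instr (D ⊕ A) B)) (init : (A → Bool) → ℂ) (corr : D → Finset B)
    (u : (D → Bool) → ℂ) (δ : ℝ) : Prop where
  kraus_ket : ∀ o x,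
    kraus l o ⊥ (tensor (ket x) init) = tensor (ket x) (branch l init o x)
  exists_approx : ∃ χ : List Bool → (A → Bool) → ℂ,
    recordSum (measCount l) (fun o => normSq (χ o)) = 1 ∧
    ∀ x, recordSum (measCount l) (fun o =>
      normSq (corrSign corr (finalMem l o ⊥) x • branch l init o x - u x • χ o)) ≤ δ ^ 2

namespace DiagRealizes

variable {l : List (Instr (D ⊕ A) B)} {init : (A → Bool) → ℂ} {corr : D → Finset B}
  {u : (D → Bool) → ℂ} {δ : ℝ}

theorem recordSum_normSq_branch (h : DiagRealizes l init corr u δ) (hinit : normSq init = 1)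
    (x : D → Bool) : recordSum (measCount l) (fun o => normSq (branch l init o x)) = 1 := by
  simpa only [h.kraus_ket, normSq_tensor, normSq_ket, hinit, one_mul] using
    recordSum_normSq_kraus l ⊥ (tensor (ket x) init)

theorem const_mul (h : DiagRealizes l init corr u δ) {ω : ℂ} (hω : ‖ω‖ = 1) :
    DiagRealizes l init corr (fun x => ω * u x) δ := by
  obtain ⟨hket, χ, hχ, happrox⟩ := h
  have hω₀ : ω ≠ 0 := norm_ne_zero_iff.1 (hω ▸ one_ne_zero)
  refine ⟨hket, fun o => ω⁻¹ • χ o, ?_, fun x => ?_⟩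
  · simpa only [normSq_smul, norm_inv, hω, inv_one, one_pow, one_mul] using hχ
  · have hu : ω * u x * ω⁻¹ = u x := by rw [mul_right_comm, mul_inv_cancel₀ hω₀, one_mul]
    simpa only [smul_smul, hu] using happrox x

theorem kraus_tensor (h : DiagRealizes l init corr u δ) (o : List Bool) (φ : (D → Bool) → ℂ) :
    kraus l o ⊥ (tensor φ init) =
      fun s => φ (s ∘ .inl) * branch l init o (s ∘ .inl) (s ∘ .inr) := by
  have hφ : tensor φ init = ∑ x, φ x • tensor (ket x) init := by
    funext s
    simp only [tensor, eq_sum_ket φ (s ∘ .inl), Finset.sum_mul, Finset.sum_apply, Pi.smul_apply,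
      smul_eq_mul, mul_assoc]
  funext s
  simp only [hφ, map_sum, map_smul, h.kraus_ket, Finset.sum_apply, Pi.smul_apply, tensor,
    smul_eq_mul]
  rw [eq_sum_ket φ, Finset.sum_mul]
  refine Finset.sum_congr rfl fun x _ => ?_
  by_cases hx : s ∘ .inl = x
  · rw [hx, mul_assoc]
  · simp [ket, hx]

end DiagRealizes

end Diagonal

section Relabel

variable {D D' : Type}

/-- The basis state `x` of the qubits outside the range of `ι`. -/
noncomputable def ketOutside (ι : D ↪ D') (x s : D' → Bool) : ℂ :=
  open Classical in if Set.EqOn s x (Set.range ι)ᶜ then 1 else 0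

theorem ket_comp_mul_ketOutside (ι : D ↪ D') (x s : D' → Bool) :
    ket (x ∘ ι) (s ∘ ι) * ketOutside ι x s = ket x s := by
  have hs : s = x ↔ s ∘ ι = x ∘ ι ∧ Set.EqOn s x (Set.range ι)ᶜ := by
    refine ⟨fun h => h ▸ ⟨rfl, fun _ _ => rfl⟩, fun ⟨hin, hout⟩ => funext fun d => ?_⟩
    by_cases hd : d ∈ Set.range ι
    · obtain ⟨d, rfl⟩ := hd
      exact congrFun hin d
    · exact hout hd
  by_cases hin : s ∘ ι = x ∘ ι <;> by_cases hout : Set.EqOn s x (Set.range ι)ᶜ <;>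
    simp [ket, ketOutside, hs, hin, hout]

variable [DecidableEq D']

theorem ketOutside_update (ι : D ↪ D') (x s : D' → Bool) (d : D) (v : Bool) :
    ketOutside ι x (update s (ι d) v) = ketOutside ι x s := by
  have houtside : Set.EqOn (update s (ι d) v) x (Set.range ι)ᶜ ↔ Set.EqOn s x (Set.range ι)ᶜ :=
    forall₂_congr fun d' hd' => by rw [update_of_ne fun h => hd' ⟨d, h.symm⟩]
  rw [ketOutside, ketOutside, propext houtside]

variable [DecidableEq D] {A A' B B' : Type} [DecidableEq A] [DecidableEq B]
  [DecidableEq A'] [DecidableEq B']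

theorem kraus_relabel_tensor_ket (ι : D ↪ D') (e : A ≃ A') {g : B → B'} (hg : Injective g)
    {l : List (Instr (D ⊕ A) B)} {init : (A → Bool) → ℂ} {o : List Bool} {x : D' → Bool}
    {ψ : (A → Bool) → ℂ} (h : kraus l o ⊥ (tensor (ket (x ∘ ι)) init) = tensor (ket (x ∘ ι)) ψ) :
    kraus (l.map (Instr.relabel (ι.sumMap e.toEmbedding) g)) o ⊥
      (tensor (ket x) fun s => init (s ∘ e)) = tensor (ket x) fun s => ψ (s ∘ e) := by
  have hrun := kraus_relabel (ι.sumMap e.toEmbedding) hg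
    (R := fun s => ketOutside ι x (s ∘ .inl))
    (by
      rintro s (d | a) v
      · exact (congrArg _ (update_comp_eq_of_injective s Sum.inl_injective (ι d) v)).trans
          (ketOutside_update ι x (s ∘ .inl) d v)
      · rfl) l o ⊥ (tensor (ket (x ∘ ι)) init)
  rw [show (⊥ : B' → Bool) ∘ g = ⊥ from rfl, h] at hrun
  have htensor (ψ : (A → Bool) → ℂ) : (tensor (ket x) fun s => ψ (s ∘ e)) = fun s =>
      tensor (ket (x ∘ ι)) ψ (s ∘ ι.sumMap e.toEmbedding) * ketOutside ι x (s ∘ .inl) := by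
    funext s
    rw [tensor, tensor, ← ket_comp_mul_ketOutside ι x, mul_right_comm]
    rfl
  rw [htensor, htensor, hrun]

variable [Fintype D] [Fintype A] [Fintype D'] [Fintype A']

theorem DiagRealizes.relabel {l : List (Instr (D ⊕ A) B)} {init : (A → Bool) → ℂ}
    {corr : D → Finset B} {u : (D → Bool) → ℂ} {δ : ℝ} (h : DiagRealizes l init corr u δ)
    (ι : D ↪ D') (e : A ≃ A') (g : B ↪ B') :
    DiagRealizes (l.map (Instr.relabel (ι.sumMap e.toEmbedding) g)) (fun s => init (s ∘ e))
      (extend ι (fun d => (corr d).map g) fun _ => ∅) (fun x => u (x ∘ ι)) δ := by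
  have hket (o : List Bool) (x : D' → Bool) :=
    kraus_relabel_tensor_ket ι e g.injective (h.kraus_ket o (x ∘ ι))
  have hbranch (o : List Bool) (x : D' → Bool) := branch_eq (hket o x)
  obtain ⟨χ, hχ, happrox⟩ := h.exists_approx
  refine ⟨fun o x => (hket o x).trans (congrArg _ (hbranch o x).symm),
    fun o s => χ o (s ∘ e), ?_, fun x => ?_⟩
  · simpa only [measCount_map_relabel, normSq_comp_equiv] using hχ
  · rw [measCount_map_relabel]
    refine (recordSum_congr fun o _ => ?_).trans_le (happrox (x ∘ ι))
    rw [hbranch, corrSign_relabel, finalMem_relabel_comp _ g.injective]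
    exact normSq_comp_equiv e
      (corrSign corr (finalMem l o ⊥) (x ∘ ι) • branch l init o (x ∘ ι) - u (x ∘ ι) • χ o)

end Relabel

section ZEquivalent

variable {D : Type} [DecidableEq D]

theorem Circuit.exec_eq (V : Circuit D) (o : V.Outcome) (φ : (D → Bool) → ℂ) :
    V.exec o φ = ⟨finalMem V.instrs (List.ofFn o) ⊥,
      kraus V.instrs (List.ofFn o) ⊥ (tensor φ V.init)⟩ :=
  run_eq _ _ _ _

variable [Fintype D]

theorem DiagRealizes.corrected_sub {V : Circuit D} {corr : D → Finset V.B} {u : (D → Bool) → ℂ}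
    {δ : ℝ} (h : DiagRealizes V.instrs V.init corr u δ) (o : V.Outcome) (φ : (D → Bool) → ℂ)
    (χ : (V.Anc → Bool) → ℂ) (s : D ⊕ V.Anc → Bool) :
    V.corrected corr o φ s - (Matrix.diagonal u).mulVec φ (s ∘ .inl) * χ (s ∘ .inr) =
      φ (s ∘ .inl) * (corrSign corr (finalMem V.instrs (List.ofFn o) ⊥) (s ∘ .inl) •
        branch V.instrs V.init (List.ofFn o) (s ∘ .inl) - u (s ∘ .inl) • χ) (s ∘ .inr) := by
  rw [Circuit.corrected, V.exec_eq, h.kraus_tensor, Matrix.mulVec_diagonal]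
  simp only [corrSign, sgn, Pi.sub_apply, Pi.smul_apply, smul_eq_mul, comp_apply]
  ring

/-- Up to some `Z` corrections, the circuit `V` applies the diagonal gate with entries `u`, with
accuracy `δ`, and it preserves each basis state of the data qubits on each branch. -/
def Circuit.ZRealizes (V : Circuit D) (u : (D → Bool) → ℂ) (δ : ℝ) : Prop :=
  ∃ corr, DiagRealizes V.instrs V.init corr u δ

theorem Circuit.ZRealizes.zEquivalent {V : Circuit D} {u : (D → Bool) → ℂ} {δ : ℝ}
    (hV : V.ZRealizes u δ) : V.ZEquivalent (Matrix.diagonal u) δ := by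
  obtain ⟨corr, h⟩ := hV
  obtain ⟨χ, hχ, happrox⟩ := h.exists_approx
  refine ⟨corr, fun o => χ (List.ofFn o), hχ, fun φ => ?_⟩
  set F : List Bool → (D → Bool) → (V.Anc → Bool) → ℂ := fun o x =>
    corrSign corr (finalMem V.instrs o ⊥) x • branch V.instrs V.init o x - u x • χ o
  calc ∑ o : V.Outcome, ∑ s, ‖V.corrected corr o φ s -
        (Matrix.diagonal u).mulVec φ (s ∘ .inl) * χ (List.ofFn o) (s ∘ .inr)‖ ^ 2
    _ = ∑ o : V.Outcome, ∑ x, ‖φ x‖ ^ 2 * normSq (F (List.ofFn o) x) := by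
      simp only [h.corrected_sub]
      exact Finset.sum_congr rfl fun o _ => normSq_mul_fiber φ (F (List.ofFn o))
    _ = ∑ x, ‖φ x‖ ^ 2 * recordSum (measCount V.instrs) fun o => normSq (F o x) := by
      rw [Finset.sum_comm]
      exact Finset.sum_congr rfl fun x _ => (Finset.mul_sum ..).symm
    _ ≤ ∑ x, ‖φ x‖ ^ 2 * δ ^ 2 :=
      Finset.sum_le_sum fun x _ => mul_le_mul_of_nonneg_left (happrox x) (sq_nonneg _)
    _ = δ ^ 2 * ∑ x, ‖φ x‖ ^ 2 := by rw [← Finset.sum_mul, mul_comm]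

theorem DiagRealizes.zRealizes {D₀ A B : Type} [Fintype D₀] [DecidableEq D₀] [Fintype A]
    [DecidableEq A] [DecidableEq B] {l : List (Instr (D₀ ⊕ A) B)} {init : (A → Bool) → ℂ}
    {corr : D₀ → Finset B} {u : (D₀ → Bool) → ℂ} {δ : ℝ} (h : DiagRealizes l init corr u δ)
    {V : Circuit D} (ι : D₀ ↪ D) (e : A ≃ V.Anc) (g : B ↪ V.B)
    (hinstrs : V.instrs = l.map (Instr.relabel (ι.sumMap e.toEmbedding) g))
    (hinit : ∀ s, V.init s = init (s ∘ e)) : V.ZRealizes (fun x => u (x ∘ ι)) δ := by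
  have hV := h.relabel ι e g
  rw [← hinstrs, ← funext hinit] at hV
  exact ⟨_, hV⟩

end ZEquivalent

/-! ### Products of circuits -/

section Append

variable {D A₁ A₂ B₁ B₂ : Type}

/-- The instructions `l₁` followed by the instructions `l₂`, on shared data qubits and on separate
ancilla qubits and classical bits. -/
def sharedAppend (l₁ : List (Instr (D ⊕ A₁) B₁)) (l₂ : List (Instr (D ⊕ A₂) B₂)) :
    List (Instr (D ⊕ (A₁ ⊕ A₂)) (B₁ ⊕ B₂)) :=
  l₁.map (Instr.relabel ((Embedding.refl D).sumMap .inl) .inl) ++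
    l₂.map (Instr.relabel ((Embedding.refl D).sumMap .inr) .inr)

theorem measCount_sharedAppend (l₁ : List (Instr (D ⊕ A₁) B₁)) (l₂ : List (Instr (D ⊕ A₂) B₂)) :
    measCount (sharedAppend l₁ l₂) = measCount l₁ + measCount l₂ := by
  rw [sharedAppend, measCount, List.countP_append]
  exact congrArg₂ (· + ·) (measCount_map_relabel ..) (measCount_map_relabel ..)

theorem corrSign_disjSum [Fintype D] (corr₁ : D → Finset B₁) (corr₂ : D → Finset B₂)
    (m : B₁ ⊕ B₂ → Bool) (x : D → Bool) :
    corrSign (fun d => (corr₁ d).disjSum (corr₂ d)) m x =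
      corrSign corr₁ (m ∘ .inl) x * corrSign corr₂ (m ∘ .inr) x := by
  simp only [corrSign, Finset.prod_disjSum, Finset.prod_mul_distrib, comp_apply]

theorem recordSum_normSq_tensor [Fintype A₁] [DecidableEq A₁] [Fintype A₂] [DecidableEq A₂]
    (n₁ n₂ : ℕ) (F : List Bool → (A₁ → Bool) → ℂ) (G : List Bool → (A₂ → Bool) → ℂ) :
    recordSum (n₁ + n₂) (fun o => normSq (tensor (F (o.take n₁)) (G (o.drop n₁)))) =
      recordSum n₁ (fun o => normSq (F o)) * recordSum n₂ fun o => normSq (G o) := by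
  rw [recordSum_add, ← recordSum_mul_right]
  refine recordSum_congr fun o ho => ?_
  simp only [← ho, List.take_left, List.drop_left, normSq_tensor, recordSum_mul_left]

theorem recordSum_normSq_add_le {Y : Type*} [Fintype Y] {n : ℕ} {F G : List Bool → Y → ℂ}
    {a b : ℝ} (ha : 0 ≤ a) (hb : 0 ≤ b) (hF : recordSum n (fun o => normSq (F o)) ≤ a ^ 2)
    (hG : recordSum n (fun o => normSq (G o)) ≤ b ^ 2) :
    recordSum n (fun o => normSq (F o + G o)) ≤ (a + b) ^ 2 := by
  let vec (H : List Bool → Y → ℂ) : EuclideanSpace ℂ ((Fin n → Bool) × Y) :=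
    WithLp.toLp 2 fun p => H (List.ofFn p.1) p.2
  have hvec (H : List Bool → Y → ℂ) : recordSum n (fun o => normSq (H o)) = ‖vec H‖ ^ 2 := by
    rw [EuclideanSpace.norm_sq_eq, Fintype.sum_prod_type]
    rfl
  rw [hvec, sq_le_sq₀ (norm_nonneg _) ‹_›] at hF hG
  calc recordSum n (fun o => normSq (F o + G o))
    _ = ‖vec F + vec G‖ ^ 2 := hvec fun o => F o + G o
    _ ≤ (a + b) ^ 2 :=
      pow_le_pow_left₀ (norm_nonneg _) ((norm_add_le _ _).trans (add_le_add hF hG)) 2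

theorem tensor_sub_tensor (φ φ' : (A₁ → Bool) → ℂ) (ψ ψ' : (A₂ → Bool) → ℂ) :
    tensor φ ψ - tensor φ' ψ' = tensor (φ - φ') ψ + tensor φ' (ψ - ψ') := by
  funext s
  simp only [tensor, Pi.sub_apply, Pi.add_apply]
  ring

theorem smul_tensor_smul (a b : ℂ) (φ : (A₁ → Bool) → ℂ) (ψ : (A₂ → Bool) → ℂ) :
    tensor (a • φ) (b • ψ) = (a * b) • tensor φ ψ := by
  funext s
  simp only [tensor, Pi.smul_apply, smul_eq_mul]
  ring

variable [DecidableEq D] [DecidableEq A₁] [DecidableEq A₂] [DecidableEq B₁] [DecidableEq B₂]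
  {l₁ : List (Instr (D ⊕ A₁) B₁)} {l₂ : List (Instr (D ⊕ A₂) B₂)} {o : List Bool}

theorem finalMem_sharedAppend_comp_inl :
    finalMem (sharedAppend l₁ l₂) o ⊥ ∘ .inl = finalMem l₁ o ⊥ := by
  rw [sharedAppend, finalMem_append,
    finalMem_relabel_comp_of_ne _ Sum.inr_injective fun _ _ => Sum.inr_ne_inl,
    finalMem_relabel_comp _ Sum.inl_injective]
  rfl

theorem finalMem_sharedAppend_comp_inr :
    finalMem (sharedAppend l₁ l₂) o ⊥ ∘ .inr = finalMem l₂ (o.drop (measCount l₁)) ⊥ := by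
  rw [sharedAppend, finalMem_append, measCount_map_relabel,
    finalMem_relabel_comp _ Sum.inr_injective,
    finalMem_relabel_comp_of_ne _ Sum.inl_injective fun _ _ => Sum.inl_ne_inr]
  rfl

theorem kraus_sharedAppend {φ : (D → Bool) → ℂ} {init₁ ψ₁ : (A₁ → Bool) → ℂ}
    {init₂ ψ₂ : (A₂ → Bool) → ℂ} (h₁ : kraus l₁ o ⊥ (tensor φ init₁) = tensor φ ψ₁)
    (h₂ : kraus l₂ (o.drop (measCount l₁)) ⊥ (tensor φ init₂) = tensor φ ψ₂) :
    kraus (sharedAppend l₁ l₂) o ⊥ (tensor φ (tensor init₁ init₂)) = tensor φ (tensor ψ₁ ψ₂) := by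
  let f₁ : D ⊕ A₁ ↪ D ⊕ (A₁ ⊕ A₂) := (Embedding.refl D).sumMap .inl
  let f₂ : D ⊕ A₂ ↪ D ⊕ (A₁ ⊕ A₂) := (Embedding.refl D).sumMap .inr
  let g₁ : B₁ → B₁ ⊕ B₂ := .inl
  let m := finalMem (l₁.map (Instr.relabel f₁ g₁)) o ⊥
  have hm : m ∘ .inr = (⊥ : B₂ → Bool) :=
    finalMem_relabel_comp_of_ne f₁ Sum.inl_injective (fun _ _ => Sum.inl_ne_inr) l₁ o ⊥
  have hrun₁ := kraus_relabel f₁ (g := g₁) Sum.inl_injective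
    (R := fun s => init₂ (s ∘ .inr ∘ .inr))
    (by rintro s (d | a) v <;> simp [f₁, comp_def]) l₁ o ⊥ (tensor φ init₁)
  have hrun₂ := kraus_relabel f₂ (g := .inr) Sum.inr_injective
    (R := fun s => ψ₁ (s ∘ .inr ∘ .inl))
    (by rintro s (d | a) v <;> simp [f₂, comp_def]) l₂ (o.drop (measCount l₁)) m (tensor φ init₂)
  have hin : tensor φ (tensor init₁ init₂) =
      fun s => tensor φ init₁ (s ∘ f₁) * init₂ (s ∘ .inr ∘ .inr) :=
    funext fun s => (mul_assoc ..).symm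
  have hmid : (fun s : D ⊕ (A₁ ⊕ A₂) → Bool =>
      tensor φ ψ₁ (s ∘ f₁) * init₂ (s ∘ .inr ∘ .inr)) =
      fun s => tensor φ init₂ (s ∘ f₂) * ψ₁ (s ∘ .inr ∘ .inl) :=
    funext fun s => mul_right_comm ..
  calc kraus (sharedAppend l₁ l₂) o ⊥ (tensor φ (tensor init₁ init₂))
    _ = kraus (l₂.map (Instr.relabel f₂ .inr)) (o.drop (measCount l₁)) m
        (kraus (l₁.map (Instr.relabel f₁ g₁)) o ⊥
          fun s => tensor φ init₁ (s ∘ f₁) * init₂ (s ∘ .inr ∘ .inr)) := by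
      rw [sharedAppend, kraus_append, measCount_map_relabel, ← hin]
    _ = kraus (l₂.map (Instr.relabel f₂ .inr)) (o.drop (measCount l₁)) m
        fun s => tensor φ init₂ (s ∘ f₂) * ψ₁ (s ∘ .inr ∘ .inl) := by
      rw [hrun₁, show (⊥ : B₁ ⊕ B₂ → Bool) ∘ g₁ = ⊥ from rfl, h₁, hmid]
    _ = tensor φ (tensor ψ₁ ψ₂) := by
      rw [hrun₂, hm, h₂]
      exact funext fun s => (mul_right_comm ..).trans (mul_assoc ..)

namespace DiagRealizes

variable [Fintype D] [Fintype A₁] [Fintype A₂] {init₁ : (A₁ → Bool) → ℂ} {init₂ : (A₂ → Bool) → ℂ}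
  {corr₁ : D → Finset B₁} {corr₂ : D → Finset B₂} {u₁ u₂ : (D → Bool) → ℂ} {δ₁ δ₂ : ℝ}

theorem branch_sharedAppend (h₁ : DiagRealizes l₁ init₁ corr₁ u₁ δ₁)
    (h₂ : DiagRealizes l₂ init₂ corr₂ u₂ δ₂) (o : List Bool) (x : D → Bool) :
    branch (sharedAppend l₁ l₂) (tensor init₁ init₂) o x =
      tensor (branch l₁ init₁ o x) (branch l₂ init₂ (o.drop (measCount l₁)) x) :=
  branch_eq (kraus_sharedAppend (h₁.kraus_ket o x) (h₂.kraus_ket _ x))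

theorem append (h₁ : DiagRealizes l₁ init₁ corr₁ u₁ δ₁) (h₂ : DiagRealizes l₂ init₂ corr₂ u₂ δ₂)
    (hinit₂ : normSq init₂ = 1) (hu₁ : ∀ x, ‖u₁ x‖ = 1) (hδ₁ : 0 ≤ δ₁) (hδ₂ : 0 ≤ δ₂) :
    DiagRealizes (sharedAppend l₁ l₂) (tensor init₁ init₂)
      (fun d => (corr₁ d).disjSum (corr₂ d)) (fun x => u₁ x * u₂ x) (δ₁ + δ₂) := by
  have hbranch := h₁.branch_sharedAppend h₂
  obtain ⟨χ₁, hχ₁, happrox₁⟩ := h₁.exists_approx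
  obtain ⟨χ₂, hχ₂, happrox₂⟩ := h₂.exists_approx
  refine ⟨fun o x => (kraus_sharedAppend (h₁.kraus_ket o x) (h₂.kraus_ket _ x)).trans
    (congrArg _ (hbranch o x).symm),
    fun o => tensor (χ₁ (o.take (measCount l₁))) (χ₂ (o.drop (measCount l₁))), ?_, fun x => ?_⟩
  · rw [measCount_sharedAppend, recordSum_normSq_tensor, hχ₁, hχ₂, one_mul]
  let F₁ (o : List Bool) := corrSign corr₁ (finalMem l₁ o ⊥) x • branch l₁ init₁ o x
  let F₂ (o : List Bool) := corrSign corr₂ (finalMem l₂ o ⊥) x • branch l₂ init₂ o x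
  have hF₁ (o : List Bool) : F₁ (o.take (measCount l₁)) = F₁ o := by
    simp only [F₁, finalMem_take, branch_take]
  have hF₂ : recordSum (measCount l₂) (fun o => normSq (F₂ o)) = 1 := by
    simpa only [F₂, normSq_smul, norm_corrSign, one_pow, one_mul] using
      h₂.recordSum_normSq_branch hinit₂ x
  have hχ₁' : recordSum (measCount l₁) (fun o => normSq (u₁ x • χ₁ o)) = 1 := by
    simpa only [normSq_smul, hu₁, one_pow, one_mul] using hχ₁
  have herror₁ := recordSum_normSq_tensor (measCount l₁) (measCount l₂)
    (fun o => F₁ o - u₁ x • χ₁ o) F₂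
  have herror₂ := recordSum_normSq_tensor (measCount l₁) (measCount l₂)
    (fun o => u₁ x • χ₁ o) fun o => F₂ o - u₂ x • χ₂ o
  rw [hF₂, mul_one] at herror₁
  rw [hχ₁', one_mul] at herror₂
  rw [measCount_sharedAppend]
  refine (recordSum_congr fun o _ => ?_).trans_le (recordSum_normSq_add_le hδ₁ hδ₂
    (herror₁.trans_le (happrox₁ x)) (herror₂.trans_le (happrox₂ x)))
  rw [hbranch, corrSign_disjSum, finalMem_sharedAppend_comp_inl, finalMem_sharedAppend_comp_inr,
    ← smul_tensor_smul, ← smul_tensor_smul, ← tensor_sub_tensor, hF₁]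

theorem nil {D A B : Type} [Fintype D] [DecidableEq D] [Fintype A] [DecidableEq A] [DecidableEq B]
    {init : (A → Bool) → ℂ} (hinit : normSq init = 1) :
    DiagRealizes (B := B) (D := D) [] init (fun _ => ∅) (fun _ => 1) 0 := by
  have hbranch (o : List Bool) (x : D → Bool) : branch (B := B) [] init o x = init :=
    branch_eq rfl
  refine ⟨fun o x => congrArg (tensor (ket x)) (hbranch o x).symm, fun _ => init, ?_, fun x => ?_⟩
  · rw [measCount, List.countP_nil, recordSum_zero, hinit]
  · simp [hbranch, corrSign, measCount, recordSum_zero, normSq]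

end DiagRealizes

end Append

section SharedProduct

/-- A dependent sum over `Fin (m + 1)`, split into its first summand and the others. -/
def sigmaFinSuccEquiv {m : ℕ} (F : Fin (m + 1) → Type) :
    (F 0 ⊕ Σ j : Fin m, F j.succ) ≃ Σ j, F j where
  toFun := Sum.elim (Sigma.mk 0) fun a => ⟨a.1.succ, a.2⟩
  invFun a := Fin.cases (motive := fun j => F j → F 0 ⊕ Σ j : Fin m, F j.succ) .inl
    (fun j a => .inr ⟨j, a⟩) a.1 a.2
  left_inv := by rintro (a | ⟨j, a⟩) <;> rfl
  right_inv := by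
    rintro ⟨j, a⟩
    induction j using Fin.cases <;> rfl

variable {D : Type} {m : ℕ}

/-- The instructions `l 0`, `l 1`, …, one list after the other, on shared data qubits and on
separate ancilla qubits and classical bits. -/
def sharedProduct {A B : Fin m → Type} (l : ∀ j, List (Instr (D ⊕ A j) (B j))) :
    List (Instr (D ⊕ Σ j, A j) (Σ j, B j)) :=
  (List.finRange m).flatMap fun j =>
    (l j).map (Instr.relabel ((Embedding.refl D).sumMap (.sigmaMk j)) (Sigma.mk j))

theorem sharedProduct_succ {A B : Fin (m + 1) → Type}
    (l : ∀ j, List (Instr (D ⊕ A j) (B j))) :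
    sharedProduct l = (sharedAppend (l 0) (sharedProduct fun j => l j.succ)).map
      (Instr.relabel ((Embedding.refl D).sumMap (sigmaFinSuccEquiv A).toEmbedding)
        (sigmaFinSuccEquiv B)) := by
  have hinl : (Embedding.refl D).sumMap (.sigmaMk 0) =
      ((Embedding.refl D).sumMap .inl).trans
        ((Embedding.refl D).sumMap (sigmaFinSuccEquiv A).toEmbedding) := by
    ext (d | a) <;> rfl
  have hinr (j : Fin m) : (Embedding.refl D).sumMap (.sigmaMk j.succ) =
      ((Embedding.refl D).sumMap (.sigmaMk j)).trans (((Embedding.refl D).sumMap .inr).trans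
        ((Embedding.refl D).sumMap (sigmaFinSuccEquiv A).toEmbedding)) := by
    ext (d | a) <;> rfl
  simp only [sharedProduct, sharedAppend, List.finRange_succ, List.flatMap_cons, List.map_append,
    List.flatMap_map, List.map_flatMap, map_relabel_map_relabel, hinl, hinr]
  rfl

theorem normSq_sigma {A : Fin m → Type} [∀ j, Fintype (A j)] [∀ j, DecidableEq (A j)]
    (ψ : ∀ j, (A j → Bool) → ℂ) :
    normSq (fun s : (Σ j, A j) → Bool => ∏ j, ψ j fun a => s ⟨j, a⟩) = ∏ j, normSq (ψ j) := by
  simp only [normSq, Finset.prod_univ_sum, Fintype.piFinset_univ, norm_prod, Finset.prod_pow]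
  exact (Equiv.piCurry fun j (_ : A j) => Bool).sum_comp fun s => (∏ j, ‖ψ j (s j)‖) ^ 2

theorem DiagRealizes.sharedProduct [DecidableEq D] [Fintype D] {A B : Fin m → Type}
    [∀ j, Fintype (A j)] [∀ j, DecidableEq (A j)] [∀ j, DecidableEq (B j)]
    {l : ∀ j, List (Instr (D ⊕ A j) (B j))} {init : ∀ j, (A j → Bool) → ℂ}
    {corr : ∀ j, D → Finset (B j)} {u : Fin m → (D → Bool) → ℂ} {δ : Fin m → ℝ}
    (h : ∀ j, DiagRealizes (l j) (init j) (corr j) (u j) (δ j))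
    (hinit : ∀ j, normSq (init j) = 1) (hu : ∀ j x, ‖u j x‖ = 1) (hδ : ∀ j, 0 ≤ δ j) :
    ∃ corr, DiagRealizes (sharedProduct l) (fun s => ∏ j, init j fun a => s ⟨j, a⟩) corr
      (fun x => ∏ j, u j x) (∑ j, δ j) := by
  have hone : normSq (fun s : (Σ j, A j) → Bool => ∏ j, init j fun a => s ⟨j, a⟩) = 1 := by
    simp only [normSq_sigma, hinit, Finset.prod_const_one]
  induction m with
  | zero =>
    refine ⟨fun _ => ∅, ?_⟩
    simp only [Finset.univ_eq_empty, Finset.prod_empty, Finset.sum_empty] at hone ⊢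
    exact .nil hone
  | succ m ih =>
    have htail_one : normSq (fun s : (Σ j : Fin m, A j.succ) → Bool =>
        ∏ j, init j.succ fun a => s ⟨j, a⟩) = 1 := by
      simp only [normSq_sigma, hinit, Finset.prod_const_one]
    obtain ⟨corr', htail⟩ := ih (fun j => h j.succ) (fun j => hinit j.succ)
      (fun j => hu j.succ) (fun j => hδ j.succ) htail_one
    have hall := ((h 0).append htail htail_one (hu 0) (hδ 0)
      (Finset.sum_nonneg fun j _ => hδ j.succ)).relabel (.refl D) (sigmaFinSuccEquiv A)
      (sigmaFinSuccEquiv B).toEmbedding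
    have hprod : (fun s : (Σ j, A j) → Bool => ∏ j, init j fun a => s ⟨j, a⟩) =
        fun s => tensor (init 0) (fun s => ∏ j : Fin m, init j.succ fun a => s ⟨j, a⟩)
          (s ∘ sigmaFinSuccEquiv A) :=
      funext fun s => Fin.prod_univ_succ _
    simp only [Fin.prod_univ_succ (fun j => u j _), Fin.sum_univ_succ δ, hprod, sharedProduct_succ]
    exact ⟨_, hall⟩

end SharedProduct

namespace Circuit

variable {D : Type} {m : ℕ}

/-- The ancilla qubits of the factor `V j`, as ancilla qubits of the product. -/
def productAnc (V : Fin m → Circuit D) (σ : Equiv.Perm (Fin m)) (j : Fin m) :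
    (V j).Anc ↪ (product V σ).Anc where
  toFun a := ⟨⟨j, a.1⟩, a.2⟩
  inj' := by
    rintro ⟨r, i⟩ ⟨r', i'⟩ h
    cases h
    rfl

/-- The classical bits of the factor `V j`, as classical bits of the product. -/
def productBit (V : Fin m → Circuit D) (σ : Equiv.Perm (Fin m)) (j : Fin m) :
    (V j).B ↪ (product V σ).B :=
  Embedding.sigmaMk (β := fun j => (V j).B) j

/-- The instructions of the factor `V j`, as instructions of the product. -/
def productPart (V : Fin m → Circuit D) (σ : Equiv.Perm (Fin m)) (j : Fin m) :
    List (Instr (D ⊕ (product V σ).Anc) (product V σ).B) :=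
  (V j).instrs.map
    (Instr.relabel ((Embedding.refl D).sumMap (productAnc V σ j)) (productBit V σ j))

theorem product_instrs (V : Fin m → Circuit D) (σ : Equiv.Perm (Fin m)) :
    (product V σ).instrs = (List.ofFn σ).flatMap (productPart V σ) :=
  rfl

theorem product_init (V : Fin m → Circuit D) (σ : Equiv.Perm (Fin m))
    (s : (product V σ).Anc → Bool) :
    (product V σ).init s = ∏ j, (V j).init (s ∘ productAnc V σ j) :=
  Fintype.prod_sigma _

/-- The ancilla qubits of the product, factor by factor in the order of execution. -/
def productAncEquiv (V : Fin m → Circuit D) (σ : Equiv.Perm (Fin m)) :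
    (Σ j, (V (σ j)).Anc) ≃ (product V σ).Anc :=
  (Equiv.sigmaCongrLeft (β := fun j => (V j).Anc) σ).trans
    (Equiv.sigmaAssoc fun j r => Fin ((V j).res r).arity).symm

theorem product_instrs_eq_map_sharedProduct (V : Fin m → Circuit D) (σ : Equiv.Perm (Fin m)) :
    (product V σ).instrs = (sharedProduct fun j => (V (σ j)).instrs).map
      (Instr.relabel ((Embedding.refl D).sumMap (productAncEquiv V σ).toEmbedding)
        (Equiv.sigmaCongrLeft (β := fun j => (V j).B) σ)) := by
  have hanc (j : Fin m) : (Embedding.refl D).sumMap (productAnc V σ (σ j)) =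
      ((Embedding.refl D).sumMap (.sigmaMk j)).trans
        ((Embedding.refl D).sumMap (productAncEquiv V σ).toEmbedding) := by
    ext (d | a) <;> rfl
  simp only [product_instrs, productPart, sharedProduct, List.map_flatMap,
    map_relabel_map_relabel, List.ofFn_eq_map, List.flatMap_map, hanc]
  rfl

theorem ZRealizes.product [DecidableEq D] [Fintype D] {V : Fin m → Circuit D}
    {u : Fin m → (D → Bool) → ℂ} {δ : Fin m → ℝ} (hV : ∀ j, (V j).ZRealizes (u j) (δ j))
    (hu : ∀ j x, ‖u j x‖ = 1) (hδ : ∀ j, 0 ≤ δ j) (σ : Equiv.Perm (Fin m)) :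
    (product V σ).ZRealizes (fun x => ∏ j, u j x) (∑ j, δ j) := by
  choose corr hcorr using hV
  obtain ⟨corr', h⟩ := DiagRealizes.sharedProduct (fun j => hcorr (σ j))
    (fun j => (IsSupply.of_circuit (V (σ j))).normSq_eq_one) (fun j => hu (σ j)) fun j => hδ (σ j)
  have hprod : (fun x => ∏ j, u j x) = fun x => ∏ j, u (σ j) x :=
    funext fun x => (Equiv.prod_comp σ fun j => u j x).symm
  rw [hprod, ← Equiv.sum_comp σ]
  refine h.zRealizes (.refl D) (productAncEquiv V σ)
    (Equiv.sigmaCongrLeft (β := fun j => (V j).B) σ).toEmbedding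
    (product_instrs_eq_map_sharedProduct V σ) fun s => ?_
  rw [product_init, ← Equiv.prod_comp σ]
  rfl

end Circuit

/-! ### Scheduling a product of circuits -/

/-- The data qubits in `S`, all ancilla qubits and all classical bits are available after `ρ`
cycles. -/
structure Clock.ReadyBy {D A B : Type} (t : Clock (D ⊕ A) B) (S : Finset D) (ρ : ℕ) : Prop where
  data_le : ∀ d ∈ S, t.qubit (.inl d) ≤ ρ
  anc_le : ∀ a, t.qubit (.inr a) ≤ ρ
  bit_le : ∀ b, t.bit b ≤ ρ

namespace Circuit

variable {D : Type} [DecidableEq D]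

/-- The circuit `V` occupies the data qubits `S` for one cycle only, it does not touch the other
data qubits, and it is done with its ancilla qubits another `K` cycles later. -/
structure Timed (V : Circuit D) (S : Finset D) (K : ℕ) : Prop where
  data_le {t : Clock (D ⊕ V.Anc) V.B} {ρ : ℕ} (ht : t.ReadyBy S ρ) :
    ∀ d ∈ S, (V.instrs.foldl Instr.tick t).qubit (.inl d) ≤ ρ + 1
  data_eq (t : Clock (D ⊕ V.Anc) V.B) :
    ∀ d ∉ S, (V.instrs.foldl Instr.tick t).qubit (.inl d) = t.qubit (.inl d)
  anc_le {t : Clock (D ⊕ V.Anc) V.B} {ρ : ℕ} (ht : t.ReadyBy S ρ) (a : V.Anc) :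
    (V.instrs.foldl Instr.tick t).qubit (.inr a) ≤ ρ + 1 + K

variable {m : ℕ} (V : Fin m → Circuit D) (σ : Equiv.Perm (Fin m))

/-- A clock for the product, restricted to the factor `V j`. -/
def factorClock (j : Fin m) (t : Clock (D ⊕ (product V σ).Anc) (product V σ).B) :
    Clock (D ⊕ (V j).Anc) (V j).B :=
  t.comap ((Embedding.refl D).sumMap (productAnc V σ j)) (productBit V σ j)

variable {V σ}

theorem foldl_tick_productPart (j : Fin m) (t : Clock (D ⊕ (product V σ).Anc) (product V σ).B) :
    (productPart V σ j).foldl Instr.tick t =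
      ((V j).instrs.foldl Instr.tick (factorClock V σ j t)).extend
        ((Embedding.refl D).sumMap (productAnc V σ j)) (productBit V σ j) t :=
  foldl_tick_relabel _ (productBit V σ j).injective _ _

theorem foldl_tick_productPart_data (j : Fin m)
    (t : Clock (D ⊕ (product V σ).Anc) (product V σ).B) (d : D) :
    ((productPart V σ j).foldl Instr.tick t).qubit (.inl d) =
      ((V j).instrs.foldl Instr.tick (factorClock V σ j t)).qubit (.inl d) := by
  rw [foldl_tick_productPart]
  exact ((Embedding.refl D).sumMap (productAnc V σ j)).injective.extend_apply _ _ (.inl d)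

theorem foldl_tick_productPart_anc (j : Fin m)
    (t : Clock (D ⊕ (product V σ).Anc) (product V σ).B) (a : (V j).Anc) :
    ((productPart V σ j).foldl Instr.tick t).qubit (.inr (productAnc V σ j a)) =
      ((V j).instrs.foldl Instr.tick (factorClock V σ j t)).qubit (.inr a) := by
  rw [foldl_tick_productPart]
  exact ((Embedding.refl D).sumMap (productAnc V σ j)).injective.extend_apply _ _ (.inr a)

theorem foldl_tick_productPart_anc_of_ne {i j : Fin m} (h : i ≠ j)
    (t : Clock (D ⊕ (product V σ).Anc) (product V σ).B) (a : (V i).Anc) :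
    ((productPart V σ j).foldl Instr.tick t).qubit (.inr (productAnc V σ i a)) =
      t.qubit (.inr (productAnc V σ i a)) := by
  rw [foldl_tick_productPart]
  refine extend_apply' _ _ _ ?_
  rintro ⟨d | a', ha'⟩
  · exact Sum.inl_ne_inr ha'
  · exact h (congrArg (fun q => q.1.1) (Sum.inr_injective ha')).symm

theorem foldl_tick_productPart_bit_of_ne {i j : Fin m} (h : i ≠ j)
    (t : Clock (D ⊕ (product V σ).Anc) (product V σ).B) (b : (V i).B) :
    ((productPart V σ j).foldl Instr.tick t).bit (productBit V σ i b) =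
      t.bit (productBit V σ i b) := by
  rw [foldl_tick_productPart]
  refine extend_apply' _ _ _ ?_
  rintro ⟨b', hb'⟩
  exact h (congrArg Sigma.fst hb').symm

variable {S : Fin m → Finset D} {ρ : Fin m → ℕ} {K : ℕ}

theorem readyBy_foldl_tick_productPart {i j : Fin m} (hij : i ≠ j) (hV : (V j).Timed (S j) K)
    (hρ : ρ j ≤ ρ i) (hS : ρ i = ρ j → Disjoint (S i) (S j))
    {t : Clock (D ⊕ (product V σ).Anc) (product V σ).B}
    (hj : (factorClock V σ j t).ReadyBy (S j) (ρ j))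
    (hi : (factorClock V σ i t).ReadyBy (S i) (ρ i)) :
    (factorClock V σ i ((productPart V σ j).foldl Instr.tick t)).ReadyBy (S i) (ρ i) where
  data_le d hd := by
    refine (foldl_tick_productPart_data j t d).trans_le ?_
    by_cases hdj : d ∈ S j
    · have hne : ρ j ≠ ρ i := fun h => Finset.disjoint_left.1 (hS h.symm) hd hdj
      exact (hV.data_le hj d hdj).trans (hρ.lt_of_ne hne)
    · exact (hV.data_eq _ d hdj).trans_le (hi.data_le d hd)
  anc_le a := (foldl_tick_productPart_anc_of_ne hij t a).trans_le (hi.anc_le a)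
  bit_le b := (foldl_tick_productPart_bit_of_ne hij t b).trans_le (hi.bit_le b)

theorem foldl_tick_productPart_le {j : Fin m} {N : ℕ} (hV : (V j).Timed (S j) K)
    (hN : ρ j + 1 + K ≤ N) {t : Clock (D ⊕ (product V σ).Anc) (product V σ).B}
    (hj : (factorClock V σ j t).ReadyBy (S j) (ρ j)) (ht : ∀ q, t.qubit q ≤ N)
    (q : D ⊕ (product V σ).Anc) :
    ((productPart V σ j).foldl Instr.tick t).qubit q ≤ N := by
  obtain d | ⟨⟨i, r⟩, k⟩ := q
  · rw [foldl_tick_productPart_data]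
    by_cases hd : d ∈ S j
    · exact (hV.data_le hj d hd).trans ((Nat.le_add_right _ K).trans hN)
    · exact (hV.data_eq _ d hd).trans_le (ht (.inl d))
  · obtain rfl | hij := eq_or_ne i j
    · exact (foldl_tick_productPart_anc i t ⟨r, k⟩).trans_le ((hV.anc_le hj ⟨r, k⟩).trans hN)
    · exact (foldl_tick_productPart_anc_of_ne hij t ⟨r, k⟩).trans_le (ht _)

theorem foldl_tick_flatMap_productPart_le {N : ℕ} (hV : ∀ j, (V j).Timed (S j) K)
    (hN : ∀ j, ρ j + 1 + K ≤ N) (hS : ∀ i j, i ≠ j → ρ i = ρ j → Disjoint (S i) (S j))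
    {js : List (Fin m)} (hnodup : js.Nodup) (hsorted : js.Pairwise fun i j => ρ i ≤ ρ j)
    {t : Clock (D ⊕ (product V σ).Anc) (product V σ).B}
    (hready : ∀ j ∈ js, (factorClock V σ j t).ReadyBy (S j) (ρ j)) (ht : ∀ q, t.qubit q ≤ N)
    (q : D ⊕ (product V σ).Anc) :
    ((js.flatMap (productPart V σ)).foldl Instr.tick t).qubit q ≤ N := by
  induction js generalizing t with
  | nil => exact ht q
  | cons j js ih =>
    obtain ⟨hj, hnodup⟩ := List.nodup_cons.1 hnodup
    obtain ⟨hρ, hsorted⟩ := List.pairwise_cons.1 hsorted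
    obtain ⟨hready_j, hready⟩ := List.forall_mem_cons.1 hready
    rw [List.flatMap_cons, List.foldl_append]
    refine ih hnodup hsorted (fun i hi => ?_) (foldl_tick_productPart_le (hV j) (hN j) hready_j ht)
    have hij : i ≠ j := ne_of_mem_of_not_mem hi hj
    exact readyBy_foldl_tick_productPart hij (hV j) (hρ i hi) (hS i j hij) hready_j (hready i hi)

theorem logicalDepth_product_sort_le [Fintype D] {c : ℕ} (hV : ∀ j, (V j).Timed (S j) K)
    (hρ : ∀ j, ρ j < c) (hS : ∀ i j, i ≠ j → ρ i = ρ j → Disjoint (S i) (S j)) :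
    (product V (Tuple.sort ρ)).logicalDepth ≤ c + K := by
  refine Finset.sup_le fun q _ => ?_
  rw [product_instrs]
  refine foldl_tick_flatMap_productPart_le hV (fun j => Nat.add_le_add_right (hρ j) K) hS
    (List.nodup_ofFn.2 (Tuple.sort ρ).injective) ?_
    (fun _ _ => ⟨fun _ _ => zero_le, fun _ => zero_le, fun _ => zero_le⟩)
    (fun _ => zero_le) q
  exact List.pairwise_ofFn.2 fun i j hij => Tuple.monotone_sort ρ hij.le

end Circuit

/-! ### Phases controlled by a Boolean function -/

theorem corrSign_mul_self {D B : Type} [Fintype D] (corr : D → Finset B) (m : B → Bool)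
    (x : D → Bool) : corrSign corr m x * corrSign corr m x = 1 := by
  simp [corrSign, ← Finset.prod_mul_distrib, sgn_mul_self]

section Tensor

variable {D A B B' : Type}

theorem tensor_sub (φ : (D → Bool) → ℂ) (ψ ψ' : (A → Bool) → ℂ) :
    tensor φ (ψ - ψ') = tensor φ ψ - tensor φ ψ' :=
  funext fun _ => mul_sub ..

theorem tensor_smul (c : ℂ) (φ : (D → Bool) → ℂ) (ψ : (A → Bool) → ℂ) :
    tensor φ (c • ψ) = c • tensor φ ψ :=
  funext fun _ => mul_left_comm ..

theorem smul_tensor (c : ℂ) (φ : (D → Bool) → ℂ) (ψ : (A → Bool) → ℂ) :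
    tensor (c • φ) ψ = c • tensor φ ψ :=
  funext fun _ => mul_assoc ..

variable [DecidableEq D] [DecidableEq A] [DecidableEq B] [DecidableEq B']

theorem kraus_relabel_inl_tensor {g : B → B'} (hg : Injective g) (l : List (Instr D B))
    (o : List Bool) (m : B' → Bool) (φ : (D → Bool) → ℂ) (ψ : (A → Bool) → ℂ) :
    kraus (l.map (Instr.relabel .inl g)) o m (tensor φ ψ) = tensor (kraus l o (m ∘ g) φ) ψ :=
  kraus_relabel .inl hg (R := fun s => ψ (s ∘ .inr)) (fun _ _ _ => rfl) l o m φ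

theorem kraus_relabel_inr_tensor {g : B → B'} (hg : Injective g) (l : List (Instr A B))
    (o : List Bool) (m : B' → Bool) (φ : (D → Bool) → ℂ) (ψ : (A → Bool) → ℂ) :
    kraus (l.map (Instr.relabel .inr g)) o m (tensor φ ψ) = tensor φ (kraus l o (m ∘ g) ψ) := by
  have hrun := kraus_relabel (Q' := D ⊕ A) .inr hg (R := fun s => φ (s ∘ .inl))
    (fun _ _ _ => rfl) l o m ψ
  simpa only [mul_comm _ (φ _)] using! hrun

end Tensor

section Uncompute

variable {D A B : Type} [DecidableEq D] [DecidableEq A] [DecidableEq B]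

theorem kraus_append_uncompute {l₁ : List (Instr (D ⊕ A) B)} (l₂ : List (Instr A B))
    {init : (A → Bool) → ℂ} {o : List Bool} {x : D → Bool} {ψ : (A → Bool) → ℂ}
    (hψ : kraus l₁ o ⊥ (tensor (ket x) init) = tensor (ket x) ψ) :
    kraus (l₁ ++ l₂.map (Instr.relabel .inr id)) o ⊥ (tensor (ket x) init) =
      tensor (ket x) (kraus l₂ (o.drop (measCount l₁)) (finalMem l₁ o ⊥) ψ) := by
  rw [kraus_append, hψ, kraus_relabel_inr_tensor injective_id, comp_id]

variable [Fintype D] [Fintype A]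

theorem DiagRealizes.append_uncompute {l₁ : List (Instr (D ⊕ A) B)} {l₂ : List (Instr A B)}
    {init : (A → Bool) → ℂ} {corr : D → Finset B} {u : (D → Bool) → ℂ} {δ : ℝ}
    {ψ ψ' : List Bool → (D → Bool) → (A → Bool) → ℂ} {χ : List Bool → List Bool → (A → Bool) → ℂ}
    (hψ : ∀ o x, kraus l₁ o ⊥ (tensor (ket x) init) = tensor (ket x) (ψ o x))
    (hψ' : ∀ x, recordSum (measCount l₁) (fun o => normSq (ψ' o x)) = 1)
    (happrox : ∀ x, recordSum (measCount l₁) (fun o => normSq (ψ o x - u x • ψ' o x)) ≤ δ ^ 2)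
    (hχ : ∀ o o' x, kraus l₂ o' (finalMem l₁ o ⊥) (ψ' o x) =
      corrSign corr (finalMem l₂ o' (finalMem l₁ o ⊥)) x • χ o o') :
    DiagRealizes (l₁ ++ l₂.map (Instr.relabel .inr id)) init corr u δ := by
  have hket (o : List Bool) (x : D → Bool) := kraus_append_uncompute l₂ (hψ o x)
  have hcount : measCount (l₁ ++ l₂.map (Instr.relabel (.inr : A ↪ D ⊕ A) id)) =
      measCount l₁ + measCount l₂ :=
    List.countP_append.trans (congrArg _ (measCount_map_relabel ..))
  have hmem (o o' : List Bool) (ho : o.length = measCount l₁) :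
      finalMem l₁ (o ++ o') ⊥ = finalMem l₁ o ⊥ := by
    rw [← finalMem_take l₁ (o ++ o'), List.take_left' ho]
  have hψ_append (o o' : List Bool) (x : D → Bool) (ho : o.length = measCount l₁) :
      ψ (o ++ o') x = ψ o x := by
    rw [← branch_eq (hψ (o ++ o') x), ← branch_eq (hψ o x), ← branch_take, List.take_left' ho]
  refine ⟨fun o x => (hket o x).trans (congrArg _ (branch_eq (hket o x)).symm),
    fun o => χ (o.take (measCount l₁)) (o.drop (measCount l₁)), ?_, fun x => ?_⟩
  · rw [hcount, recordSum_add, ← hψ' ⊥]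
    refine recordSum_congr fun o ho => ?_
    rw [← recordSum_normSq_kraus l₂ (finalMem l₁ o ⊥)]
    refine recordSum_congr fun o' _ => ?_
    beta_reduce
    rw [hχ, normSq_smul, norm_corrSign, one_pow, one_mul, List.take_left' ho, List.drop_left' ho]
  · rw [hcount, recordSum_add]
    refine (recordSum_congr fun o ho => ?_).trans_le (happrox x)
    rw [← recordSum_normSq_kraus l₂ (finalMem l₁ o ⊥)]
    refine recordSum_congr fun o' _ => ?_
    beta_reduce
    rw [branch_eq (hket (o ++ o') x), finalMem_append, finalMem_relabel _ injective_id,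
      hmem o o' ho, hψ_append o o' x ho, List.take_left' ho, List.drop_left' ho, map_sub, map_smul,
      hχ, comp_id, extend_id]
    rw [← one_mul (normSq (_ - _)), ← one_pow 2, ← norm_corrSign corr _ x, ← normSq_smul, smul_sub,
      smul_comm _ (u x), smul_smul (corrSign ..), corrSign_mul_self, one_smul]

end Uncompute

/-- The phase that the gate `exp(iγ |1⟩⟨1|)` applies to the basis state `b`. -/
noncomputable def phase (γ : ℝ) (b : Bool) : ℂ := if b then Complex.exp (Complex.I * γ) else 1

theorem phaseGate_mulVec_ket (γ : ℝ) (b : Bool) :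
    (phaseGate γ).mulVec (ket fun _ => b) = phase γ b • ket fun _ => b := by
  funext s
  rw [phaseGate, Matrix.mulVec_diagonal, Pi.smul_apply, smul_eq_mul]
  by_cases h : s () = b
  · rw [phase, h]
  · simp [ket_unit, ind, h]

theorem Circuit.Implements.exists_approx {P : Circuit Unit} {γ δ : ℝ}
    (hP : P.Implements (phaseGate γ) δ) : ∃ χ : List Bool → (P.Anc → Bool) → ℂ,
    recordSum (measCount P.instrs) (fun o => normSq (χ o)) = 1 ∧
    ∀ b, recordSum (measCount P.instrs) (fun o =>
      normSq (kraus P.instrs o ⊥ (tensor (ket fun _ => b) P.init) -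
        phase γ b • tensor (ket fun _ => b) (χ o))) ≤ δ ^ 2 := by
  obtain ⟨χ, hχ, happrox⟩ := hP
  have hget (o : P.Outcome) :
      (fun i : Fin (measCount P.instrs) => (List.ofFn o).getD i false) = o := by
    funext i
    simp
  refine ⟨fun o => χ fun i => o.getD i false, ?_, fun b => ?_⟩
  · simpa only [recordSum, hget] using! hχ
  · have hb := happrox (ket fun _ => b)
    rw [show ∑ x, ‖ket (fun _ : Unit => b) x‖ ^ 2 = 1 from normSq_ket _, mul_one] at hb
    refine (Finset.sum_congr rfl fun o _ => Finset.sum_congr rfl fun s _ => ?_).trans_le hb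
    rw [phaseGate_mulVec_ket, Circuit.corrected, P.exec_eq]
    simp only [Finset.prod_empty, Finset.prod_const_one, one_mul, Pi.sub_apply, Pi.smul_apply,
      smul_eq_mul, tensor, mul_assoc, hget, comp_def]

namespace Evaluator

variable {E : Type} [Fintype E] [DecidableEq E] {f : (E → Bool) → Bool} {L N : ℕ}

section State

variable (C : Evaluator E f L N)

theorem recordSum_normSq_state (x : E → Bool) :
    recordSum (measCount C.pre) (fun o => normSq (C.state o x)) = 1 := by
  have hpre := recordSum_normSq_kraus C.pre ⊥
    (tensor (ket x) fun s : Option C.A → Bool => plusAmp * C.init (s ∘ some))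
  have hinit := normSq_option (fun _ => plusAmp) C.init
  rw [normSq_tensor, normSq_ket, hinit, IsSupply.plus.normSq_eq_one, C.supply.normSq_eq_one,
    one_mul, one_mul] at hpre
  rw [← hpre]
  refine recordSum_congr fun o _ => ?_
  calc normSq (C.state o x)
    _ = normSq (tensor (ket x) fun s : Option C.A → Bool =>
        ind (s none) (f x) * C.state o x (s ∘ some)) := by
      have hroot := normSq_option (ket fun _ => f x) (C.state o x)
      simp only [ket_unit] at hroot
      rw [normSq_tensor, normSq_ket, hroot, normSq_ket, one_mul, one_mul]
    _ = _ := congrArg normSq (C.kraus_pre o x).symm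

end State

variable (C : Evaluator E f L N) (P : Circuit Unit)

/-- The qubits, other than the data qubits, on which the function `f` is computed by `C`, and on
which `P` is applied to the qubit `.inr (.inl ())` that holds its value. -/
abbrev PhaseAnc : Type := C.A ⊕ (Unit ⊕ P.Anc)

/-- The classical bits of `C` and of `P`, and a bit for the basis of the measurement of the qubit
that holds the value of `f`. -/
abbrev PhaseBit : Type := C.B ⊕ (P.B ⊕ Unit)

/-- Places the qubits of `C`. -/
def preQubit : E ⊕ Option C.A ↪ E ⊕ C.PhaseAnc P :=
  (Embedding.refl E).sumMap
    ((Equiv.optionEquivSumPUnit C.A).toEmbedding.trans ((Embedding.refl C.A).sumMap .inl))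

/-- The instructions of `C` that compute the value of `f`. -/
def compute : List (Instr (E ⊕ C.PhaseAnc P) (C.PhaseBit P)) :=
  C.pre.map (Instr.relabel (C.preQubit P) .inl)

/-- The instructions of `P`, applied to the value of `f`. -/
def applyPhase : List (Instr (E ⊕ C.PhaseAnc P) (C.PhaseBit P)) :=
  P.instrs.map (Instr.relabel (Embedding.inr.trans .inr) (.inr ∘ .inl))

/-- Places the bits of `measureX`. -/
def rootBit : Bool ↪ C.PhaseBit P :=
  ⟨fun b => if b then .inr (.inr ()) else .inl C.pend, by rintro (_ | _) (_ | _) <;> simp⟩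

/-- Measures the value of `f` in the `X` basis. -/
def measureValue : List (Instr (C.PhaseAnc P) (C.PhaseBit P)) :=
  measureX.map (Instr.relabel (Embedding.inl.trans .inr) (C.rootBit P))

/-- Measures the value of `f` in the `X` basis, and removes the by-products. -/
def uncompute : List (Instr (C.PhaseAnc P) (C.PhaseBit P)) :=
  C.measureValue P ++ C.post.map (Instr.relabel .inl .inl)

theorem measCount_compute : measCount (C.compute P) = measCount C.pre :=
  measCount_map_relabel ..

theorem measCount_compute_append :
    measCount (C.compute P ++ C.applyPhase P) = measCount C.pre + measCount P.instrs :=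
  List.countP_append.trans
    (congrArg₂ _ (C.measCount_compute P) (measCount_map_relabel ..))

theorem finalMem_compute_comp_inl (o : List Bool) :
    finalMem (C.compute P ++ C.applyPhase P) o ⊥ ∘ .inl =
      finalMem C.pre (o.take (measCount C.pre)) ⊥ := by
  rw [finalMem_take, finalMem_append, applyPhase, compute, finalMem_relabel_comp_of_ne _
    (Sum.inr_injective.comp Sum.inl_injective) (fun _ _ => Sum.inr_ne_inl),
    finalMem_relabel_comp _ Sum.inl_injective]
  rfl

theorem kraus_compute (o : List Bool) (x : E → Bool) (ψ : (P.Anc → Bool) → ℂ) :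
    kraus (C.compute P) o ⊥ (tensor (ket x) (tensor C.init (tensor (fun _ => plusAmp) ψ))) =
      tensor (ket x) (tensor (C.state o x) (tensor (ket fun _ => f x) ψ)) := by
  have hrun := kraus_relabel (C.preQubit P) (Sum.inl_injective (β := P.B ⊕ Unit))
    (R := fun s => ψ (s ∘ .inr ∘ .inr ∘ .inr)) (by rintro s (e | _ | a) v <;> rfl) C.pre o ⊥
    fun s => ket x (s ∘ .inl) * (plusAmp * C.init (s ∘ .inr ∘ some))
  rw [show (⊥ : C.PhaseBit P → Bool) ∘ .inl = ⊥ from rfl, C.kraus_pre] at hrun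
  refine (congrArg _ (funext fun s => ?_)).trans (hrun.trans (funext fun s => ?_))
  · exact (congrArg _ (mul_left_comm ..)).trans <|
      (congrArg _ (mul_assoc ..).symm).trans (mul_assoc ..).symm
  · exact (mul_assoc ..).trans <| congrArg _ <| (mul_assoc ..).trans <| (mul_left_comm ..).trans <|
      congrArg _ <| congrArg (· * _)
        (ket_unit (fun _ => f x) (s ∘ .inr ∘ .inr ∘ .inl)).symm

theorem kraus_applyPhase (o : List Bool) {m : C.PhaseBit P → Bool} (hm : m ∘ .inr ∘ .inl = ⊥)
    (φ : (E → Bool) → ℂ) (ψ : (C.A → Bool) → ℂ) (ψ' : (Unit ⊕ P.Anc → Bool) → ℂ) :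
    kraus (C.applyPhase P) o m (tensor φ (tensor ψ ψ')) =
      tensor φ (tensor ψ (kraus P.instrs o ⊥ ψ')) := by
  have hinstrs : C.applyPhase P =
      (P.instrs.map (Instr.relabel .inr (.inr ∘ .inl))).map (Instr.relabel .inr id) :=
    (map_relabel_map_relabel .inr _ .inr id P.instrs).symm
  rw [hinstrs, kraus_relabel_inr_tensor injective_id,
    kraus_relabel_inr_tensor (Sum.inr_injective.comp Sum.inl_injective), comp_id, hm]

theorem kraus_compute_append (o : List Bool) (x : E → Bool) :
    kraus (C.compute P ++ C.applyPhase P) o ⊥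
      (tensor (ket x) (tensor C.init (tensor (fun _ => plusAmp) P.init))) =
      tensor (ket x) (tensor (C.state (o.take (measCount C.pre)) x)
        (kraus P.instrs (o.drop (measCount C.pre)) ⊥ (tensor (ket fun _ => f x) P.init))) := by
  have hmem : finalMem (C.compute P) o ⊥ ∘ .inr ∘ .inl = ⊥ :=
    finalMem_relabel_comp_of_ne _ Sum.inl_injective (fun _ _ => Sum.inl_ne_inr) ..
  rw [kraus_append, ← kraus_take (C.compute P), measCount_compute, kraus_compute,
    C.kraus_applyPhase P _ hmem]

theorem finalMem_measureValue_comp_inl (o : List Bool) (m : C.PhaseBit P → Bool) :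
    finalMem (C.measureValue P) o m ∘ .inl = update (m ∘ .inl) C.pend (o.headD false) := by
  rw [measureValue, finalMem_relabel _ (C.rootBit P).injective, finalMem_measureX]
  funext b
  by_cases hb : b = C.pend
  · subst hb
    rw [update_self]
    exact (C.rootBit P).injective.extend_apply _ _ false
  · rw [update_of_ne hb]
    refine extend_apply' _ _ _ ?_
    rintro ⟨_ | _, h⟩
    · exact hb (Sum.inl_injective h.symm)
    · exact Sum.inr_ne_inl h

theorem kraus_measureValue (o : List Bool) (m : C.PhaseBit P → Bool) (b : Bool)
    (ψ : (C.A → Bool) → ℂ) (ψ' : (P.Anc → Bool) → ℂ) :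
    kraus (C.measureValue P) o m (tensor ψ (tensor (ket fun _ => b) ψ')) =
      sgn (o.headD false && b) •
        tensor ψ (tensor (fun s => sgn (o.headD false && s ()) / 2) ψ') := by
  have hinstrs : C.measureValue P =
      (measureX.map (Instr.relabel .inl (C.rootBit P))).map (Instr.relabel .inr id) :=
    (map_relabel_map_relabel ..).symm
  have hket : ket (fun _ : Unit => b) = fun s => ind (s ()) b := funext fun s => ket_unit _ s
  rw [hinstrs, kraus_relabel_inr_tensor injective_id,
    kraus_relabel_inl_tensor (C.rootBit P).injective, hket, kraus_measureX, ← tensor_smul,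
    ← smul_tensor]
  rfl

theorem finalMem_uncompute_comp_inl (o : List Bool) (m : C.PhaseBit P → Bool) :
    finalMem (C.uncompute P) o m ∘ .inl =
      finalMem C.post (o.drop 1) (update (m ∘ .inl) C.pend (o.headD false)) := by
  rw [uncompute, finalMem_append, finalMem_relabel_comp _ Sum.inl_injective,
    C.finalMem_measureValue_comp_inl P]
  rfl

theorem kraus_uncompute {o : List Bool} {m : C.PhaseBit P → Bool}
    (hm : m ∘ .inl = finalMem C.pre o ⊥) (o' : List Bool) (x : E → Bool)
    (χ : (P.Anc → Bool) → ℂ) :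
    kraus (C.uncompute P) o' m (tensor (C.state o x) (tensor (ket fun _ => f x) χ)) =
      corrSign (fun e => {.inl (C.corr e)}) (finalMem (C.uncompute P) o' m) x •
        tensor (C.final o (o'.drop 1) (o'.headD false))
          (tensor (fun s => sgn (o'.headD false && s ()) / 2) χ) := by
  set r := o'.headD false
  have hcorr : ∏ e, sgn (finalMem C.post (o'.drop 1) (update (finalMem C.pre o ⊥) C.pend r)
      (C.corr e) && x e) =
        corrSign (fun e => {.inl (C.corr e)}) (finalMem (C.uncompute P) o' m) x := by
    rw [← hm, ← finalMem_uncompute_comp_inl]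
    simp only [corrSign, Finset.prod_singleton, comp_apply]
  have hpost : kraus C.post (o'.drop 1) (update (finalMem C.pre o ⊥) C.pend r) (C.state o x) =
      sgn (r && f x) • corrSign (fun e => {.inl (C.corr e)}) (finalMem (C.uncompute P) o' m) x •
        C.final o (o'.drop 1) r := by
    rw [C.kraus_post, hcorr]
    exact funext fun _ => mul_assoc ..
  have hcount : measCount (C.measureValue P) = 1 := measCount_map_relabel ..
  rw [uncompute, kraus_append, kraus_measureValue, map_smul,
    kraus_relabel_inl_tensor Sum.inl_injective, finalMem_measureValue_comp_inl, hm, ← uncompute,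
    hcount, hpost, smul_tensor, smul_tensor, smul_smul, sgn_mul_self, one_smul]

/-- Applies `P` to the value of `f`. -/
def conditionalPhase : List (Instr (E ⊕ C.PhaseAnc P) (C.PhaseBit P)) :=
  C.compute P ++ C.applyPhase P ++ (C.uncompute P).map (Instr.relabel .inr id)

theorem diagRealizes_conditionalPhase {γ δ : ℝ} (hP : P.Implements (phaseGate γ) δ) :
    DiagRealizes (C.conditionalPhase P) (tensor C.init (tensor (fun _ => plusAmp) P.init))
      (fun e => {.inl (C.corr e)}) (fun x => phase γ (f x)) δ := by
  obtain ⟨χ, hχ, happrox⟩ := hP.exists_approx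
  let n := measCount C.pre
  refine DiagRealizes.append_uncompute (C.kraus_compute_append P)
    (ψ' := fun o x => tensor (C.state (o.take n) x) (tensor (ket fun _ => f x) (χ (o.drop n))))
    (χ := fun o o' => tensor (C.final (o.take n) (o'.drop 1) (o'.headD false))
      (tensor (fun s => sgn (o'.headD false && s ()) / 2) (χ (o.drop n))))
    (fun x => ?_) (fun x => ?_)
    fun o o' x => C.kraus_uncompute P (C.finalMem_compute_comp_inl P o) o' x _
  · rw [measCount_compute_append, recordSum_add, ← C.recordSum_normSq_state x]
    refine recordSum_congr fun o ho => ?_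
    rw [← mul_one (normSq (C.state o x)), ← hχ, ← recordSum_mul_left]
    refine recordSum_congr fun o' _ => ?_
    rw [List.take_left' ho, List.drop_left' ho, normSq_tensor, normSq_tensor, normSq_ket, one_mul]
  · calc _
      _ = recordSum n fun o => normSq (C.state o x) *
          recordSum (measCount P.instrs) fun o' =>
            normSq (kraus P.instrs o' ⊥ (tensor (ket fun _ => f x) P.init) -
              phase γ (f x) • tensor (ket fun _ => f x) (χ o')) := by
        rw [measCount_compute_append, recordSum_add]
        refine recordSum_congr fun o ho => ?_
        rw [← recordSum_mul_left]
        refine recordSum_congr fun o' _ => ?_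
        rw [List.take_left' ho, List.drop_left' ho, ← tensor_smul, ← tensor_sub, normSq_tensor]
      _ ≤ recordSum n fun o => normSq (C.state o x) * δ ^ 2 :=
        recordSum_mono fun o _ =>
          mul_le_mul_of_nonneg_left (happrox (f x)) (normSq_nonneg _)
      _ = δ ^ 2 := by rw [recordSum_mul_right, C.recordSum_normSq_state, one_mul]

end Evaluator

theorem measureX_tick_le : measureX.foldl Instr.tick (Clock.const _ _ 0) ≤ Clock.const _ _ 0 := by
  constructor <;> intro b <;> cases b <;> exact le_rfl

namespace Evaluator

variable {E : Type} [Fintype E] [DecidableEq E] {f : (E → Bool) → Bool} {L N : ℕ}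
  (C : Evaluator E f L N) (P : Circuit Unit)

/-- A bound on the cycles after which the classical bits are known: `τ` for those of `P`. -/
def bitBound (τ : P.B → ℕ) (k : ℕ) : C.PhaseBit P → ℕ :=
  Sum.elim (fun _ => k) (Sum.elim τ fun _ => k)

variable {P}

theorem bitBound_mono {τ τ' : P.B → ℕ} {k k' : ℕ} (hτ : τ ≤ τ') (hk : k ≤ k') :
    C.bitBound P τ k ≤ C.bitBound P τ' k' :=
  Sum.forall.2 ⟨fun _ => hk, Sum.forall.2 ⟨hτ, fun _ => hk⟩⟩

variable (P)

theorem compute_tick_le : (C.compute P).foldl Instr.tick (Clock.const _ _ 0) ≤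
    ⟨Sum.elim (fun _ => 1) fun _ => 1 + 2 * L, C.bitBound P 0 (1 + 2 * L)⟩ :=
  foldl_tick_relabel_le (k := 0) _ Sum.inl_injective C.pre_tick_le le_rfl
    ⟨by rintro (_ | _ | _) <;> exact le_rfl, fun _ => le_rfl⟩ ⟨fun _ => zero_le, fun _ => zero_le⟩

theorem applyPhase_tick_le :
    (C.applyPhase P).foldl Instr.tick
        ⟨Sum.elim (fun _ => 1) fun _ => 1 + 2 * L, C.bitBound P 0 (1 + 2 * L)⟩ ≤
      ⟨Sum.elim (fun _ => 1) fun _ => P.logicalDepth + (1 + 2 * L),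
        C.bitBound P (fun b => (P.instrs.foldl Instr.tick (Clock.const _ _ 0)).bit b + (1 + 2 * L))
          (P.logicalDepth + (1 + 2 * L))⟩ := by
  have hP : P.instrs.foldl Instr.tick (Clock.const _ _ 0) ≤
      ⟨fun _ => P.logicalDepth, (P.instrs.foldl Instr.tick (Clock.const _ _ 0)).bit⟩ :=
    ⟨fun _ => Finset.le_sup (Finset.mem_univ _), le_rfl⟩
  exact foldl_tick_relabel_le (k := 1 + 2 * L) _ (Sum.inr_injective.comp Sum.inl_injective) hP
    ⟨fun _ => Nat.le_add_left .., fun _ => zero_le⟩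
    ⟨fun _ => le_rfl, fun _ => le_rfl⟩
    ⟨Sum.forall.2 ⟨fun _ => le_rfl, fun _ => Nat.le_add_left ..⟩,
      C.bitBound_mono (fun _ => zero_le) (Nat.le_add_left ..)⟩

theorem uncompute_tick_le (τ : P.B → ℕ) (k : ℕ) :
    (C.uncompute P).foldl Instr.tick ⟨fun _ => k, C.bitBound P τ k⟩ ≤
      ⟨fun _ => 2 * L + k, C.bitBound P τ (2 * L + k)⟩ := by
  have hmeasure : (C.measureValue P).foldl Instr.tick ⟨fun _ => k, C.bitBound P τ k⟩ ≤
      ⟨fun _ => k, C.bitBound P τ k⟩ :=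
    foldl_tick_relabel_le (k := k) _ (C.rootBit P).injective measureX_tick_le
      ⟨fun _ => Nat.le_add_left .., by rintro (_ | _) <;> exact Nat.le_add_left ..⟩
      ⟨fun _ => (Nat.zero_add k).le, by rintro (_ | _) <;> exact (Nat.zero_add k).le⟩ le_rfl
  rw [uncompute, List.foldl_append]
  exact (foldl_tick_mono _ hmeasure).trans <| foldl_tick_relabel_le (k := k) _ Sum.inl_injective
    C.post_tick_le ⟨fun _ => Nat.le_add_left .., fun _ => Nat.le_add_left ..⟩
    ⟨fun _ => le_rfl, fun _ => le_rfl⟩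
    ⟨fun _ => Nat.le_add_left .., C.bitBound_mono le_rfl (Nat.le_add_left ..)⟩

theorem map_uncompute_tick_le (τ : P.B → ℕ) (k : ℕ) :
    ((C.uncompute P).map (Instr.relabel .inr id)).foldl Instr.tick
        ⟨Sum.elim (fun _ : E => 1) fun _ => k, C.bitBound P τ k⟩ ≤
      ⟨Sum.elim (fun _ => 1) fun _ => 2 * L + k, C.bitBound P τ (2 * L + k)⟩ :=
  foldl_tick_relabel_le (k := 0) _ injective_id (C.uncompute_tick_le P τ k) le_rfl le_rfl
    ⟨Sum.forall.2 ⟨fun _ => le_rfl, fun _ => Nat.le_add_left ..⟩,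
      C.bitBound_mono le_rfl (Nat.le_add_left ..)⟩

theorem conditionalPhase_tick_le :
    ((C.conditionalPhase P).foldl Instr.tick (Clock.const _ _ 0)).qubit ≤
      Sum.elim (fun _ => 1) fun _ => 2 * L + (P.logicalDepth + (1 + 2 * L)) := by
  have happly := (foldl_tick_mono _ (C.compute_tick_le P)).trans (C.applyPhase_tick_le P)
  rw [conditionalPhase, List.foldl_append, List.foldl_append]
  exact ((foldl_tick_mono _ happly).trans (C.map_uncompute_tick_le P _ _)).1

theorem length_conditionalPhase_le :
    (C.conditionalPhase P).length ≤ N + P.instrs.length + 2 := by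
  have hlength := C.length_le
  simp only [conditionalPhase, compute, applyPhase, uncompute, measureValue, measureX,
    List.length_append, List.length_map, List.length_cons, List.length_nil]
  omega

end Evaluator

theorem Circuit.Timed.of_relabel {D E A B : Type} [DecidableEq D] [DecidableEq E] [DecidableEq A]
    [DecidableEq B] {l : List (Instr (E ⊕ A) B)} {V : Circuit D} {S : Finset D} {K : ℕ}
    (ι : E ↪ D) (e : A ≃ V.Anc) (g : B ↪ V.B)
    (hinstrs : V.instrs = l.map (Instr.relabel (ι.sumMap e.toEmbedding) g))
    (hl : (l.foldl Instr.tick (Clock.const _ _ 0)).qubit ≤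
      Sum.elim (fun _ => 1) fun _ => 1 + K)
    (hι : ∀ i, ι i ∈ S) : V.Timed S K := by
  have hle {t : Clock (D ⊕ V.Anc) V.B} {ρ : ℕ} (ht : t.ReadyBy S ρ) (q : E ⊕ A) :
      (V.instrs.foldl Instr.tick t).qubit (ι.sumMap e.toEmbedding q) ≤
        Sum.elim (fun _ => 1) (fun _ => 1 + K) q + ρ := by
    rw [hinstrs, foldl_tick_relabel _ g.injective]
    refine ((ι.sumMap e.toEmbedding).injective.extend_apply _ _ q).trans_le ?_
    have hcomap : t.comap (ι.sumMap e.toEmbedding) g ≤ (Clock.const _ _ 0).delay ρ :=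
      ⟨Sum.forall.2 ⟨fun i => (ht.data_le _ (hι i)).trans (Nat.le_add_left ..),
        fun a => (ht.anc_le _).trans (Nat.le_add_left ..)⟩,
        fun b => (ht.bit_le _).trans (Nat.le_add_left ..)⟩
    refine ((foldl_tick_mono l hcomap).1 q).trans ?_
    rw [foldl_tick_delay]
    exact Nat.add_le_add_right (hl q) ρ
  have heq (t : Clock (D ⊕ V.Anc) V.B) (d : D) (hd : d ∉ Set.range ι) :
      (V.instrs.foldl Instr.tick t).qubit (.inl d) = t.qubit (.inl d) := by
    rw [hinstrs, foldl_tick_relabel _ g.injective]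
    refine extend_apply' _ _ _ ?_
    rintro ⟨i | a, h⟩
    · exact hd ⟨i, Sum.inl_injective h⟩
    · exact Sum.inr_ne_inl h
  refine ⟨fun {t ρ} ht d hd => ?_, fun t d hd => heq t d ?_, fun {t ρ} ht a => ?_⟩
  · by_cases h : d ∈ Set.range ι
    · obtain ⟨i, rfl⟩ := h
      exact (hle ht (.inl i)).trans_eq (Nat.add_comm ..)
    · exact (heq t d h).trans_le ((ht.data_le d hd).trans (Nat.le_succ ρ))
  · rintro ⟨i, rfl⟩
    exact hd (hι i)
  · obtain ⟨a, rfl⟩ := e.surjective a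
    exact (hle ht (.inr a)).trans_eq ((Nat.add_comm ..).trans (Nat.add_assoc ..).symm)

namespace Evaluator

variable {E : Type} [Fintype E] [DecidableEq E] {f : (E → Bool) → Bool} {L N : ℕ}

theorem exists_circuit (C : Evaluator E f L N) {P : Circuit Unit} {γ δ : ℝ}
    (hP : P.Implements (phaseGate γ) δ) {D : Type} [Fintype D] [DecidableEq D] {S : Finset D}
    (ι : E ↪ D) (hι : ∀ i, ι i ∈ S) :
    ∃ V : Circuit D, V.ZRealizes (fun x => phase γ (f (x ∘ ι))) δ ∧
      V.size ≤ 2 * N + P.size + 3 ∧ V.Timed S (4 * L + P.logicalDepth) := by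
  obtain ⟨R, _, _, res, e, hinit, hcard⟩ :=
    C.supply.sum (IsSupply.plus.sum (IsSupply.of_circuit P))
  let V : Circuit D :=
    { R := R
      B := C.PhaseBit P
      fintypeR := inferInstance
      decEqR := inferInstance
      decEqB := inferInstance
      res := res
      instrs := (C.conditionalPhase P).map
        (Instr.relabel (ι.sumMap e.symm.toEmbedding) (Embedding.refl _)) }
  refine ⟨V, (C.diagRealizes_conditionalPhase P hP).zRealizes ι e.symm (Embedding.refl _) rfl
    fun s => ?_, ?_, Circuit.Timed.of_relabel ι e.symm (Embedding.refl _) rfl ?_ hι⟩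
  · exact (Finset.prod_congr rfl fun _ _ => by simp [V]).trans (hinit _).symm
  · have hlength := C.length_conditionalPhase_le P
    change Fintype.card R + ((C.conditionalPhase P).map _).length ≤ 2 * N + (_ + _) + 3
    rw [List.length_map]
    omega
  · refine (C.conditionalPhase_tick_le P).trans_eq ?_
    rw [show 2 * L + (P.logicalDepth + (1 + 2 * L)) = 1 + (4 * L + P.logicalDepth) by ring]

end Evaluator

/-! ### Clauses -/

theorem two_pow_clog_le (k : ℕ) : 2 ^ Nat.clog 2 k ≤ 2 * k + 1 := by
  obtain hk | hk := le_or_gt k 1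
  · rw [Nat.clog_of_right_le_one hk]
    exact Nat.le_add_left ..
  · have hlt := Nat.pow_pred_clog_lt_self one_lt_two hk
    rw [← Nat.succ_pred_eq_of_pos (Nat.clog_pos one_lt_two hk), pow_succ]
    omega

theorem Circuit.ZRealizes.const_mul {D : Type} [Fintype D] [DecidableEq D] {V : Circuit D}
    {u : (D → Bool) → ℂ} {δ : ℝ} (h : V.ZRealizes u δ) {ω : ℂ} (hω : ‖ω‖ = 1) :
    V.ZRealizes (fun x => ω * u x) δ :=
  h.imp fun _ h => h.const_mul hω

theorem Circuit.Timed.mono {D : Type} [DecidableEq D] {V : Circuit D} {S : Finset D} {K K' : ℕ}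
    (h : V.Timed S K) (hK : K ≤ K') : V.Timed S K' where
  data_le := h.data_le
  data_eq := h.data_eq
  anc_le ht a := (h.anc_le ht a).trans (Nat.add_le_add_left hK _)

namespace Clause

variable {n k : ℕ} (C : Clause n k)

/-- Whether no literal of the clause is true. -/
def falsified (x : Fin n → Bool) : Bool := decide (∀ i, x (C i).1 ≠ (C i).2)

theorem exp_value_eq (γ : ℝ) (x : Fin n → Bool) :
    Complex.exp (-Complex.I * γ * C.value x) =
      Complex.exp (-Complex.I * γ) * phase γ (C.falsified x) := by
  by_cases h : ∃ i, x (C i).1 = (C i).2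
  · have hfalsified : C.falsified x = false := by simpa [falsified] using h
    rw [value, if_pos h, hfalsified]
    simp [phase]
  · have hfalsified : C.falsified x = true := by simpa [falsified] using h
    rw [value, if_neg h, hfalsified, phase, if_pos rfl, ← Complex.exp_add]
    simp

theorem norm_exp_value (γ : ℝ) (x : Fin n → Bool) :
    ‖Complex.exp (-Complex.I * γ * C.value x)‖ = 1 := by
  simp [Complex.norm_exp]

theorem falsified_eq_false {i j : Fin k} (hvar : (C i).1 = (C j).1) (hsign : (C i).2 ≠ (C j).2)
    (x : Fin n → Bool) : C.falsified x = false := by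
  refine decide_eq_false fun h => hsign ?_
  rw [Bool.eq_not_of_ne (h i).symm, Bool.eq_not_of_ne (h j).symm, hvar]

theorem exists_sign (h : ∀ i j, (C i).1 = (C j).1 → (C i).2 = (C j).2) :
    ∃ b : Fin n → Bool, ∀ i, b (C i).1 = (C i).2 := by
  refine ⟨extend (fun i => (C i).1) (fun i => (C i).2) ⊥, fun i => ?_⟩
  exact FactorsThrough.extend_apply (fun i j => h i j) _ i

theorem literalConj_comp_eq_falsified {E : Type} [Fintype E] {ι : E ↪ Fin n}
    (hι : Set.range ι = C.qubits) {b : Fin n → Bool} (hb : ∀ i, b (C i).1 = (C i).2)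
    (x : Fin n → Bool) : literalConj (b ∘ ι) (x ∘ ι) = C.falsified x := by
  refine decide_eq_decide.2 ?_
  have hrange : (∀ e, x (ι e) ≠ b (ι e)) ↔ ∀ d ∈ C.qubits, x d ≠ b d := by
    rw [← Set.forall_mem_range (f := ι) (p := fun d => x d ≠ b d), hι]
    rfl
  simp only [comp_apply, bne_iff_ne, hrange, qubits, Finset.forall_mem_image, Finset.mem_univ,
    true_imp_iff, hb]

theorem exists_evaluator : ∃ (E : Type) (_ : Fintype E) (_ : DecidableEq E) (ι : E ↪ Fin n)
    (f : (E → Bool) → Bool) (L N : ℕ), (∀ e, ι e ∈ C.qubits) ∧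
      (∀ x, f (x ∘ ι) = C.falsified x) ∧ L ≤ Nat.clog 2 k ∧ N ≤ 62 * k + 4 ∧
      Nonempty (Evaluator E f L N) := by
  by_cases h : ∀ i j, (C i).1 = (C j).1 → (C i).2 = (C j).2
  · obtain ⟨b, hb⟩ := C.exists_sign h
    have hcard : C.qubits.card ≤ k := Finset.card_image_le.trans_eq (Finset.card_fin k)
    obtain ⟨E, _, _, ι, N, hι, hN, hC⟩ :=
      hasEvaluator_of_card_le (b := b) (hcard.trans (Nat.le_pow_clog one_lt_two k))
    refine ⟨E, _, _, ι, _, _, N, fun e => ?_, C.literalConj_comp_eq_falsified hι hb, le_rfl, ?_, hC⟩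
    · rw [← Finset.mem_coe, ← hι]
      exact Set.mem_range_self e
    · have hpow := two_pow_clog_le k
      omega
  · push Not at h
    obtain ⟨i, j, hvar, hsign⟩ := h
    exact ⟨Empty, inferInstance, inferInstance, .ofIsEmpty, _, 0, 4, fun e => e.elim,
      fun x => (C.falsified_eq_false hvar hsign x).symm, zero_le, Nat.le_add_left ..,
      ⟨.const false⟩⟩

theorem exists_circuit {P : Circuit Unit} {γ δ : ℝ} (hP : P.Implements (phaseGate γ) δ) :
    ∃ V : Circuit (Fin n),
      V.ZRealizes (fun x => Complex.exp (-Complex.I * γ * C.value x)) δ ∧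
      V.size ≤ 124 * (k + P.size + 1) ^ 124 ∧
      V.Timed C.qubits (4 * Nat.clog 2 k + P.logicalDepth) := by
  obtain ⟨E, _, _, ι, f, L, N, hι, hf, hL, hN, ⟨F⟩⟩ := C.exists_evaluator
  obtain ⟨V, hV, hsize, htime⟩ := F.exists_circuit hP ι hι
  refine ⟨V, ?_, ?_, htime.mono (by omega)⟩
  · have hω : ‖Complex.exp (-Complex.I * γ)‖ = 1 := by simp [Complex.norm_exp]
    simpa only [exp_value_eq, hf] using hV.const_mul hω
  · calc V.size
      _ ≤ 124 * (k + P.size + 1) := by omega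
      _ ≤ 124 * (k + P.size + 1) ^ 124 :=
        Nat.mul_le_mul_left _ (Nat.le_self_pow (by norm_num) _)

end Clause

theorem exists_part_index {m : ℕ} (parts : Finpartition (Finset.univ : Finset (Fin m))) :
    ∃ ρ : Fin m → ℕ, (∀ j, ρ j < parts.parts.card) ∧
      ∀ i j, ρ i = ρ j → ∃ S ∈ parts.parts, i ∈ S ∧ j ∈ S := by
  have hpart (j : Fin m) := parts.part_mem.2 (Finset.mem_univ j)
  have hmem (j : Fin m) := parts.mem_part_self.2 (Finset.mem_univ j)
  refine ⟨fun j => parts.parts.equivFin ⟨parts.part j, hpart j⟩, fun j => Fin.is_lt _,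
    fun i j h => ⟨parts.part i, hpart i, hmem i, ?_⟩⟩
  have heq : parts.part i = parts.part j :=
    congrArg Subtype.val (parts.parts.equivFin.injective (Fin.val_injective h))
  exact heq ▸ hmem j

end LatticeSurgery

theorem mainTheorem3 :
    ∃ A : ℕ, ∀ (n m k : ℕ) (γ δ : ℝ) (_hδ : 0 ≤ δ)
      (C : Fin m → LatticeSurgery.Clause n k)
      (parts : Finpartition (Finset.univ : Finset (Fin m)))
      (_hparts : ∀ S ∈ parts.parts, ∀ i ∈ S, ∀ j ∈ S, i ≠ j →
        Disjoint (C i).qubits (C j).qubits)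
      (P : LatticeSurgery.Circuit Unit)
      (_hP : P.Implements (LatticeSurgery.phaseGate γ) δ)
      (nP : ℕ) (_hnP : P.logicalDepth = nP),
      ∃ (V : Fin m → LatticeSurgery.Circuit (Fin n)) (σ : Equiv.Perm (Fin m)),
        (∀ j, (V j).ZEquivalent (LatticeSurgery.clauseUnitary γ (C j)) δ ∧
          (V j).size ≤ A * (k + P.size + 1) ^ A) ∧
        (LatticeSurgery.Circuit.product V σ).ZEquivalent (LatticeSurgery.phaser γ C) (m * δ) ∧
        (LatticeSurgery.Circuit.product V σ).logicalDepth ≤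
          parts.parts.card + nP + 4 * Nat.clog 2 k := by
  refine ⟨124, fun n m k γ δ hδ C parts hparts P hP nP hnP => ?_⟩
  choose V hV hsize htime using fun j => (C j).exists_circuit hP
  obtain ⟨ρ, hρ, hρ_eq⟩ := LatticeSurgery.exists_part_index parts
  have hdisjoint (i j : Fin m) (hij : i ≠ j) (h : ρ i = ρ j) :
      Disjoint (C i).qubits (C j).qubits := by
    obtain ⟨S, hS, hi, hj⟩ := hρ_eq i j h
    exact hparts S hS i hi j hj hij
  refine ⟨V, Tuple.sort ρ, fun j => ⟨(hV j).zEquivalent, hsize j⟩, ?_, ?_⟩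
  · have hproduct := LatticeSurgery.Circuit.ZRealizes.product hV
      (fun j => (C j).norm_exp_value γ) (fun _ => hδ) (Tuple.sort ρ)
    simp only [← Complex.exp_sum, ← Finset.mul_sum, Finset.sum_const, Finset.card_univ,
      Fintype.card_fin, nsmul_eq_mul] at hproduct
    exact hproduct.zEquivalent
  · have hdepth := LatticeSurgery.Circuit.logicalDepth_product_sort_le htime hρ hdisjoint
    omega
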